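/- Let $d\ge 1$ and let $|\cdot|$ be the Euclidean norm on $\mathbb R^d$. For $r\in\{1,2,3\}$ and $f:\mathbb R^d\to\mathbb R$ put $$M_r(f):=\sup_{x\ne y}\frac{|\nabla^{r-1}f(x)-\nabla^{r-1}f(y)|_\vee}{|x-y|}$$ if $f$ is $(r-1)$-times differentiable everywhere, and $M_r(f):=\infty$ otherwise; here $|\varphi|_\vee=\sup\{|\varphi(v_1,\dots,v_k)| : |v_1|,\dots,|v_k|\le 1\}$ is the injective norm of a $k$-linear form (so $M_1(f)$ is the best Lipschitz constant of $f$). Let $\mathcal N f:=\mathbb E f(Z)$ with $Z$ a standard $d$-variate normal vector, and use the convention $0\cdot\infty=0$. Let $\mathcal I$ be a countable set and let $X_i$, $i\in\mathcal I$, be independent $\mathbb R^d$-valued random vectors with $\mathbb E X_i=0$ and $\sum_{i\in\mathcal I}\mathbb E|X_i|^2<\infty$. Then the sum $W:=\sum_{i\in\mathcal I}X_i$ exists almost surely: there is a random vector $W$ such that, along every increasing sequence of finite sets with union $\mathcal I$, the partial sums converge to $W$ almost surely. Suppose in addition that $\operatorname{Var}(W)=\mathrm I_d$. Then the following hold for every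 $f:\mathbb R^d\to\mathbb R$. 1. If $M_3(f)<\infty$, then $\mathcal N|f|<\infty$ and $$|\mathbb E f(W)-\mathcal N f|\le \frac{M_3(f)}{2}\sum_{i\in\mathcal I}\mathbb E|X_i|^3 ,$$ where $\mathbb E|f(W)|<\infty$ whenever the right-hand side is finite (and the bound is understood to be void when the right-hand side is infinite). 2. If $M_2(f)<\infty$, then $\mathcal N|f|<\infty$, $\mathbb E|f(W)|<\infty$ and $$|\mathbb E f(W)-\mathcal N f|\le M_2(f)\sum_{i\in\mathcal I}\mathbb E\bigl[|X_i|^2\min\{2.5,\;0.94\,|X_i|\}\bigr].$$ 3. If $M_1(f)<\infty$, i.e. $f$ is Lipschitz, then $\mathcal N|f|<\infty$, $\mathbb E|f(W)|<\infty$ and $$|\mathbb E f(W)-\mathcal N f|\le M_1(f)\sum_{i\in\mathcal I}\mathbb E\bigl[|X_i|^2\min\{4.5,\;(11.1+0.83\log d)\,|X_i|\}\bigr].$$ -/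

import Mathlib

open MeasureTheory ProbabilityTheory Filter Topology
open scoped ENNReal

namespace LipCLT

/-- `f` is `k` times differentiable at every point: each derivative of order less than `k`
exists and is (Fréchet) differentiable everywhere. -/
def TimesDifferentiable {d : ℕ} (k : ℕ) (f : EuclideanSpace ℝ (Fin d) → ℝ) : Prop :=
  ∀ m : ℕ, m < k → Differentiable ℝ (iteratedFDeriv ℝ m f)

open Classical in
/-- The quantity `M_r(f)`, with values in `[0, ∞]`. `M_0(f)` is the supremum norm; for `r = k + 1`,
`M_r(f)` is the best Lipschitz constant of the `k`-th derivative of `f` if `f` is `k` times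
differentiable everywhere, and `∞` otherwise. The norm on `k`-linear forms is
`sup |φ(v₁, …, v_k)|` over `|v₁|, …, |v_k| ≤ 1`, which is the injective tensor norm. -/
noncomputable def M {d : ℕ} : ℕ → (EuclideanSpace ℝ (Fin d) → ℝ) → ℝ≥0∞
  | 0, f => ⨆ x, ‖f x‖ₑ
  | k + 1, f =>
    if TimesDifferentiable k f then
      ⨆ (x : EuclideanSpace ℝ (Fin d)) (y : EuclideanSpace ℝ (Fin d)) (_ : x ≠ y),
        ‖iteratedFDeriv ℝ k f x - iteratedFDeriv ℝ k f y‖ₑ / ‖x - y‖ₑ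
    else ∞

/-- An increasing sequence of finite sets whose union is the whole index set. -/
def Exhausts {ι : Type*} (s : ℕ → Finset ι) : Prop :=
  Monotone s ∧ ∀ i, ∃ n, i ∈ s n

/-- The partial sums of the family `X` over the finite sets `s n` converge to `W`
almost surely. -/
def ASSumAlong {Ω ι : Type*} {d : ℕ} [MeasurableSpace Ω] (P : Measure Ω)
    (X : ι → Ω → EuclideanSpace ℝ (Fin d)) (s : ℕ → Finset ι)
    (W : Ω → EuclideanSpace ℝ (Fin d)) : Prop :=
  ∀ᵐ ω ∂P, Tendsto (fun n => ∑ i ∈ s n, X i ω) atTop (𝓝 (W ω))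

end LipCLT

/-!
The statement is a quantitative central limit theorem, with rates depending on the smoothness of the
test function. The argument is a Lindeberg-type interpolation combined with Gaussian integration
by parts.

For finitely many summands (`IsStdSum`), the curve `θ ↦ E f(sin θ W + cos θ Z)` (`interp`) joins the
Gaussian mean of `f` to `E f(W)`. Its derivative contains a term with `W = ∑ X i` and a term with
`Z`. Integration by parts turns the latter into a Laplacian, which is distributed over the summands
because their covariances add up to the identity. The derivative thus becomes a sum of second-order
Taylor remainders of the test function averaged over `W - X i` and over a Gaussian perturbation of
size `c = cos θ`, one for each summand (`IsStdSum.abs_deriv_interp_le`). A remainder is small if the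
averaged Hessian (`smoothedHess`) is bounded or Lipschitz, and integration by parts against the
Gaussian density trades each missing derivative of `f` for a factor `1 / c`.

* If `D²f` is Lipschitz, no smoothing is needed, and `∫ sin² cos = 1 / 3` gives the constant `1 / 2`.
* If `Df` is Lipschitz, the Hessian is bounded and its smoothing is Lipschitz with constant
  proportional to `1 / c`, which `sin² θ` makes integrable. Taking the better of the two bounds for
  each pair of values of the summand and of an independent copy gives the truncated third moment.
* If `f` is only Lipschitz, the smoothed Hessian has a Lipschitz constant of order `1 / c²`, which
  is not integrable down to `c = 0`. The improvement comes from the average over `W - X i`: if that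
  vector were Gaussian, the perturbation would have unit size, and the error made by pretending so
  is the Wasserstein distance `Δ` from `W` to `Z` times a Lipschitz constant of order `1 / c³`
  (`IsStdSum.abs_integral_smoothedHess_sub_le_bootstrap`). The interpolation is stopped at a value of
  `cos θ` proportional to `Δ / √d`, which is where the term `log d` comes from. The resulting
  inequality bounds `Δ` by a small multiple of itself plus truncated moments
  (`IsStdSum.abs_sub_le_bootstrap`), and can be solved for `Δ` because `Δ` is known to be finite
  (`IsStdSum.wassersteinLE`).

Test functions with fewer than two continuous derivatives are mollified, which preserves the
Lipschitz constants (`exists_C2Growth_of_lipschitz`, `exists_C2Growth_of_lipschitz_fderiv`).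

The countable sum exists by martingale convergence, and its limit does not depend on the exhaustion
because the second moment of the remainder is bounded by the tail of the series of second moments.
The error bounds carry over by treating the remainder `W - ∑ i ∈ t, X i` as one more summand of a
finite family (`truncFamily`): its truncated moments tend to zero, and so do its third moments if
the third moments of the `X i` are summable.
-/

set_option linter.unusedSectionVars false

namespace LipCLT

/-! ### The standard Gaussian measure: integration by parts, rotations and moments -/

lemma hasDerivAt_gaussianPDFReal (x : ℝ) :
    HasDerivAt (gaussianPDFReal 0 1) (-(x * gaussianPDFReal 0 1 x)) x := by
  have h : HasDerivAt (fun x : ℝ => (Real.sqrt (2 * Real.pi * (1 : NNReal)))⁻¹ *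
      Real.exp (-(x - 0) ^ 2 / (2 * (1 : NNReal)))) _ x :=
    (((((hasDerivAt_id x).sub_const 0).pow 2).neg.div_const _).exp).const_mul _
  rw [gaussianPDFReal_def]
  convert! h using 1
  simp
  ring

/-- One-dimensional Gaussian integration by parts, from `φ' x = -x φ x` for the density `φ`. -/
lemma integral_deriv_gaussianReal {u u' : ℝ → ℝ} (hu : ∀ x, HasDerivAt u (u' x) x)
    (h1 : Integrable u (gaussianReal 0 1)) (h2 : Integrable u' (gaussianReal 0 1))
    (h3 : Integrable (fun x => x * u x) (gaussianReal 0 1)) :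
    ∫ x, u' x ∂(gaussianReal 0 1) = ∫ x, x * u x ∂(gaussianReal 0 1) := by
  have key : ∀ g : ℝ → ℝ, Integrable g (gaussianReal 0 1) →
      Integrable (fun x => gaussianPDFReal 0 1 x * g x) := by
    intro g hg
    rw [gaussianReal_of_var_ne_zero _ one_ne_zero, integrable_withDensity_iff_integrable_smul'
      (measurable_gaussianPDF 0 1) (ae_of_all _ fun x => gaussianPDF_lt_top)] at hg
    simpa [toReal_gaussianPDF, smul_eq_mul] using hg
  rw [integral_gaussianReal_eq_integral_smul one_ne_zero,
    integral_gaussianReal_eq_integral_smul one_ne_zero]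
  simp only [smul_eq_mul]
  rw [integral_mul_deriv_eq_deriv_mul_of_integrable (u := gaussianPDFReal 0 1) (v := u)
    (u' := fun x => -(x * gaussianPDFReal 0 1 x)) (v' := u') (fun x _ => hasDerivAt_gaussianPDFReal x)
    (fun x _ => hu x)
    (key _ h2) ?_ (key _ h1), ← integral_neg]
  · refine integral_congr_ae (ae_of_all _ fun x => ?_)
    simp only; ring
  · refine (key _ h3).neg.congr (ae_of_all _ fun x => ?_)
    simp only [Pi.mul_apply, Pi.neg_apply]; ring

lemma integral_abs_gaussianReal : ∫ x, |x| ∂(gaussianReal 0 1) = √(2 / Real.pi) := by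
  rw [integral_gaussianReal_eq_integral_smul one_ne_zero]
  simp only [smul_eq_mul]
  have e : ∀ x : ℝ, gaussianPDFReal 0 1 x * |x| = gaussianPDFReal 0 1 |x| * |x| := by
    intro x; simp [gaussianPDFReal_def]
  simp_rw [e]
  rw [integral_comp_abs (f := fun x => gaussianPDFReal 0 1 x * x)]
  have hd : ∀ x : ℝ, HasDerivAt (fun x => -gaussianPDFReal 0 1 x) (gaussianPDFReal 0 1 x * x) x := by
    intro x
    convert! (hasDerivAt_gaussianPDFReal x).neg using 1
    ring
  have hcont : Continuous (gaussianPDFReal 0 1) :=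
    continuous_iff_continuousAt.2 fun x => (hasDerivAt_gaussianPDFReal x).continuousAt
  have ht : Tendsto (fun x => -gaussianPDFReal 0 1 x) atTop (𝓝 0) := by
    have : Tendsto (fun x : ℝ => -((Real.sqrt (2 * Real.pi))⁻¹ * Real.exp (-(x ^ 2 / 2)))) atTop
        (𝓝 (-((Real.sqrt (2 * Real.pi))⁻¹ * 0))) := by
      refine (Tendsto.const_mul _ (Real.tendsto_exp_neg_atTop_nhds_zero.comp ?_)).neg
      exact (tendsto_pow_atTop two_ne_zero).atTop_div_const (by norm_num)
    simp only [mul_zero, neg_zero] at this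
    refine this.congr fun x => ?_
    simp only [gaussianPDFReal_def, NNReal.coe_one, mul_one, sub_zero, neg_div]
  have h0 : gaussianPDFReal 0 1 0 = (√(2 * Real.pi))⁻¹ := by simp [gaussianPDFReal_def]
  rw [integral_Ioi_of_hasDerivAt_of_nonneg (hcont.neg.continuousWithinAt) (fun x _ => hd x)
    (fun x hx => mul_nonneg (gaussianPDFReal_nonneg _ _ _) (le_of_lt hx)) ht]
  simp only [Pi.neg_apply, h0, zero_sub, neg_neg]
  rw [Real.sqrt_mul (by norm_num), Real.sqrt_div (by norm_num)]
  have h2 : √2 * √2 = 2 := Real.mul_self_sqrt (by norm_num)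
  have : √2 ≠ 0 := by positivity
  have : √Real.pi ≠ 0 := by positivity
  field_simp
  linarith

lemma integrable_pow_gaussianReal (k : ℕ) : Integrable (fun x => x ^ k) (gaussianReal 0 1) := by
  rcases eq_or_ne k 0 with rfl | hk
  · simp
  have h : MemLp (fun z : ℝ => z) (k : ℝ≥0∞) (gaussianReal 0 1) :=
    IsGaussian.memLp_id (gaussianReal 0 1) k (by simp)
  refine (h.integrable_norm_pow hk).mono (by fun_prop) (ae_of_all _ fun z => ?_)
  simp

lemma integral_sq_gaussianReal : ∫ x, x ^ 2 ∂(gaussianReal 0 1) = 1 := by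
  have h := integral_deriv_gaussianReal (u := fun x => x) (u' := fun _ => 1)
    (fun x => hasDerivAt_id x) (by simpa using integrable_pow_gaussianReal 1)
    (integrable_const _) (by simpa [sq] using integrable_pow_gaussianReal 2)
  simp only [integral_const, probReal_univ, smul_eq_mul, mul_one] at h
  rw [h]
  simp_rw [sq]

/-- The exact value is `4 φ 1`, with `φ` the standard normal density. -/
lemma integral_abs_sq_sub_one_gaussianReal_le : ∫ x, |x ^ 2 - 1| ∂(gaussianReal 0 1) ≤ 1 := by
  have e : ∀ x : ℝ, |x ^ 2 - 1| = (x ^ 2 - 1) + 2 * (Set.Ioc (-1 : ℝ) 1).indicator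
      (fun x => 1 - x ^ 2) x := by
    intro x
    by_cases hx : x ∈ Set.Ioc (-1 : ℝ) 1
    · rw [Set.indicator_of_mem hx, abs_of_nonpos (by nlinarith [hx.1, hx.2])]; ring
    · rw [Set.indicator_of_notMem hx, abs_of_nonneg]
      · ring
      · by_contra! h
        have := abs_lt.1 ((sq_lt_one_iff_abs_lt_one x).1 (by linarith))
        exact hx ⟨this.1, this.2.le⟩
  have i2 : Integrable (fun x : ℝ => 1 - x ^ 2) (gaussianReal 0 1) :=
    (integrable_const 1).sub (integrable_pow_gaussianReal 2)
  have i3 : Integrable (fun x : ℝ => x ^ 2 - 1) (gaussianReal 0 1) :=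
    (integrable_pow_gaussianReal 2).sub (integrable_const 1)
  simp_rw [e]
  rw [integral_add i3
    ((i2.indicator measurableSet_Ioc).const_mul 2),
    integral_sub (integrable_pow_gaussianReal 2) (integrable_const 1), integral_sq_gaussianReal,
    integral_const_mul, integral_gaussianReal_eq_integral_smul
      (f := (Set.Ioc (-1 : ℝ) 1).indicator fun x => 1 - x ^ 2) one_ne_zero]
  have e2 : ∀ x : ℝ, gaussianPDFReal 0 1 x • (Set.Ioc (-1 : ℝ) 1).indicator
      (fun x => 1 - x ^ 2) x = (Set.Ioc (-1 : ℝ) 1).indicator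
      (fun x => gaussianPDFReal 0 1 x * (1 - x ^ 2)) x := by
    intro x
    simp only [smul_eq_mul]
    rw [Set.indicator_mul_right]
  simp_rw [e2]
  have hd : ∀ x : ℝ, HasDerivAt (fun x => x * gaussianPDFReal 0 1 x)
      (gaussianPDFReal 0 1 x * (1 - x ^ 2)) x := by
    intro x
    convert! (hasDerivAt_id x).mul (hasDerivAt_gaussianPDFReal x) using 1
    simp
    ring
  have hcont : Continuous (gaussianPDFReal 0 1) :=
    continuous_iff_continuousAt.2 fun x => (hasDerivAt_gaussianPDFReal x).continuousAt
  rw [integral_indicator measurableSet_Ioc, ← intervalIntegral.integral_of_le (by norm_num),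
    intervalIntegral.integral_eq_sub_of_hasDerivAt (fun x _ => hd x)
      (Continuous.intervalIntegrable (by fun_prop) _ _)]
  have h1 : gaussianPDFReal 0 1 1 ≤ 1 / 4 := by
    rw [gaussianPDFReal_def]
    simp only [NNReal.coe_one, mul_one, sub_zero, one_pow]
    rw [show (-1 / 2 : ℝ) = -(1 / 2) by norm_num, Real.exp_neg, ← mul_inv,
      show (1 / 4 : ℝ) = 4⁻¹ by norm_num]
    refine inv_anti₀ (by norm_num) ?_
    rw [Real.exp_half, ← Real.sqrt_mul (by positivity)]
    refine Real.le_sqrt_of_sq_le ?_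
    have := Real.exp_one_gt_d9
    have := Real.pi_gt_three
    nlinarith
  have h2 : gaussianPDFReal 0 1 (-1) = gaussianPDFReal 0 1 1 := by
    simp [gaussianPDFReal_def]
  rw [h2]
  simp only [integral_const, probReal_univ, smul_eq_mul]
  linarith

section Gaussian

variable {E : Type*} [NormedAddCommGroup E] [InnerProductSpace ℝ E] [FiniteDimensional ℝ E]
  [MeasurableSpace E] [BorelSpace E]

lemma integrable_norm_pow_stdGaussian (k : ℕ) : Integrable (fun z => (1 + ‖z‖) ^ k) (stdGaussian E) := by
  rcases eq_or_ne k 0 with rfl | hk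
  · simp
  have h : MemLp (fun z : E => 1 + ‖z‖) (k : ℝ≥0∞) (stdGaussian E) :=
    (memLp_const (1 : ℝ)).add (IsGaussian.memLp_id (stdGaussian E) k (by simp)).norm
  refine (h.integrable_norm_pow hk).congr (ae_of_all _ fun z => ?_)
  simp only [Real.norm_eq_abs]
  rw [abs_of_nonneg (by positivity)]

lemma integrable_stdGaussian_of_le {F : Type*} [NormedAddCommGroup F] {g : E → F}
    (hg : AEStronglyMeasurable g (stdGaussian E)) (C : ℝ) (k : ℕ) (h : ∀ z, ‖g z‖ ≤ C * (1 + ‖z‖) ^ k) :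
    Integrable g (stdGaussian E) :=
  ((integrable_norm_pow_stdGaussian k).const_mul C).mono' hg (ae_of_all _ h)

/-- Replacing the component of a standard Gaussian vector in a unit direction `y` by an independent
standard normal variable does not change its law. -/
lemma map_replace_component_stdGaussian {y : E} (hy : ‖y‖ = 1) :
    ((gaussianReal 0 1).prod (stdGaussian E)).map (fun p => p.2 + (p.1 - inner ℝ y p.2) • y) = (stdGaussian E) := by
  have hm : Measurable (fun p : ℝ × E => p.2 + (p.1 - inner ℝ y p.2) • y) :=
    Continuous.measurable (by fun_prop)
  have : IsProbabilityMeasure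
      (((gaussianReal 0 1).prod (stdGaussian E)).map (fun p => p.2 + (p.1 - inner ℝ y p.2) • y)) :=
    Measure.isProbabilityMeasure_map hm.aemeasurable
  refine Measure.ext_of_charFun ?_
  ext t
  rw [charFun_stdGaussian, charFun_apply, integral_map hm.aemeasurable
    (Continuous.aestronglyMeasurable (by fun_prop))]
  have e : ∀ p : ℝ × E, Complex.exp (↑(inner ℝ (p.2 + (p.1 - inner ℝ y p.2) • y) t) * Complex.I)
      = Complex.exp (↑(inner ℝ p.1 (inner ℝ y t)) * Complex.I) *
        Complex.exp (↑(inner ℝ p.2 (t - (inner ℝ y t : ℝ) • y)) * Complex.I) := by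
    intro p
    rw [← Complex.exp_add]
    congr 1
    simp only [inner_add_left, inner_smul_left, inner_sub_right, inner_smul_right, RCLike.inner_apply]
    rw [real_inner_comm y p.2]
    simp
    ring
  simp_rw [e]
  rw [integral_prod_mul (fun x : ℝ => Complex.exp (↑(inner ℝ x (inner ℝ y t)) * Complex.I))
    (fun z : E => Complex.exp (↑(inner ℝ z (t - (inner ℝ y t : ℝ) • y)) * Complex.I)),
    ← charFun_apply, ← charFun_apply, charFun_gaussianReal, charFun_stdGaussian, ← Complex.exp_add]
  congr 1
  have h2 : ‖t - (inner ℝ y t : ℝ) • y‖ ^ 2 = ‖t‖ ^ 2 - (inner ℝ y t : ℝ) ^ 2 := by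
    rw [norm_sub_sq_real, norm_smul, inner_smul_right, hy, real_inner_comm]
    simp only [Real.norm_eq_abs, mul_one, sq_abs]; ring
  rw [← Complex.ofReal_pow ‖t - _‖, h2]
  push_cast
  ring

/-- Gaussian integration by parts in the direction `y`. -/
lemma integral_fderiv_stdGaussian {F : E → ℝ} {F' : E → E →L[ℝ] ℝ} (y : E)
    (hF : ∀ z, HasFDerivAt F (F' z) z) (h1 : Integrable F (stdGaussian E))
    (h2 : Integrable (fun z => F' z y) (stdGaussian E)) (h3 : Integrable (fun z => inner ℝ y z * F z) (stdGaussian E)) :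
    ∫ z, F' z y ∂(stdGaussian E) = ∫ z, inner ℝ y z * F z ∂(stdGaussian E) := by
  -- the unit-vector case, where the Gaussian component along `y` is isolated
  have main : ∀ y : E, ‖y‖ = 1 → Integrable (fun z => F' z y) (stdGaussian E) →
      Integrable (fun z => inner ℝ y z * F z) (stdGaussian E) →
      ∫ z, F' z y ∂(stdGaussian E) = ∫ z, inner ℝ y z * F z ∂(stdGaussian E) := by
    intro y hy h2 h3
    have hm : Measurable (fun p : ℝ × E => p.2 + (p.1 - inner ℝ y p.2) • y) :=
      Continuous.measurable (by fun_prop)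
    have hmap := map_replace_component_stdGaussian hy
    have tr : ∀ g : E → ℝ, Integrable g (stdGaussian E) →
        Integrable (fun p : ℝ × E => g (p.2 + (p.1 - inner ℝ y p.2) • y))
          ((gaussianReal 0 1).prod (stdGaussian E)) ∧
        ∫ z, g z ∂(stdGaussian E) = ∫ z, ∫ x, g (z + (x - inner ℝ y z) • y) ∂(gaussianReal 0 1) ∂(stdGaussian E) := by
      intro g hg
      have hg' : Integrable g (((gaussianReal 0 1).prod (stdGaussian E)).map
          (fun p => p.2 + (p.1 - inner ℝ y p.2) • y)) := by rw [hmap]; exact hg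
      have hi := (integrable_map_measure hg'.aestronglyMeasurable hm.aemeasurable).1 hg'
      refine ⟨hi, ?_⟩
      conv_lhs => rw [← hmap]
      rw [integral_map hm.aemeasurable hg'.aestronglyMeasurable]
      exact integral_prod_symm _ hi
    have t1 := tr _ h1
    have t2 := tr _ h2
    have t3 := tr _ h3
    rw [t2.2, t3.2]
    refine integral_congr_ae ?_
    filter_upwards [t1.1.prod_left_ae, t2.1.prod_left_ae, t3.1.prod_left_ae] with z i1 i2 i3
    have hin : ∀ x : ℝ, inner ℝ y (z + (x - inner ℝ y z) • y) = x := by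
      intro x
      rw [inner_add_right, inner_smul_right, real_inner_self_eq_norm_sq, hy]; ring
    simp only [hin] at i3 ⊢
    refine integral_deriv_gaussianReal (fun x => ?_) i1 i2 i3
    have hl : HasDerivAt (fun x : ℝ => z + (x - inner ℝ y z) • y) y x := by
      simpa using! (((hasDerivAt_id x).sub_const (inner ℝ y z : ℝ)).smul_const y).const_add z
    exact (hF _).comp_hasDerivAt x hl
  rcases eq_or_ne y 0 with rfl | hy
  · simp
  have hn : ‖y‖ ≠ 0 := by simpa using hy
  have h2' : Integrable (fun z => F' z ((‖y‖⁻¹ : ℝ) • y)) (stdGaussian E) := by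
    simpa [map_smul] using h2.const_mul ‖y‖⁻¹
  have h3' : Integrable (fun z => inner ℝ ((‖y‖⁻¹ : ℝ) • y) z * F z) (stdGaussian E) := by
    simpa [inner_smul_left, mul_assoc] using h3.const_mul ‖y‖⁻¹
  have h := main ((‖y‖⁻¹ : ℝ) • y) (by rw [norm_smul, norm_inv, norm_norm, inv_mul_cancel₀ hn])
    h2' h3'
  simp only [map_smul, smul_eq_mul, inner_smul_left, mul_assoc, integral_const_mul] at h
  simpa [hn] using h

/-- Rotation invariance: `a Z + b Z'` is standard Gaussian when `a² + b² = 1`. -/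
lemma map_rotation_stdGaussian {a b : ℝ} (h : a ^ 2 + b ^ 2 = 1) :
    ((stdGaussian E).prod (stdGaussian E)).map (fun p => a • p.1 + b • p.2) = (stdGaussian E) := by
  have hm : Measurable (fun p : E × E => a • p.1 + b • p.2) :=
    Continuous.measurable (by fun_prop)
  have : IsProbabilityMeasure (((stdGaussian E).prod (stdGaussian E)).map (fun p : E × E => a • p.1 + b • p.2)) :=
    Measure.isProbabilityMeasure_map hm.aemeasurable
  refine Measure.ext_of_charFun ?_
  ext t
  rw [charFun_stdGaussian, charFun_apply, integral_map hm.aemeasurable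
    (Continuous.aestronglyMeasurable (by fun_prop))]
  have e : ∀ p : E × E, Complex.exp (↑(inner ℝ (a • p.1 + b • p.2) t) * Complex.I)
      = Complex.exp (↑(inner ℝ p.1 (a • t)) * Complex.I) *
        Complex.exp (↑(inner ℝ p.2 (b • t)) * Complex.I) := by
    intro p
    rw [← Complex.exp_add]
    congr 1
    simp only [inner_add_left, inner_smul_left, inner_smul_right]
    simp
    ring
  simp_rw [e]
  rw [integral_prod_mul (fun x : E => Complex.exp (↑(inner ℝ x (a • t)) * Complex.I))
    (fun z : E => Complex.exp (↑(inner ℝ z (b • t)) * Complex.I)),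
    ← charFun_apply, ← charFun_apply, charFun_stdGaussian, charFun_stdGaussian, ← Complex.exp_add]
  congr 1
  rw [← Complex.ofReal_pow, ← Complex.ofReal_pow, norm_smul, norm_smul, mul_pow, mul_pow]
  simp only [Real.norm_eq_abs, sq_abs]
  have h' : ((a ^ 2 + b ^ 2 : ℝ) : ℂ) = 1 := by rw [h]; simp
  push_cast at h' ⊢
  linear_combination (-(‖t‖ : ℂ) ^ 2 / 2) * h'

lemma integral_rotation_stdGaussian {F : Type*} [NormedAddCommGroup F] [NormedSpace ℝ F]
    {a b : ℝ} (h : a ^ 2 + b ^ 2 = 1) {g : E → F} (hg : Integrable g (stdGaussian E)) :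
    Integrable (fun p : E × E => g (a • p.1 + b • p.2)) ((stdGaussian E).prod (stdGaussian E)) ∧
    ∫ z, ∫ z', g (a • z + b • z') ∂(stdGaussian E) ∂(stdGaussian E) = ∫ z, g z ∂(stdGaussian E) := by
  have hm : Measurable (fun p : E × E => a • p.1 + b • p.2) :=
    Continuous.measurable (by fun_prop)
  have hg' : Integrable g (((stdGaussian E).prod (stdGaussian E)).map (fun p : E × E => a • p.1 + b • p.2)) := by
    rw [map_rotation_stdGaussian h]; exact hg
  have hi := (integrable_map_measure hg'.aestronglyMeasurable hm.aemeasurable).1 hg'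
  refine ⟨hi, ?_⟩
  conv_rhs => rw [← map_rotation_stdGaussian h]
  rw [integral_map hm.aemeasurable hg'.aestronglyMeasurable]
  exact (integral_prod _ hi).symm

/-- The law of a linear functional `⟪y, Z⟫` with `‖y‖ = 1`. -/
lemma map_inner_stdGaussian {y : E} (hy : ‖y‖ = 1) :
    (stdGaussian E).map (fun z => inner ℝ y z) = gaussianReal 0 1 := by
  have hm : Measurable (fun z : E => (inner ℝ y z : ℝ)) := Continuous.measurable (by fun_prop)
  have : IsProbabilityMeasure ((stdGaussian E).map (fun z : E => (inner ℝ y z : ℝ))) :=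
    Measure.isProbabilityMeasure_map hm.aemeasurable
  refine Measure.ext_of_charFun ?_
  ext t
  rw [charFun_apply, integral_map hm.aemeasurable
    (Continuous.aestronglyMeasurable (by fun_prop)), charFun_gaussianReal]
  have e : ∀ z : E, Complex.exp (↑(inner ℝ (inner ℝ y z : ℝ) t) * Complex.I)
      = Complex.exp (↑(inner ℝ z (t • y)) * Complex.I) := by
    intro z
    simp only [inner_smul_right, RCLike.inner_apply, real_inner_comm y z]
    simp
  simp_rw [e]
  rw [← charFun_apply, charFun_stdGaussian, norm_smul, hy]
  congr 1
  rw [← Complex.ofReal_pow, mul_pow]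
  simp only [Real.norm_eq_abs, sq_abs]
  push_cast
  simp
  ring

lemma integral_comp_inner_stdGaussian {g : ℝ → ℝ} (hg : Continuous g) {y : E} (hy : ‖y‖ = 1) :
    ∫ z, g (inner ℝ y z) ∂(stdGaussian E) = ∫ x, g x ∂(gaussianReal 0 1) := by
  rw [← map_inner_stdGaussian hy, integral_map (Continuous.aemeasurable (by fun_prop))
    hg.aestronglyMeasurable]

lemma integral_abs_inner_stdGaussian (y : E) :
    ∫ z, |inner ℝ y z| ∂(stdGaussian E) = √(2 / Real.pi) * ‖y‖ := by
  rcases eq_or_ne y 0 with rfl | hy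
  · simp
  have hn : ‖y‖ ≠ 0 := by simpa using hy
  have h := integral_comp_inner_stdGaussian (g := fun x => |x|) continuous_abs
    (y := (‖y‖⁻¹ : ℝ) • y) (by rw [norm_smul, norm_inv, norm_norm, inv_mul_cancel₀ hn])
  rw [integral_abs_gaussianReal] at h
  simp only [inner_smul_left, abs_mul, integral_const_mul] at h
  rw [← h]
  simp
  field_simp

lemma integral_abs_inner_sq_sub_stdGaussian_le (y : E) :
    ∫ z, |inner ℝ y z ^ 2 - ‖y‖ ^ 2| ∂(stdGaussian E) ≤ ‖y‖ ^ 2 := by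
  rcases eq_or_ne y 0 with rfl | hy
  · simp
  have hn : ‖y‖ ≠ 0 := by simpa using hy
  have h := integral_comp_inner_stdGaussian (g := fun x => |x ^ 2 - 1|) (by fun_prop)
    (y := (‖y‖⁻¹ : ℝ) • y) (by rw [norm_smul, norm_inv, norm_norm, inv_mul_cancel₀ hn])
  have h1 := integral_abs_sq_sub_one_gaussianReal_le
  rw [← h] at h1
  have e : ∀ z : E, |inner ℝ y z ^ 2 - ‖y‖ ^ 2| =
      ‖y‖ ^ 2 * |inner ℝ ((‖y‖⁻¹ : ℝ) • y) z ^ 2 - 1| := by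
    intro z
    rw [← abs_of_nonneg (sq_nonneg ‖y‖), ← abs_mul, abs_of_nonneg (sq_nonneg ‖y‖)]
    simp only [inner_smul_left]
    congr 1
    simp
    field_simp
  simp_rw [e]
  rw [integral_const_mul]
  exact mul_le_of_le_one_right (by positivity) h1

lemma integral_norm_stdGaussian_le :
    ∫ z, ‖z‖ ∂(stdGaussian E) ≤ √(Module.finrank ℝ E) := by
  have i2 : Integrable (fun z : E => ‖z‖ ^ 2) (stdGaussian E) :=
    integrable_stdGaussian_of_le (by fun_prop) 1 2 fun z => by
      rw [Real.norm_eq_abs, abs_of_nonneg (by positivity)]; nlinarith [norm_nonneg z]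
  have h2 : ∫ z, ‖z‖ ^ 2 ∂(stdGaussian E) = Module.finrank ℝ E := by
    have e : ∀ z : E, ‖z‖ ^ 2 = ∑ i, inner ℝ (stdOrthonormalBasis ℝ E i) z ^ 2 := fun z =>
      ((stdOrthonormalBasis ℝ E).sum_sq_inner_right z).symm
    have hb : ∀ i, ‖stdOrthonormalBasis ℝ E i‖ = 1 := (stdOrthonormalBasis ℝ E).norm_eq_one
    simp_rw [e]
    rw [integral_finsetSum]
    · simp_rw [integral_comp_inner_stdGaussian (g := fun x => x ^ 2) (by fun_prop) (hb _),
        integral_sq_gaussianReal]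
      simp
    · intro i _
      refine i2.mono' (by fun_prop) (ae_of_all _ fun z => ?_)
      rw [Real.norm_eq_abs, abs_of_nonneg (by positivity), ← sq_abs]
      have := abs_real_inner_le_norm (stdOrthonormalBasis ℝ E i) z
      rw [hb, one_mul] at this
      exact pow_le_pow_left₀ (abs_nonneg _) this 2
  refine Real.le_sqrt_of_sq_le ?_
  rw [← h2]
  have hm : MemLp (fun z : E => ‖z‖) 2 (stdGaussian E) :=
    (IsGaussian.memLp_id (stdGaussian E) 2 (by simp)).norm
  have hv := variance_eq_sub hm
  have := variance_nonneg (fun z : E => ‖z‖) (stdGaussian E)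
  simp only [Pi.pow_apply] at hv
  linarith

end Gaussian

/-! ### Functions of polynomial growth and differentiation under the integral -/

section Growth

variable {E F : Type*} [NormedAddCommGroup E] [InnerProductSpace ℝ E] [NormedAddCommGroup F]
  [NormedSpace ℝ F]

/-- A continuous function with at most polynomial growth. -/
structure PolyBdd (g : E → F) : Prop where
  cont : Continuous g
  bdd : ∃ C : ℝ, ∃ k : ℕ, 0 ≤ C ∧ ∀ z, ‖g z‖ ≤ C * (1 + ‖z‖) ^ k

lemma PolyBdd.comp_affine {g : E → F} (hg : PolyBdd g) (a : E) (c : ℝ) :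
    PolyBdd fun z => g (a + c • z) := by
  obtain ⟨C, k, hC, h⟩ := hg.bdd
  refine ⟨hg.cont.comp (by fun_prop), C * (1 + ‖a‖ + |c|) ^ k, k, by positivity, fun z => ?_⟩
  refine (h _).trans ?_
  rw [mul_assoc, ← mul_pow]
  have : ‖a + c • z‖ ≤ ‖a‖ + |c| * ‖z‖ := by
    simpa [norm_smul] using norm_add_le a (c • z)
  have h2 : 1 + ‖a + c • z‖ ≤ (1 + ‖a‖ + |c|) * (1 + ‖z‖) := by
    nlinarith [norm_nonneg z, norm_nonneg a, abs_nonneg c, mul_nonneg (norm_nonneg a) (norm_nonneg z)]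
  gcongr

lemma PolyBdd.smul {f : E → ℝ} {g : E → F} (hf : PolyBdd f) (hg : PolyBdd g) :
    PolyBdd fun z => f z • g z := by
  obtain ⟨C, k, hC, h⟩ := hf.bdd
  obtain ⟨D, l, hD, h'⟩ := hg.bdd
  refine ⟨hf.cont.smul hg.cont, C * D, k + l, by positivity, fun z => ?_⟩
  rw [norm_smul]
  calc ‖f z‖ * ‖g z‖ ≤ (C * (1 + ‖z‖) ^ k) * (D * (1 + ‖z‖) ^ l) := by
        gcongr
        exacts [h z, h' z]
    _ = _ := by rw [pow_add]; ring

lemma PolyBdd.mul {f g : E → ℝ} (hf : PolyBdd f) (hg : PolyBdd g) :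
    PolyBdd fun z => f z * g z := hf.smul hg

lemma PolyBdd.sub {f g : E → F} (hf : PolyBdd f) (hg : PolyBdd g) :
    PolyBdd fun z => f z - g z := by
  obtain ⟨C, k, hC, h⟩ := hf.bdd
  obtain ⟨D, l, hD, h'⟩ := hg.bdd
  refine ⟨hf.cont.sub hg.cont, C + D, k + l, by positivity, fun z => ?_⟩
  have h1 : (1 + ‖z‖) ^ k ≤ (1 + ‖z‖) ^ (k + l) :=
    pow_le_pow_right₀ (by simp) (by omega)
  have h2 : (1 + ‖z‖) ^ l ≤ (1 + ‖z‖) ^ (k + l) :=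
    pow_le_pow_right₀ (by simp) (by omega)
  calc ‖f z - g z‖ ≤ ‖f z‖ + ‖g z‖ := norm_sub_le _ _
    _ ≤ C * (1 + ‖z‖) ^ (k + l) + D * (1 + ‖z‖) ^ (k + l) :=
        add_le_add ((h z).trans (by gcongr)) ((h' z).trans (by gcongr))
    _ = _ := by ring

lemma PolyBdd.norm {f : E → F} (hf : PolyBdd f) : PolyBdd fun z => ‖f z‖ := by
  obtain ⟨C, k, hC, h⟩ := hf.bdd
  exact ⟨hf.cont.norm, C, k, hC, fun z => by simpa using h z⟩

lemma PolyBdd.abs {f : E → ℝ} (hf : PolyBdd f) : PolyBdd fun z => |f z| := hf.norm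

lemma PolyBdd.clm_apply {G : Type*} [NormedAddCommGroup G] [NormedSpace ℝ G]
    {g : E → G →L[ℝ] F} (hg : PolyBdd g) (x : G) : PolyBdd fun z => g z x := by
  obtain ⟨C, k, hC, h⟩ := hg.bdd
  refine ⟨hg.cont.clm_apply continuous_const, C * ‖x‖, k, by positivity, fun z => ?_⟩
  refine ((g z).le_opNorm x).trans ?_
  rw [mul_right_comm]
  exact mul_le_mul_of_nonneg_right (h z) (norm_nonneg x)

lemma PolyBdd.const (x : F) : PolyBdd fun _ : E => x :=
  ⟨continuous_const, ‖x‖, 0, norm_nonneg _, fun z => by simp⟩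

lemma polyBdd_inner (x : E) : PolyBdd fun z : E => inner ℝ x z :=
  ⟨by fun_prop, ‖x‖, 1, norm_nonneg _, fun z => (norm_inner_le_norm x z).trans
    (by nlinarith [norm_nonneg x])⟩

lemma PolyBdd.integrable [FiniteDimensional ℝ E] [MeasurableSpace E] [BorelSpace E] {g : E → F}
    (hg : PolyBdd g) : Integrable g (stdGaussian E) := by
  obtain ⟨C, k, hC, h⟩ := hg.bdd
  exact integrable_stdGaussian_of_le hg.cont.aestronglyMeasurable C k h

lemma norm_le_of_norm_fderiv_le {g : E → F} (hg : Differentiable ℝ g) {C : ℝ} {k : ℕ} (hC : 0 ≤ C)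
    (h : ∀ z, ‖fderiv ℝ g z‖ ≤ C * (1 + ‖z‖) ^ k) (a : E) :
    ‖g a‖ ≤ (‖g 0‖ + C) * (1 + ‖a‖) ^ (k + 1) := by
  have h1 : ‖g a - g 0‖ ≤ C * (1 + ‖a‖) ^ k * ‖a - 0‖ := by
    refine (convex_closedBall (0 : E) ‖a‖).norm_image_sub_le_of_norm_fderiv_le
      (fun z _ => hg z) (fun z hz => (h z).trans ?_) (by simp) (by simp)
    have : ‖z‖ ≤ ‖a‖ := by simpa using hz
    gcongr
  have h2 : ‖g a‖ ≤ ‖g 0‖ + ‖g a - g 0‖ := by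
    simpa using norm_add_le (g 0) (g a - g 0)
  have h3 : (1 : ℝ) ≤ (1 + ‖a‖) ^ (k + 1) := one_le_pow₀ (by simp)
  rw [sub_zero] at h1
  have h4 : (1 + ‖a‖) ^ k * ‖a‖ ≤ (1 + ‖a‖) ^ (k + 1) := by
    rw [pow_succ]; gcongr; linarith
  nlinarith [mul_le_mul_of_nonneg_left h4 hC, mul_le_mul_of_nonneg_left h3 (norm_nonneg (g 0))]

/-- Twice continuously differentiable functions whose second derivative grows at most like
`‖a‖ ^ k`. -/
structure C2Growth (f : E → ℝ) (k : ℕ) : Prop where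
  contDiff : ContDiff ℝ 2 f
  bdd : ∃ C : ℝ, 0 ≤ C ∧ ∀ a, ‖fderiv ℝ (fderiv ℝ f) a‖ ≤ C * (1 + ‖a‖) ^ k

variable {f : E → ℝ} {k : ℕ}

lemma C2Growth.differentiable (hf : C2Growth f k) : Differentiable ℝ f :=
  hf.contDiff.differentiable (by norm_num)

lemma C2Growth.contDiff_fderiv (hf : C2Growth f k) : ContDiff ℝ 1 (fderiv ℝ f) :=
  hf.contDiff.fderiv_right (by norm_num)

lemma C2Growth.differentiable_fderiv (hf : C2Growth f k) : Differentiable ℝ (fderiv ℝ f) :=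
  hf.contDiff_fderiv.differentiable (by norm_num)

lemma C2Growth.continuous_hess (hf : C2Growth f k) : Continuous (fderiv ℝ (fderiv ℝ f)) :=
  hf.contDiff_fderiv.continuous_fderiv (by norm_num)

lemma C2Growth.fderiv_bdd (hf : C2Growth f k) :
    ∃ C : ℝ, 0 ≤ C ∧ ∀ a, ‖fderiv ℝ f a‖ ≤ C * (1 + ‖a‖) ^ (k + 1) := by
  obtain ⟨C, hC, h⟩ := hf.bdd
  exact ⟨_, by positivity, norm_le_of_norm_fderiv_le hf.differentiable_fderiv hC h⟩

lemma C2Growth.self_bdd (hf : C2Growth f k) :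
    ∃ C : ℝ, 0 ≤ C ∧ ∀ a, ‖f a‖ ≤ C * (1 + ‖a‖) ^ (k + 2) := by
  obtain ⟨C, hC, h⟩ := hf.fderiv_bdd
  exact ⟨_, by positivity, norm_le_of_norm_fderiv_le hf.differentiable hC h⟩

lemma C2Growth.polyBdd (hf : C2Growth f k) : PolyBdd f := by
  obtain ⟨C, hC, h⟩ := hf.self_bdd
  exact ⟨hf.contDiff.continuous, C, _, hC, h⟩

lemma C2Growth.polyBdd_fderiv (hf : C2Growth f k) : PolyBdd (fderiv ℝ f) := by
  obtain ⟨C, hC, h⟩ := hf.fderiv_bdd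
  exact ⟨hf.contDiff_fderiv.continuous, C, _, hC, h⟩

lemma C2Growth.polyBdd_hess (hf : C2Growth f k) : PolyBdd (fderiv ℝ (fderiv ℝ f)) := by
  obtain ⟨C, hC, h⟩ := hf.bdd
  exact ⟨hf.continuous_hess, C, _, hC, h⟩

/-- The derivative of `a ↦ Df(a) x`. -/
lemma C2Growth.hasFDerivAt_fderiv_apply (hf : C2Growth f k) (x a : E) :
    HasFDerivAt (fun a => fderiv ℝ f a x) ((fderiv ℝ (fderiv ℝ f) a).flip x) a := by
  have h := (hf.differentiable_fderiv a).hasFDerivAt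
  convert! h.clm_apply (hasFDerivAt_const x a) using 1
  ext v
  simp

/-- Differentiation of `∫ g (A t a) ∂μ(a)` in `t`, dominated through the polynomial growth of the
derivative of `g`. -/
lemma hasDerivAt_integral_comp_curve {α : Type*} [MeasurableSpace α] {μ : Measure α}
    {g : E → ℝ} {g' : E → E →L[ℝ] ℝ} (hg : ∀ z, HasFDerivAt g (g' z) z) (hg' : Continuous g')
    {C : ℝ} {k : ℕ} (hC : 0 ≤ C) (hb : ∀ z, ‖g' z‖ ≤ C * (1 + ‖z‖) ^ k)
    {A A' : ℝ → α → E} {R : α → ℝ} {s : Set ℝ} {t : ℝ} (hs : s ∈ 𝓝 t)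
    (hA : ∀ u ∈ s, ∀ a, HasDerivAt (fun u => A u a) (A' u a) u)
    (hAm : ∀ u, AEStronglyMeasurable (A u) μ) (hAm' : ∀ u, AEStronglyMeasurable (A' u) μ)
    (hAR : ∀ u ∈ s, ∀ a, ‖A u a‖ ≤ R a) (hAR' : ∀ u ∈ s, ∀ a, ‖A' u a‖ ≤ R a)
    (hR : Integrable (fun a => (1 + R a) ^ (k + 1)) μ) :
    Integrable (fun a => g (A t a)) μ ∧ Integrable (fun a => g' (A t a) (A' t a)) μ ∧
    HasDerivAt (fun u => ∫ a, g (A u a) ∂μ) (∫ a, g' (A t a) (A' t a) ∂μ) t := by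
  have ht := mem_of_mem_nhds hs
  have hgc : Continuous g := continuous_iff_continuousAt.2 fun z => (hg z).continuousAt
  have hfd : fderiv ℝ g = g' := funext fun z => (hg z).fderiv
  have hgb := norm_le_of_norm_fderiv_le (fun z => (hg z).differentiableAt) hC
    (by rw [hfd]; exact hb)
  have hRn : ∀ a, 0 ≤ R a := fun a => (norm_nonneg _).trans (hAR t ht a)
  have i1 : Integrable (fun a => g (A t a)) μ := by
    refine (hR.const_mul (‖g 0‖ + C)).mono' (hgc.comp_aestronglyMeasurable (hAm t))
      (ae_of_all _ fun a => (hgb _).trans ?_)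
    have := hAR t ht a
    gcongr
  have key := hasDerivAt_integral_of_dominated_loc_of_deriv_le (μ := μ) (𝕜 := ℝ)
    (F := fun u a => g (A u a)) (F' := fun u a => g' (A u a) (A' u a)) (x₀ := t)
    (bound := fun a => C * (1 + R a) ^ (k + 1)) hs
    (Eventually.of_forall fun u => hgc.comp_aestronglyMeasurable (hAm u)) i1
    (isBoundedBilinearMap_apply.continuous.comp_aestronglyMeasurable
      ((hg'.comp_aestronglyMeasurable (hAm t)).prodMk (hAm' t)))
    (ae_of_all _ fun a u hu => ?_) (hR.const_mul C)
    (ae_of_all _ fun a u hu => (hg _).comp_hasDerivAt u (hA u hu a))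
  · exact ⟨i1, key.1, key.2⟩
  · refine ((g' _).le_opNorm _).trans ?_
    have h1 := hAR u hu a
    have h2 := hAR' u hu a
    have h3 := hRn a
    calc ‖g' (A u a)‖ * ‖A' u a‖ ≤ (C * (1 + R a) ^ k) * (1 + R a) := by
          refine mul_le_mul ((hb _).trans ?_) (by linarith) (norm_nonneg _) (by positivity)
          gcongr
      _ = _ := by rw [pow_succ]; ring

end Growth

/-! ### Gaussian smoothing of the Hessian -/

section Kernel

variable {E : Type*} [NormedAddCommGroup E] [InnerProductSpace ℝ E] [FiniteDimensional ℝ E]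
  [MeasurableSpace E] [BorelSpace E]

/-- The second derivative along `x`, averaged over a Gaussian perturbation of size `c`:
`E D²f(a + c Z)(x, x)`. -/
noncomputable def smoothedHess (f : E → ℝ) (c : ℝ) (a x : E) : ℝ :=
  ∫ z, fderiv ℝ (fderiv ℝ f) (a + c • z) x x ∂(stdGaussian E)

variable {f : E → ℝ} {k : ℕ}

lemma hasFDerivAt_comp_affine {g : E → ℝ} {g' : E →L[ℝ] ℝ} {a z : E} {c : ℝ}
    (h : HasFDerivAt g g' (a + c • z)) :
    HasFDerivAt (fun z => g (a + c • z)) (c • g') z := by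
  have h1 : HasFDerivAt (fun z : E => a + c • z) (c • ContinuousLinearMap.id ℝ E) z :=
    ((hasFDerivAt_id z).const_smul c).const_add a
  convert! h.comp z h1 using 1
  ext v
  simp

lemma integral_fderiv_comp_affine (hf : C2Growth f k) (c : ℝ) (a x : E) :
    c * ∫ z, fderiv ℝ f (a + c • z) x ∂(stdGaussian E) =
      ∫ z, inner ℝ x z * f (a + c • z) ∂(stdGaussian E) := by
  have h := integral_fderiv_stdGaussian (F := fun z => f (a + c • z))
    (F' := fun z => c • fderiv ℝ f (a + c • z)) x
    (fun z => hasFDerivAt_comp_affine (hf.differentiable _).hasFDerivAt)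
    (hf.polyBdd.comp_affine a c).integrable
    (((hf.polyBdd_fderiv.comp_affine a c).clm_apply x).integrable.const_mul c)
    ((polyBdd_inner x).mul (hf.polyBdd.comp_affine a c)).integrable
  simpa [integral_const_mul] using h

/-- Integration by parts moves one of the two derivatives to the Gaussian density. -/
lemma smoothedHess_eq_integral_fderiv (hf : C2Growth f k) (c : ℝ) (a x : E) :
    c * smoothedHess f c a x =
      ∫ z, inner ℝ x z * fderiv ℝ f (a + c • z) x ∂(stdGaussian E) := by
  have h := integral_fderiv_stdGaussian (F := fun z => fderiv ℝ f (a + c • z) x)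
    (F' := fun z => c • (fderiv ℝ (fderiv ℝ f) (a + c • z)).flip x) x
    (fun z => hasFDerivAt_comp_affine (g := fun a => fderiv ℝ f a x)
      (hf.hasFDerivAt_fderiv_apply x _))
    ((hf.polyBdd_fderiv.comp_affine a c).clm_apply x).integrable
    ((((hf.polyBdd_hess.comp_affine a c).clm_apply x).clm_apply x).integrable.const_mul c)
    ((polyBdd_inner x).mul ((hf.polyBdd_fderiv.comp_affine a c).clm_apply x)).integrable
  simpa [integral_const_mul, smoothedHess] using h

/-- After integrating by parts twice no derivative of `f` is left, and the weight is the second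
Hermite polynomial in the direction `x`. -/
lemma smoothedHess_eq_integral (hf : C2Growth f k) (c : ℝ) (a x : E) :
    c ^ 2 * smoothedHess f c a x =
      ∫ z, (inner ℝ x z ^ 2 - ‖x‖ ^ 2) * f (a + c • z) ∂(stdGaussian E) := by
  have pf := hf.polyBdd.comp_affine a c
  have pd := (hf.polyBdd_fderiv.comp_affine a c).clm_apply x
  have i1 : Integrable (fun z => ‖x‖ ^ 2 * f (a + c • z)) (stdGaussian E) :=
    pf.integrable.const_mul _
  have i2 : Integrable (fun z => inner ℝ x z * fderiv ℝ f (a + c • z) x) (stdGaussian E) :=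
    ((polyBdd_inner x).mul pd).integrable
  have i3 : Integrable (fun z => inner ℝ x z * (inner ℝ x z * f (a + c • z))) (stdGaussian E) :=
    ((polyBdd_inner x).mul ((polyBdd_inner x).mul pf)).integrable
  have e : ∀ z : E, (inner ℝ x z • (c • fderiv ℝ f (a + c • z)) +
      f (a + c • z) • innerSL ℝ x) x
      = c * (inner ℝ x z * fderiv ℝ f (a + c • z) x) + ‖x‖ ^ 2 * f (a + c • z) := by
    intro z
    simp only [_root_.add_apply, _root_.smul_apply, smul_eq_mul,
      innerSL_apply_apply, real_inner_self_eq_norm_sq]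
    ring
  have h := integral_fderiv_stdGaussian (F := fun z => inner ℝ x z * f (a + c • z))
    (F' := fun z => (inner ℝ x z : ℝ) • (c • fderiv ℝ f (a + c • z)) +
      f (a + c • z) • innerSL ℝ x) x
    (fun z => (innerSL ℝ x).hasFDerivAt.mul
      (hasFDerivAt_comp_affine (hf.differentiable _).hasFDerivAt))
    ((polyBdd_inner x).mul pf).integrable
    (((i2.const_mul c).add i1).congr (ae_of_all _ fun z => (e z).symm)) i3
  simp_rw [e] at h
  rw [integral_add (i2.const_mul c) i1, integral_const_mul,
    ← smoothedHess_eq_integral_fderiv hf] at h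
  have e2 : ∀ z : E, (inner ℝ x z ^ 2 - ‖x‖ ^ 2) * f (a + c • z) =
      inner ℝ x z * (inner ℝ x z * f (a + c • z)) - ‖x‖ ^ 2 * f (a + c • z) := fun z => by ring
  simp_rw [e2]
  rw [integral_sub i3 i1, ← h]
  ring

/-- A weighted Gaussian average of a bounded quantity. -/
lemma abs_integral_mul_le {w g : E → ℝ} (hw : PolyBdd w) {B : ℝ} (hg : ∀ z, |g z| ≤ B) :
    |∫ z, w z * g z ∂(stdGaussian E)| ≤ B * ∫ z, |w z| ∂(stdGaussian E) := by
  have h := norm_integral_le_of_norm_le (f := fun z => w z * g z) (hw.abs.integrable.const_mul B)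
    (ae_of_all _ fun z => by
      rw [Real.norm_eq_abs, abs_mul, mul_comm]
      exact mul_le_mul_of_nonneg_right (hg z) (abs_nonneg _))
  rwa [integral_const_mul] at h

/-- One derivative falls on the Gaussian density, which costs a factor `1 / c`, and the constant
`√(2 / π)` is the mean of `|⟪x, Z⟫|` for a unit vector `x`. -/
lemma smoothedHess_le_of_lipschitz (hf : C2Growth f k) {L : ℝ}
    (hL : ∀ a x, |fderiv ℝ f a x| ≤ L * ‖x‖) {c : ℝ} (hc : 0 < c) (a x : E) :
    |smoothedHess f c a x| ≤ √(2 / Real.pi) * L / c * ‖x‖ ^ 2 := by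
  have h := abs_integral_mul_le (polyBdd_inner x) (fun z => hL (a + c • z) x)
  rw [← smoothedHess_eq_integral_fderiv hf, integral_abs_inner_stdGaussian, abs_mul,
    abs_of_pos hc] at h
  rw [div_mul_eq_mul_div, le_div_iff₀ hc]
  linarith

lemma smoothedHess_sub_le_of_lipschitz_fderiv (hf : C2Growth f k) {L : ℝ}
    (hL : ∀ a b x, |fderiv ℝ f a x - fderiv ℝ f b x| ≤ L * ‖a - b‖ * ‖x‖) {c : ℝ} (hc : 0 < c)
    (a b x : E) :
    |smoothedHess f c a x - smoothedHess f c b x| ≤ √(2 / Real.pi) * L / c * ‖x‖ ^ 2 * ‖a - b‖ := by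
  have h := abs_integral_mul_le (polyBdd_inner x)
    (g := fun z => fderiv ℝ f (a + c • z) x - fderiv ℝ f (b + c • z) x)
    (B := L * ‖a - b‖ * ‖x‖) (fun z => (hL _ _ _).trans_eq (by congr 3; abel))
  simp_rw [mul_sub] at h
  rw [integral_sub, ← smoothedHess_eq_integral_fderiv hf, ← smoothedHess_eq_integral_fderiv hf,
    integral_abs_inner_stdGaussian, ← mul_sub, abs_mul, abs_of_pos hc] at h
  · rw [div_mul_eq_mul_div, div_mul_eq_mul_div, le_div_iff₀ hc]
    linarith
  · exact ((polyBdd_inner x).mul ((hf.polyBdd_fderiv.comp_affine a c).clm_apply x)).integrable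
  · exact ((polyBdd_inner x).mul ((hf.polyBdd_fderiv.comp_affine b c).clm_apply x)).integrable

lemma polyBdd_inner_sq_sub (x : E) : PolyBdd fun z : E => inner ℝ x z ^ 2 - ‖x‖ ^ 2 := by
  simp_rw [sq (inner ℝ x _)]
  exact ((polyBdd_inner x).mul (polyBdd_inner x)).sub (PolyBdd.const _)

/-- Both derivatives fall on the Gaussian density, at the cost of a factor `1 / c ^ 2`. The second
Hermite polynomial has mean absolute value at most `1`, hence the constant. -/
lemma smoothedHess_sub_le_of_lipschitz (hf : C2Growth f k) {L : ℝ}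
    (hL : ∀ a b, |f a - f b| ≤ L * ‖a - b‖) {c : ℝ} (hc : 0 < c) (a b x : E) :
    |smoothedHess f c a x - smoothedHess f c b x| ≤ L / c ^ 2 * ‖x‖ ^ 2 * ‖a - b‖ := by
  have h := abs_integral_mul_le (polyBdd_inner_sq_sub x)
    (g := fun z => f (a + c • z) - f (b + c • z))
    (B := L * ‖a - b‖) (fun z => (hL _ _).trans_eq (by congr 2; abel))
  have hn : 0 ≤ L * ‖a - b‖ := (abs_nonneg _).trans (hL a b)
  simp_rw [mul_sub] at h
  rw [integral_sub, ← smoothedHess_eq_integral hf, ← smoothedHess_eq_integral hf,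
    ← mul_sub, abs_mul, abs_of_pos (by positivity : 0 < c ^ 2)] at h
  · rw [div_mul_eq_mul_div, div_mul_eq_mul_div, le_div_iff₀ (by positivity)]
    have := mul_le_mul_of_nonneg_left (integral_abs_inner_sq_sub_stdGaussian_le x) hn
    linarith
  · exact ((polyBdd_inner_sq_sub x).mul (hf.polyBdd.comp_affine a c)).integrable
  · exact ((polyBdd_inner_sq_sub x).mul (hf.polyBdd.comp_affine b c)).integrable

lemma integrable_one_add_affine_norm_pow {D c : ℝ} (hD : 0 ≤ D) (hc : 0 ≤ c) (m : ℕ) :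
    Integrable (fun z : E => (1 + (D + c * ‖z‖)) ^ m) (stdGaussian E) := by
  refine integrable_stdGaussian_of_le (by fun_prop) ((1 + D + c) ^ m) m fun z => ?_
  rw [Real.norm_eq_abs, abs_of_nonneg (by positivity), ← mul_pow]
  gcongr
  nlinarith [norm_nonneg z, mul_nonneg hD (norm_nonneg z)]

/-- The mixed second difference of a Gaussian smoothing of a Lipschitz function: one derivative is
absorbed by the Lipschitz constant, the other one by the Gaussian density. -/
lemma abs_secondDiff_smoothing_le (hf : C2Growth f k) {L : ℝ}
    (hL : ∀ a b, |f a - f b| ≤ L * ‖a - b‖) {r : ℝ} (hr : 0 < r) (p u w : E) :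
    |(∫ z, f (p + w + u + r • z) ∂(stdGaussian E) - ∫ z, f (p + u + r • z) ∂(stdGaussian E)) -
      (∫ z, f (p + w + r • z) ∂(stdGaussian E) - ∫ z, f (p + r • z) ∂(stdGaussian E))| ≤
      √(2 / Real.pi) * L / r * ‖u‖ * ‖w‖ := by
  obtain ⟨C, hC, hb⟩ := hf.fderiv_bdd
  have hd : ∀ q : E, ∀ t ∈ Set.Icc (0 : ℝ) 1,
      HasDerivAt (fun t : ℝ => ∫ z, f (q + t • u + r • z) ∂(stdGaussian E))
        (∫ z, fderiv ℝ f (q + t • u + r • z) u ∂(stdGaussian E)) t := by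
    intro q t ht
    refine (hasDerivAt_integral_comp_curve (fun z => (hf.differentiable z).hasFDerivAt)
      hf.contDiff_fderiv.continuous hC hb (A := fun t z => q + t • u + r • z)
      (A' := fun _ _ => u) (R := fun z => ‖q‖ + 2 * ‖u‖ + r * ‖z‖) (s := Set.Ioo (-1) 2)
      (Ioo_mem_nhds (by linarith [ht.1]) (by linarith [ht.2])) (fun s _ z => ?_)
      (fun _ => by fun_prop) (fun _ => by fun_prop) (fun s hs z => ?_) (fun s hs z => ?_)
      (integrable_one_add_affine_norm_pow (by positivity) hr.le _)).2.2
    · simpa using! (((hasDerivAt_id s).smul_const u).const_add q).add_const (r • z)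
    · have h1 : ‖s • u‖ ≤ 2 * ‖u‖ := by
        rw [norm_smul]
        have : |s| ≤ 2 := abs_le.2 ⟨by linarith [hs.1], hs.2.le⟩
        exact mul_le_mul_of_nonneg_right this (norm_nonneg u)
      have h2 : ‖r • z‖ = r * ‖z‖ := by rw [norm_smul, Real.norm_eq_abs, abs_of_pos hr]
      linarith [norm_add₃_le (a := q) (b := s • u) (c := r • z)]
    · nlinarith [norm_nonneg q, norm_nonneg u, mul_nonneg hr.le (norm_nonneg z)]
  have key := norm_image_sub_le_of_norm_deriv_le_segment_01'
    (f := fun t : ℝ => ∫ z, f (p + w + t • u + r • z) ∂(stdGaussian E) -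
      ∫ z, f (p + t • u + r • z) ∂(stdGaussian E))
    (C := √(2 / Real.pi) * L / r * ‖u‖ * ‖w‖)
    (fun t ht => ((hd (p + w) t ht).sub (hd p t ht)).hasDerivWithinAt) (fun t _ => ?_)
  · simpa using key
  · have h := abs_integral_mul_le (polyBdd_inner u)
      (g := fun z => f (p + w + t • u + r • z) - f (p + t • u + r • z))
      (B := L * ‖w‖) (fun z => (hL _ _).trans_eq (by congr 2; abel))
    simp_rw [mul_sub] at h
    rw [integral_sub, ← integral_fderiv_comp_affine hf, ← integral_fderiv_comp_affine hf,
      integral_abs_inner_stdGaussian, ← mul_sub, abs_mul, abs_of_pos hr] at h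
    · rw [Real.norm_eq_abs, div_mul_eq_mul_div, div_mul_eq_mul_div, le_div_iff₀ hr]
      linarith
    · exact ((polyBdd_inner u).mul (hf.polyBdd.comp_affine (p + w + t • u) r)).integrable
    · exact ((polyBdd_inner u).mul (hf.polyBdd.comp_affine (p + t • u) r)).integrable

/-- Splitting the Gaussian perturbation of size `c = √2 r` into two independent halves of size `r`,
and integrating by parts twice in one of them. -/
lemma smoothedHess_eq_integral_half (hf : C2Growth f k) (r : ℝ) (a x : E) :
    Integrable (fun z' : E => (inner ℝ x z' ^ 2 - ‖x‖ ^ 2) *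
      ∫ z, f (a + r • z' + r • z) ∂(stdGaussian E)) (stdGaussian E) ∧
    r ^ 2 * smoothedHess f (√2 * r) a x = ∫ z', (inner ℝ x z' ^ 2 - ‖x‖ ^ 2) *
      ∫ z, f (a + r • z' + r • z) ∂(stdGaussian E) ∂(stdGaussian E) := by
  have hrot : (√2)⁻¹ ^ 2 + (√2)⁻¹ ^ 2 = (1 : ℝ) := by
    rw [inv_pow, Real.sq_sqrt (by norm_num)]; norm_num
  have h1 := (integral_rotation_stdGaussian hrot
    (((hf.polyBdd_hess.comp_affine a (√2 * r)).clm_apply x).clm_apply x).integrable).2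
  have e1 : ∀ z z' : E, a + (√2 * r) • ((√2)⁻¹ • z + (√2)⁻¹ • z') = a + r • z + r • z' := by
    intro z z'
    have : √2 ≠ 0 := by positivity
    rw [smul_add, smul_smul, smul_smul, mul_right_comm, mul_inv_cancel₀ this, one_mul, add_assoc]
  simp_rw [e1] at h1
  obtain ⟨C, hC, hb⟩ := hf.self_bdd
  obtain ⟨D, l, hD, hb'⟩ := (polyBdd_inner_sq_sub x).bdd
  have hint : Integrable (fun p : E × E => (inner ℝ x p.1 ^ 2 - ‖x‖ ^ 2) *
      f (a + r • p.1 + r • p.2)) ((stdGaussian E).prod (stdGaussian E)) := by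
    have i := ((integrable_norm_pow_stdGaussian (E := E) (l + (k + 2))).const_mul
      (D * (C * (1 + ‖a‖ + |r|) ^ (k + 2)))).mul_prod
      (integrable_norm_pow_stdGaussian (E := E) (k + 2))
    have hfc := hf.contDiff.continuous
    refine i.mono' (Continuous.aestronglyMeasurable (by fun_prop)) (ae_of_all _ fun p => ?_)
    rw [norm_mul]
    have hn : 1 + ‖a + r • p.1 + r • p.2‖ ≤ (1 + ‖a‖ + |r|) * (1 + ‖p.1‖) * (1 + ‖p.2‖) := by
      have h3 := norm_add₃_le (a := a) (b := r • p.1) (c := r • p.2)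
      rw [norm_smul, norm_smul, Real.norm_eq_abs] at h3
      have n1 := norm_nonneg p.1
      have n2 := norm_nonneg p.2
      have n3 := norm_nonneg a
      have n4 := abs_nonneg r
      have : (1 + ‖a‖ + |r|) * (1 + ‖p.1‖) * (1 + ‖p.2‖) = 1 + ‖a‖ + |r| * ‖p.1‖ + |r| * ‖p.2‖
        + (|r| + (1 + ‖a‖) * (‖p.1‖ + ‖p.2‖) + (1 + ‖a‖ + |r|) * (‖p.1‖ * ‖p.2‖)) := by ring
      rw [this]
      have : 0 ≤ |r| + (1 + ‖a‖) * (‖p.1‖ + ‖p.2‖) + (1 + ‖a‖ + |r|) * (‖p.1‖ * ‖p.2‖) := by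
        positivity
      linarith
    calc ‖inner ℝ x p.1 ^ 2 - ‖x‖ ^ 2‖ * ‖f (a + r • p.1 + r • p.2)‖
        ≤ (D * (1 + ‖p.1‖) ^ l) *
          (C * ((1 + ‖a‖ + |r|) * (1 + ‖p.1‖) * (1 + ‖p.2‖)) ^ (k + 2)) := by
          refine mul_le_mul (hb' _) ((hb _).trans ?_) (norm_nonneg _) (by positivity)
          gcongr
      _ = _ := by rw [mul_pow, mul_pow, pow_add (1 + ‖p.1‖)]; ring
  constructor
  · simpa [integral_const_mul] using hint.integral_prod_left
  · simp_rw [← integral_const_mul]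
    rw [integral_integral_swap (f := fun z' z => (inner ℝ x z' ^ 2 - ‖x‖ ^ 2) *
      f (a + r • z' + r • z)) hint]
    have e2 : ∀ z z' : E, a + r • z' + r • z = a + r • z + r • z' := fun z z' => by abel
    simp_rw [e2, ← smoothedHess_eq_integral hf]
    rw [integral_const_mul]
    congr 1
    exact h1.symm

/-- The second difference of the smoothed Hessian of a Lipschitz function amounts to four
derivatives. One of them is absorbed by the Lipschitz constant, and the other three fall on the
Gaussian density. The perturbation is split into two independent halves, with two derivatives on one
half and one on the other. -/
lemma abs_secondDiff_smoothedHess_le (hf : C2Growth f k) {L : ℝ}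
    (hL : ∀ a b, |f a - f b| ≤ L * ‖a - b‖) {c : ℝ} (hc : 0 < c) (p u w x : E) :
    |(smoothedHess f c (p + w + u) x - smoothedHess f c (p + u) x) -
      (smoothedHess f c (p + w) x - smoothedHess f c p x)| ≤
      2 * √2 * √(2 / Real.pi) * L / c ^ 3 * ‖x‖ ^ 2 * ‖u‖ * ‖w‖ := by
  have h2 : √2 * √2 = 2 := Real.mul_self_sqrt (by norm_num)
  have h2p : 0 < √2 := by positivity
  obtain ⟨r, hr, rfl⟩ : ∃ r, 0 < r ∧ c = √2 * r := ⟨c / √2, by positivity, by field_simp⟩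
  have H := fun a => smoothedHess_eq_integral_half hf r a x
  have h := abs_integral_mul_le (polyBdd_inner_sq_sub x) (fun z' =>
    abs_secondDiff_smoothing_le hf hL hr (p + r • z') u w)
  have hB : 0 ≤ √(2 / Real.pi) * L / r * ‖u‖ * ‖w‖ :=
    (abs_nonneg _).trans (abs_secondDiff_smoothing_le hf hL hr p u w)
  have e : ∀ z' : E, p + r • z' + w + u = p + w + u + r • z' := fun z' => by abel
  have e1 : ∀ z' : E, p + r • z' + u = p + u + r • z' := fun z' => by abel
  have e2 : ∀ z' : E, p + r • z' + w = p + w + r • z' := fun z' => by abel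
  simp_rw [e, e1, e2, mul_sub] at h
  have I : ∀ a b : E, Integrable (fun z' : E =>
      (inner ℝ x z' ^ 2 - ‖x‖ ^ 2) * (∫ z, f (a + r • z' + r • z) ∂(stdGaussian E)) -
      (inner ℝ x z' ^ 2 - ‖x‖ ^ 2) * ∫ z, f (b + r • z' + r • z) ∂(stdGaussian E))
      (stdGaussian E) := fun a b => (H a).1.sub (H b).1
  rw [integral_sub (I _ _) (I _ _), integral_sub (H _).1 (H _).1,
    integral_sub (H _).1 (H _).1, ← (H _).2, ← (H _).2, ← (H _).2, ← (H _).2, ← mul_sub, ← mul_sub,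
    ← mul_sub, abs_mul, abs_of_pos (by positivity : 0 < r ^ 2)] at h
  have h' := h.trans (mul_le_mul_of_nonneg_left (integral_abs_inner_sq_sub_stdGaussian_le x) hB)
  have e3 : 2 * √2 * √(2 / Real.pi) * L / (√2 * r) ^ 3 * ‖x‖ ^ 2 * ‖u‖ * ‖w‖ =
      (√(2 / Real.pi) * L / r * ‖u‖ * ‖w‖ * ‖x‖ ^ 2) / r ^ 2 := by
    have : (√2 * r) ^ 3 = 2 * √2 * r ^ 3 := by
      rw [mul_pow, pow_succ √2, sq, h2]
    rw [this]
    field_simp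
  rw [e3, le_div_iff₀ (by positivity)]
  linarith

end Kernel

/-! ### Interpolation between a sum of independent vectors and the Gaussian law -/

section Interpolation

variable {E : Type*} [NormedAddCommGroup E] [InnerProductSpace ℝ E] [FiniteDimensional ℝ E]
  [MeasurableSpace E] [BorelSpace E] {f : E → ℝ} {k : ℕ}

lemma C2Growth.integrable_fderiv (hf : C2Growth f k) {α : Type*} [MeasurableSpace α]
    {μ : Measure α} {A Y : α → E} {R : α → ℝ} (hA : AEStronglyMeasurable A μ)
    (hY : AEStronglyMeasurable Y μ) (hAR : ∀ a, ‖A a‖ ≤ R a) (hYR : ∀ a, ‖Y a‖ ≤ R a)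
    (hR : Integrable (fun a => (1 + R a) ^ (k + 2)) μ) :
    Integrable (fun a => fderiv ℝ f (A a) (Y a)) μ := by
  obtain ⟨C, hC, h⟩ := hf.fderiv_bdd
  refine (hR.const_mul C).mono' (isBoundedBilinearMap_apply.continuous.comp_aestronglyMeasurable
    ((hf.contDiff_fderiv.continuous.comp_aestronglyMeasurable hA).prodMk hY))
    (ae_of_all _ fun a => ((fderiv ℝ f _).le_opNorm _).trans ?_)
  have h1 := hAR a
  have h2 := hYR a
  have h3 : 0 ≤ R a := (norm_nonneg _).trans h1
  calc ‖fderiv ℝ f (A a)‖ * ‖Y a‖ ≤ (C * (1 + R a) ^ (k + 1)) * (1 + R a) := by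
        refine mul_le_mul ((h _).trans ?_) (by linarith) (norm_nonneg _) (by positivity)
        gcongr
    _ = _ := by rw [pow_succ (1 + R a) (k + 1)]; ring

lemma C2Growth.integrable_hess (hf : C2Growth f k) {α : Type*} [MeasurableSpace α]
    {μ : Measure α} {A : α → E} {R : α → ℝ} (hA : AEStronglyMeasurable A μ)
    (hAR : ∀ a, ‖A a‖ ≤ R a) (hR : Integrable (fun a => (1 + R a) ^ (k + 2)) μ) (x y : E) :
    Integrable (fun a => fderiv ℝ (fderiv ℝ f) (A a) x y) μ := by
  obtain ⟨C, hC, h⟩ := hf.bdd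
  refine (hR.const_mul (C * ‖x‖ * ‖y‖)).mono' (((hf.continuous_hess.clm_apply
    continuous_const).clm_apply continuous_const).comp_aestronglyMeasurable hA)
    (ae_of_all _ fun a => ((fderiv ℝ (fderiv ℝ f) (A a)).le_opNorm₂ x y).trans ?_)
  have h1 := hAR a
  have h3 : 0 ≤ R a := (norm_nonneg _).trans h1
  have h4 : (1 + ‖A a‖) ^ k ≤ (1 + R a) ^ (k + 2) :=
    (pow_le_pow_left₀ (by positivity) (by linarith) k).trans
      (pow_le_pow_right₀ (by linarith) (by omega))
  calc ‖fderiv ℝ (fderiv ℝ f) (A a)‖ * ‖x‖ * ‖y‖ ≤ (C * (1 + R a) ^ (k + 2)) * ‖x‖ * ‖y‖ := by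
        gcongr
        exact (h _).trans (by gcongr)
    _ = _ := by ring

variable {Ω : Type*} [MeasurableSpace Ω] {P : Measure Ω} [IsProbabilityMeasure P]

lemma integrable_one_add_pow {V X : Ω → E} {m : ℕ} (hm : m ≠ 0) (hV : MemLp V m P)
    (hX : MemLp X m P) :
    Integrable (fun p : Ω × E => (1 + (‖V p.1‖ + ‖X p.1‖ + ‖p.2‖)) ^ m)
      (P.prod (stdGaussian E)) := by
  have hZ : MemLp (fun p : Ω × E => ‖p.2‖) m (P.prod (stdGaussian E)) :=
    ((IsGaussian.memLp_id (stdGaussian E) m (by simp)).comp_measurePreserving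
      measurePreserving_snd).norm
  have h : MemLp (fun p : Ω × E => 1 + (‖V p.1‖ + ‖X p.1‖ + ‖p.2‖)) m
      (P.prod (stdGaussian E)) :=
    (memLp_const (1 : ℝ)).add (((hV.norm.comp_fst _).add (hX.norm.comp_fst _)).add hZ)
  refine (h.integrable_norm_pow hm).congr (ae_of_all _ fun z => ?_)
  simp only [Real.norm_eq_abs]
  rw [abs_of_nonneg (by positivity)]

lemma integral_eq_iterated_of_indepFun {X V : Ω → E} (h : IndepFun X V P) (hX : Measurable X)
    (hV : Measurable V) {F : E → E → ℝ} (hF : StronglyMeasurable (Function.uncurry F))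
    (hint : Integrable (fun ω => F (X ω) (V ω)) P) :
    Integrable (fun p : Ω × Ω => F (X p.1) (V p.2)) (P.prod P) ∧
    ∫ ω, F (X ω) (V ω) ∂P = ∫ ω', ∫ ω, F (X ω') (V ω) ∂P ∂P := by
  have hmap := (indepFun_iff_map_prod_eq_prod_map_map hX.aemeasurable hV.aemeasurable).1 h
  rw [Measure.map_prod_map _ _ hX hV] at hmap
  have hi : Integrable (Function.uncurry F) (P.map fun ω => (X ω, V ω)) :=
    (integrable_map_measure hF.aestronglyMeasurable (hX.prodMk hV).aemeasurable).2 hint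
  have hi' := hi
  rw [hmap] at hi'
  have hi2 : Integrable (fun p : Ω × Ω => F (X p.1) (V p.2)) (P.prod P) :=
    (integrable_map_measure hF.aestronglyMeasurable
      ((hX.comp measurable_fst).prodMk (hV.comp measurable_snd)).aemeasurable).1 hi'
  refine ⟨hi2, ?_⟩
  have e1 := integral_map (hX.prodMk hV).aemeasurable (hF.aestronglyMeasurable (μ := P.map
    fun ω => (X ω, V ω)))
  rw [hmap, integral_map (hX.prodMap hV).aemeasurable hF.aestronglyMeasurable] at e1
  rw [← integral_prod (fun p : Ω × Ω => F (X p.1) (V p.2)) hi2]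
  exact e1.symm

/-- The derivative along `x`, averaged over a Gaussian perturbation of size `c`. -/
noncomputable def smoothedGrad (f : E → ℝ) (c : ℝ) (a x : E) : ℝ :=
  ∫ z, fderiv ℝ f (a + c • z) x ∂(stdGaussian E)

lemma norm_smul_add_le {V X z : E} {s t c : ℝ} (hs : |s| ≤ 1) (ht : |t| ≤ 1) (hc : |c| ≤ 1) :
    ‖s • V + t • X + c • z‖ ≤ ‖V‖ + ‖X‖ + ‖z‖ := by
  refine norm_add₃_le.trans ?_
  simp only [norm_smul, Real.norm_eq_abs]
  have h1 := mul_le_mul_of_nonneg_right hs (norm_nonneg V)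
  have h2 := mul_le_mul_of_nonneg_right ht (norm_nonneg X)
  have h3 := mul_le_mul_of_nonneg_right hc (norm_nonneg z)
  linarith

section Pair

variable {X V : Ω → E} {s c : ℝ}

lemma integrable_fderiv_pair (hf : C2Growth f k) (hX : MemLp X (k + 2 : ℕ) P)
    (hV : MemLp V (k + 2 : ℕ) P) (hs : |s| ≤ 1) {t : ℝ} (ht : |t| ≤ 1) (hc : |c| ≤ 1) :
    Integrable (fun p : Ω × E => fderiv ℝ f (s • V p.1 + t • X p.1 + c • p.2) (X p.1))
      (P.prod (stdGaussian E)) := by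
  have mX := hX.1.comp_fst (ν := stdGaussian E)
  have mV := hV.1.comp_fst (ν := stdGaussian E)
  refine hf.integrable_fderiv (((mV.const_smul s).add (mX.const_smul t)).add
    ((measurable_snd (α := Ω)).aestronglyMeasurable.const_smul c)) mX
    (fun p => norm_smul_add_le hs ht hc) (fun p => ?_) (integrable_one_add_pow (by omega) hV hX)
  linarith [norm_nonneg (V p.1), norm_nonneg p.2]

lemma integrable_hess_pair (hf : C2Growth f k) (hX : MemLp X (k + 2 : ℕ) P)
    (hV : MemLp V (k + 2 : ℕ) P) (hs : |s| ≤ 1) {t : ℝ} (ht : |t| ≤ 1) (hc : |c| ≤ 1) (x y : E) :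
    Integrable (fun p : Ω × E => fderiv ℝ (fderiv ℝ f) (s • V p.1 + t • X p.1 + c • p.2) x y)
      (P.prod (stdGaussian E)) := by
  have mX := hX.1.comp_fst (ν := stdGaussian E)
  have mV := hV.1.comp_fst (ν := stdGaussian E)
  exact hf.integrable_hess (((mV.const_smul s).add (mX.const_smul t)).add
    ((measurable_snd (α := Ω)).aestronglyMeasurable.const_smul c))
    (fun p => norm_smul_add_le hs ht hc) (integrable_one_add_pow (by omega) hV hX) x y

lemma stronglyMeasurable_smoothedGrad (hf : C2Growth f k) (s t c : ℝ) :
    StronglyMeasurable (Function.uncurry fun x v : E => smoothedGrad f c (s • v + t • x) x) := by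
  have hc := hf.contDiff_fderiv.continuous
  exact StronglyMeasurable.integral_prod_right'
    (f := fun q : (E × E) × E => fderiv ℝ f (s • q.1.2 + t • q.1.1 + c • q.2) q.1.1)
    (Continuous.stronglyMeasurable (by fun_prop))

lemma stronglyMeasurable_smoothedHess (hf : C2Growth f k) (s t c : ℝ) (x : E) :
    StronglyMeasurable (Function.uncurry fun y v : E => smoothedHess f c (s • v + t • y) x) := by
  have hc := hf.continuous_hess
  exact StronglyMeasurable.integral_prod_right'
    (f := fun q : (E × E) × E =>
      fderiv ℝ (fderiv ℝ f) (s • q.1.2 + t • q.1.1 + c • q.2) x x)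
    (Continuous.stronglyMeasurable (by fun_prop))

/-- The quadratic form `x ↦ E D²f(W + c Z)(x, x)` in coordinates. -/
lemma integral_smoothedHess_eq_sum (hf : C2Growth f k) (hV : MemLp V (k + 2 : ℕ) P)
    (hs : |s| ≤ 1) (hc : |c| ≤ 1) {ι' : Type*} [Fintype ι'] (b : OrthonormalBasis ι' ℝ E) (x : E) :
    ∫ ω, smoothedHess f c (s • V ω) x ∂P = ∑ i, ∑ j, inner ℝ (b i) x * inner ℝ (b j) x *
      ∫ p : Ω × E, fderiv ℝ (fderiv ℝ f) (s • V p.1 + c • p.2) (b i) (b j)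
        ∂(P.prod (stdGaussian E)) := by
  have hi : ∀ x y : E, Integrable (fun p : Ω × E =>
      fderiv ℝ (fderiv ℝ f) (s • V p.1 + c • p.2) x y) (P.prod (stdGaussian E)) := by
    intro x y
    simpa using integrable_hess_pair hf hV hV hs (t := 0) (by simp) hc x y
  have e1 : ∫ ω, smoothedHess f c (s • V ω) x ∂P =
      ∫ p : Ω × E, fderiv ℝ (fderiv ℝ f) (s • V p.1 + c • p.2) x x ∂(P.prod (stdGaussian E)) :=
    (integral_prod _ (hi x x)).symm
  have e2 : ∀ B : E →L[ℝ] E →L[ℝ] ℝ, B x x =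
      ∑ i, ∑ j, inner ℝ (b i) x * inner ℝ (b j) x * B (b i) (b j) := by
    intro B
    conv_lhs => rw [← b.sum_repr' x]
    simp only [map_sum, map_smul, _root_.sum_apply, _root_.smul_apply, smul_eq_mul,
      Finset.mul_sum]
    rw [Finset.sum_comm]
    refine Finset.sum_congr rfl fun i _ => Finset.sum_congr rfl fun j _ => ?_
    ring
  rw [e1]
  simp_rw [e2]
  rw [integral_finsetSum _ fun i _ => integrable_finsetSum _ fun j _ => (hi _ _).const_mul _]
  refine Finset.sum_congr rfl fun i _ => ?_
  rw [integral_finsetSum _ fun j _ => (hi _ _).const_mul _]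
  simp_rw [integral_const_mul]

lemma integrable_inner_mul_inner (hX : MemLp X 2 P) (u v : E) :
    Integrable (fun ω => inner ℝ u (X ω) * inner ℝ v (X ω)) P := by
  refine ((hX.integrable_norm_pow two_ne_zero).const_mul (‖u‖ * ‖v‖)).mono'
    (Continuous.comp_aestronglyMeasurable (g := fun x : E => inner ℝ u x * inner ℝ v x)
      (by fun_prop) hX.1) (ae_of_all _ fun ω => ?_)
  rw [norm_mul]
  calc _ ≤ (‖u‖ * ‖X ω‖) * (‖v‖ * ‖X ω‖) :=
        mul_le_mul (norm_inner_le_norm _ _) (norm_inner_le_norm _ _) (norm_nonneg _) (by positivity)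
    _ = _ := by ring

/-- The contribution of one summand `X`, where `V` is the rest of the sum. The Hessian term is
evaluated at an independent copy of `X`, and `K x y` bounds the Taylor remainder when the summand is
`x` in one place and `y` in the other. -/
lemma abs_summand_le (hf : C2Growth f k) (hXV : IndepFun X V P) (hXm : Measurable X)
    (hVm : Measurable V) (hX : MemLp X (k + 2 : ℕ) P) (hV : MemLp V (k + 2 : ℕ) P)
    (hmean : ∫ ω, X ω ∂P = 0) (hs : |s| ≤ 1) (hc : |c| ≤ 1) {K : E → E → ℝ}
    (hK : ∀ x y, |∫ ω, smoothedGrad f c (s • V ω + s • x) x ∂P -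
      ∫ ω, smoothedGrad f c (s • V ω) x ∂P -
      s * ∫ ω, smoothedHess f c (s • V ω + s • y) x ∂P| ≤ K x y)
    (hKi : Integrable (fun p : Ω × Ω => K (X p.1) (X p.2)) (P.prod P)) :
    |∫ ω, smoothedGrad f c (s • V ω + s • X ω) (X ω) ∂P -
      s * ∫ ω', ∫ ω, smoothedHess f c (s • V ω + s • X ω) (X ω') ∂P ∂P| ≤
      ∫ ω', ∫ ω, K (X ω') (X ω) ∂P ∂P := by
  have hX2 : MemLp X 2 P := hX.mono_exponent (by norm_cast; omega)
  have i1 : Integrable (fun ω => smoothedGrad f c (s • V ω + s • X ω) (X ω)) P :=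
    (integrable_fderiv_pair hf hX hV hs hs hc).integral_prod_left
  have i0 : Integrable (fun ω => smoothedGrad f c (s • V ω + (0 : ℝ) • X ω) (X ω)) P :=
    (integrable_fderiv_pair hf hX hV hs (by simp) hc).integral_prod_left
  have i2 : ∀ x, Integrable (fun ω => smoothedHess f c (s • V ω + s • X ω) x) P := fun x =>
    (integrable_hess_pair hf hX hV hs hs hc x x).integral_prod_left
  have E1 := integral_eq_iterated_of_indepFun hXV hXm hVm
    (stronglyMeasurable_smoothedGrad hf s s c) i1
  have E0 := integral_eq_iterated_of_indepFun hXV hXm hVm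
    (stronglyMeasurable_smoothedGrad hf s 0 c) i0
  have E2 := fun x => integral_eq_iterated_of_indepFun hXV hXm hVm
    (stronglyMeasurable_smoothedHess hf s s c x) (i2 x)
  simp only [zero_smul, add_zero] at E0
  -- the first-order term vanishes since `X` is centred
  have hL : ∫ ω', ∫ ω, smoothedGrad f c (s • V ω) (X ω') ∂P ∂P = 0 := by
    obtain ⟨C, hC, hb⟩ := hf.fderiv_bdd
    have hi : Integrable (fun p : Ω × E => fderiv ℝ f (s • V p.1 + c • p.2))
        (P.prod (stdGaussian E)) := by
      have mV := hV.1.comp_fst (ν := stdGaussian E)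
      refine ((integrable_one_add_pow (by omega) hV hX).const_mul C).mono'
        (hf.contDiff_fderiv.continuous.comp_aestronglyMeasurable ((mV.const_smul s).add
        ((measurable_snd (α := Ω)).aestronglyMeasurable.const_smul c)))
        (ae_of_all _ fun p => (hb _).trans ?_)
      have h1 : ‖s • V p.1 + c • p.2‖ ≤ ‖V p.1‖ + ‖X p.1‖ + ‖p.2‖ := by
        simpa using norm_smul_add_le (V := V p.1) (X := X p.1) (z := p.2) hs (t := 0) (by simp) hc
      have h2 : 1 ≤ 1 + (‖V p.1‖ + ‖X p.1‖ + ‖p.2‖) := le_add_of_nonneg_right (by positivity)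
      have h3 : (1 + ‖s • V p.1 + c • p.2‖) ^ (k + 1) ≤
          (1 + (‖V p.1‖ + ‖X p.1‖ + ‖p.2‖)) ^ (k + 2) :=
        (pow_le_pow_left₀ (by positivity) (by linarith) _).trans
          (pow_le_pow_right₀ h2 (by omega))
      exact mul_le_mul_of_nonneg_left h3 hC
    have e : ∀ x, ∫ ω, smoothedGrad f c (s • V ω) x ∂P =
        (∫ p : Ω × E, fderiv ℝ f (s • V p.1 + c • p.2) ∂(P.prod (stdGaussian E))) x := by
      intro x
      rw [ContinuousLinearMap.integral_apply hi]
      exact (integral_prod _ (hi.apply_continuousLinearMap x)).symm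
    simp_rw [e]
    rw [ContinuousLinearMap.integral_comp_comm _ (hX2.integrable (by norm_num)), hmean, map_zero]
  have iH : Integrable (fun ω' => ∫ ω, smoothedHess f c (s • V ω + s • X ω) (X ω') ∂P) P := by
    have e : ∀ ω, s • V ω + s • X ω = s • (V + X) ω := fun ω => by simp
    simp_rw [e, integral_smoothedHess_eq_sum hf (hV.add hX) hs hc (stdOrthonormalBasis ℝ E)]
    exact integrable_finsetSum _ fun i _ => integrable_finsetSum _ fun j _ =>
      (integrable_inner_mul_inner hX2 _ _).mul_const _
  have j1 := E1.1.integral_prod_left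
  have j0 := E0.1.integral_prod_left
  have j3 : Integrable (fun ω' => (∫ ω, smoothedGrad f c (s • V ω + s • X ω') (X ω') ∂P) -
      ∫ ω, smoothedGrad f c (s • V ω) (X ω') ∂P) P := j1.sub j0
  have e : ∫ ω, smoothedGrad f c (s • V ω + s • X ω) (X ω) ∂P -
      s * ∫ ω', ∫ ω, smoothedHess f c (s • V ω + s • X ω) (X ω') ∂P ∂P =
      ∫ ω', ((∫ ω, smoothedGrad f c (s • V ω + s • X ω') (X ω') ∂P) -
        (∫ ω, smoothedGrad f c (s • V ω) (X ω') ∂P) -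
        s * ∫ ω, smoothedHess f c (s • V ω + s • X ω) (X ω') ∂P) ∂P := by
    rw [integral_sub j3 (iH.const_mul s), integral_sub j1 j0, hL, sub_zero, integral_const_mul,
      E1.2]
  rw [e, ← Real.norm_eq_abs]
  refine norm_integral_le_of_norm_le hKi.integral_prod_left ?_
  filter_upwards [hKi.prod_right_ae] with ω' hω'
  have jH := (E2 (X ω')).1.integral_prod_left
  rw [(E2 (X ω')).2, ← integral_const_mul]
  have e2 : (∫ ω, smoothedGrad f c (s • V ω + s • X ω') (X ω') ∂P) -
        (∫ ω, smoothedGrad f c (s • V ω) (X ω') ∂P) -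
        ∫ ω'', s * ∫ ω, smoothedHess f c (s • V ω + s • X ω'') (X ω') ∂P ∂P =
      ∫ ω'', ((∫ ω, smoothedGrad f c (s • V ω + s • X ω') (X ω') ∂P) -
        (∫ ω, smoothedGrad f c (s • V ω) (X ω') ∂P) -
        s * ∫ ω, smoothedHess f c (s • V ω + s • X ω'') (X ω') ∂P) ∂P := by
    rw [integral_sub (integrable_const _) (jH.const_mul s)]
    simp
  rw [e2]
  exact norm_integral_le_of_norm_le hω' (ae_of_all _ fun ω'' => hK _ _)

lemma hasDerivAt_integral_smoothedGrad (hf : C2Growth f k) (hV : MemLp V (k + 2 : ℕ) P)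
    (hs : |s| ≤ 1) (hc : |c| ≤ 1) (x : E) {t : ℝ} (ht : t ∈ Set.Icc (0 : ℝ) 1) :
    HasDerivAt (fun t : ℝ => ∫ ω, smoothedGrad f c (s • V ω + t • s • x) x ∂P)
      (s * ∫ ω, smoothedHess f c (s • V ω + t • s • x) x ∂P) t := by
  obtain ⟨C, hC, hb⟩ := hf.bdd
  have mV := hV.1.comp_fst (ν := stdGaussian E)
  have mZ : AEStronglyMeasurable (fun p : Ω × E => p.2) (P.prod (stdGaussian E)) :=
    measurable_snd.aestronglyMeasurable
  have hR : Integrable (fun p : Ω × E => (1 + (‖V p.1‖ + 2 * ‖x‖ + ‖p.2‖)) ^ (k + 2))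
      (P.prod (stdGaussian E)) := by
    simpa [norm_smul] using integrable_one_add_pow (by omega) hV
      (memLp_const ((2 : ℝ) • x) : MemLp (fun _ : Ω => (2 : ℝ) • x) (k + 2 : ℕ) P)
  have hAR : ∀ u ∈ Set.Ioo (-1 : ℝ) 2, ∀ p : Ω × E,
      ‖s • V p.1 + u • s • x + c • p.2‖ ≤ ‖V p.1‖ + 2 * ‖x‖ + ‖p.2‖ := by
    intro u hu p
    have h1 : ‖s • x‖ ≤ ‖x‖ := by
      rw [norm_smul]; exact mul_le_of_le_one_left (norm_nonneg x) hs
    have h2 : ‖u • s • x‖ ≤ 2 * ‖x‖ := by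
      rw [norm_smul]
      exact mul_le_mul (abs_le.2 ⟨by linarith [hu.1], hu.2.le⟩) h1 (norm_nonneg _) (by norm_num)
    have h3 := norm_smul_add_le (V := V p.1) (X := u • s • x) (z := p.2) hs (t := 1) (by simp) hc
    rw [one_smul] at h3
    linarith
  have hAm : ∀ u : ℝ, AEStronglyMeasurable (fun p : Ω × E => s • V p.1 + u • s • x + c • p.2)
      (P.prod (stdGaussian E)) := fun u =>
    ((mV.const_smul s).add aestronglyMeasurable_const).add (mZ.const_smul c)
  have htm : Set.Ioo (-1 : ℝ) 2 ∈ 𝓝 t := Ioo_mem_nhds (by linarith [ht.1]) (by linarith [ht.2])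
  have key := hasDerivAt_integral_comp_curve (μ := P.prod (stdGaussian E))
    (g := fun a => fderiv ℝ f a x) (g' := fun a => (fderiv ℝ (fderiv ℝ f) a).flip x)
    (C := C * ‖x‖) (k := k + 1) (t := t)
    (hf.hasFDerivAt_fderiv_apply x)
    ((ContinuousLinearMap.flipₗᵢ ℝ E E ℝ).continuous.comp hf.continuous_hess |>.clm_apply
      continuous_const) (by positivity) (fun z => ?_)
    (A := fun u p => s • V p.1 + u • s • x + c • p.2) (A' := fun _ _ => s • x)
    (R := fun p => ‖V p.1‖ + 2 * ‖x‖ + ‖p.2‖) (s := Set.Ioo (-1) 2)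
    htm (fun u _ p => ?_) hAm (fun _ => aestronglyMeasurable_const) hAR (fun u _ p => ?_) hR
  · have i1 : ∀ u ∈ Set.Ioo (-1 : ℝ) 2, Integrable (fun p : Ω × E =>
        fderiv ℝ f (s • V p.1 + u • s • x + c • p.2) x) (P.prod (stdGaussian E)) := fun u hu =>
      hf.integrable_fderiv (hAm u) aestronglyMeasurable_const (hAR u hu)
        (fun p => by linarith [norm_nonneg (V p.1), norm_nonneg p.2, norm_nonneg x]) hR
    have e : (fun t : ℝ => ∫ ω, smoothedGrad f c (s • V ω + t • s • x) x ∂P) =ᶠ[𝓝 t]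
        fun t => ∫ p : Ω × E, fderiv ℝ f (s • V p.1 + t • s • x + c • p.2) x
          ∂(P.prod (stdGaussian E)) := by
      filter_upwards [htm] with u hu
      exact (integral_prod _ (i1 u hu)).symm
    refine (key.2.2.congr_of_eventuallyEq e).congr_deriv ?_
    simp only [ContinuousLinearMap.flip_apply, map_smul, smul_eq_mul]
    rw [integral_const_mul]
    congr 1
    exact integral_prod _ (hf.integrable_hess (hAm t) (hAR t (mem_of_mem_nhds htm)) hR x x)
  · refine ContinuousLinearMap.opNorm_le_bound _ (by positivity) fun v => ?_
    rw [ContinuousLinearMap.flip_apply]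
    refine ((fderiv ℝ (fderiv ℝ f) z).le_opNorm₂ v x).trans ?_
    have h1 : (1 + ‖z‖) ^ k ≤ (1 + ‖z‖) ^ (k + 1) := pow_le_pow_right₀ (by simp) (by omega)
    calc _ ≤ (C * (1 + ‖z‖) ^ (k + 1)) * ‖v‖ * ‖x‖ := by
          gcongr
          exact (hb z).trans (by gcongr)
      _ = _ := by ring
  · simpa using! (((hasDerivAt_id u).smul_const (s • x)).const_add (s • V p.1)).add_const (c • p.2)
  · rw [norm_smul]
    have : ‖s‖ * ‖x‖ ≤ ‖x‖ := mul_le_of_le_one_left (norm_nonneg x) hs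
    linarith [norm_nonneg (V p.1), norm_nonneg p.2, norm_nonneg x]

/-- Second-order Taylor bound for the averaged gradient, in terms of the size of the averaged
Hessian. -/
lemma abs_taylor_le_of_bdd (hf : C2Growth f k) (hV : MemLp V (k + 2 : ℕ) P)
    (hs0 : 0 ≤ s) (hs : |s| ≤ 1) (hc : |c| ≤ 1) {x : E} {A : ℝ}
    (hA : ∀ a, |∫ ω, smoothedHess f c (s • V ω + a) x ∂P| ≤ A) (y : E) :
    |∫ ω, smoothedGrad f c (s • V ω + s • x) x ∂P -
      ∫ ω, smoothedGrad f c (s • V ω) x ∂P -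
      s * ∫ ω, smoothedHess f c (s • V ω + s • y) x ∂P| ≤ 2 * s * A := by
  have key := norm_image_sub_le_of_norm_deriv_le_segment_01'
    (f := fun t : ℝ => ∫ ω, smoothedGrad f c (s • V ω + t • s • x) x ∂P) (C := s * A)
    (fun t ht => (hasDerivAt_integral_smoothedGrad hf hV hs hc x ht).hasDerivWithinAt)
    (fun t _ => by
      rw [Real.norm_eq_abs, abs_mul, abs_of_nonneg hs0]
      exact mul_le_mul_of_nonneg_left (hA _) hs0)
  simp only [one_smul, zero_smul, add_zero, Real.norm_eq_abs] at key
  have h2 : |s * ∫ ω, smoothedHess f c (s • V ω + s • y) x ∂P| ≤ s * A := by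
    rw [abs_mul, abs_of_nonneg hs0]
    exact mul_le_mul_of_nonneg_left (hA _) hs0
  linarith [abs_sub (∫ ω, smoothedGrad f c (s • V ω + s • x) x ∂P -
      ∫ ω, smoothedGrad f c (s • V ω) x ∂P) (s * ∫ ω, smoothedHess f c (s • V ω + s • y) x ∂P)]

/-- Second-order Taylor bound for the averaged gradient, in terms of the Lipschitz constant of the
averaged Hessian; the Hessian term may be taken at an independent point `y`. -/
lemma abs_taylor_le_of_lipschitz (hf : C2Growth f k) (hV : MemLp V (k + 2 : ℕ) P)
    (hs0 : 0 ≤ s) (hs : |s| ≤ 1) (hc : |c| ≤ 1) {x : E} {B : ℝ} (hB0 : 0 ≤ B)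
    (hB : ∀ a b, |∫ ω, smoothedHess f c (s • V ω + a) x ∂P -
      ∫ ω, smoothedHess f c (s • V ω + b) x ∂P| ≤ B * ‖a - b‖) (y : E) :
    |∫ ω, smoothedGrad f c (s • V ω + s • x) x ∂P -
      ∫ ω, smoothedGrad f c (s • V ω) x ∂P -
      s * ∫ ω, smoothedHess f c (s • V ω + s • y) x ∂P| ≤ s ^ 2 * B * (‖x‖ / 2 + ‖y‖) := by
  set h := ∫ ω, smoothedHess f c (s • V ω + s • y) x ∂P with hh
  have hd : ∀ t ∈ Set.Icc (0 : ℝ) 1, HasDerivAt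
      (fun t : ℝ => ∫ ω, smoothedGrad f c (s • V ω + t • s • x) x ∂P -
        ∫ ω, smoothedGrad f c (s • V ω) x ∂P - t * (s * h))
      (s * ((∫ ω, smoothedHess f c (s • V ω + t • s • x) x ∂P) - h)) t := by
    intro t ht
    convert! ((hasDerivAt_integral_smoothedGrad hf hV hs hc x ht).sub_const
      (∫ ω, smoothedGrad f c (s • V ω) x ∂P)).sub ((hasDerivAt_id t).mul_const (s * h)) using 1
    ring
  have hBd : ∀ t : ℝ, HasDerivAt (fun t : ℝ => s ^ 2 * B * (t ^ 2 / 2 * ‖x‖ + t * ‖y‖))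
      (s ^ 2 * B * (t * ‖x‖ + ‖y‖)) t := by
    intro t
    convert! (((((hasDerivAt_id t).pow 2).div_const 2).mul_const ‖x‖).add
      ((hasDerivAt_id t).mul_const ‖y‖)).const_mul (s ^ 2 * B) using 1
    simp
  have key := image_norm_le_of_norm_deriv_right_le_deriv_boundary'
    (fun t ht => (hd t ht).continuousAt.continuousWithinAt)
    (fun t ht => (hd t ⟨ht.1, ht.2.le⟩).hasDerivWithinAt)
    (B := fun t : ℝ => s ^ 2 * B * (t ^ 2 / 2 * ‖x‖ + t * ‖y‖)) (by simp)
    (fun t _ => (hBd t).continuousAt.continuousWithinAt)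
    (fun t _ => (hBd t).hasDerivWithinAt) (fun t ht => ?_) (Set.right_mem_Icc.2 zero_le_one)
  · simp only [one_smul, one_mul, one_pow, Real.norm_eq_abs] at key
    refine key.trans_eq ?_
    ring
  · rw [Real.norm_eq_abs, abs_mul, abs_of_nonneg hs0]
    have h1 : ‖t • s • x - s • y‖ ≤ s * (t * ‖x‖ + ‖y‖) := by
      refine (norm_sub_le _ _).trans_eq ?_
      rw [norm_smul, norm_smul, norm_smul, Real.norm_eq_abs, Real.norm_eq_abs, abs_of_nonneg hs0,
        abs_of_nonneg ht.1]
      ring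
    calc s * _ ≤ s * (B * (s * (t * ‖x‖ + ‖y‖))) := by
          gcongr
          exact (hB _ _).trans (by gcongr)
      _ = _ := by ring

end Pair

/-- The interpolation `θ ↦ E f(sin θ W + cos θ Z)`, from the Gaussian law at `0` to the law of `W`
at `π / 2`. -/
noncomputable def interp (f : E → ℝ) (P : Measure Ω) (W : Ω → E) (θ : ℝ) : ℝ :=
  ∫ p : Ω × E, f (Real.sin θ • W p.1 + Real.cos θ • p.2) ∂(P.prod (stdGaussian E))

lemma hasDerivAt_interp (hf : C2Growth f k) {W : Ω → E} (hW : MemLp W (k + 2 : ℕ) P) (θ : ℝ) :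
    HasDerivAt (interp f P W) (∫ p : Ω × E, fderiv ℝ f (Real.sin θ • W p.1 + Real.cos θ • p.2)
      (Real.cos θ • W p.1 - Real.sin θ • p.2) ∂(P.prod (stdGaussian E))) θ := by
  obtain ⟨C, hC, hb⟩ := hf.fderiv_bdd
  have mW := hW.1.comp_fst (ν := stdGaussian E)
  have mZ : AEStronglyMeasurable (fun p : Ω × E => p.2) (P.prod (stdGaussian E)) :=
    measurable_snd.aestronglyMeasurable
  have hle : ∀ (a b : ℝ) (p : Ω × E), |a| ≤ 1 → |b| ≤ 1 →
      ‖a • W p.1 + b • p.2‖ ≤ ‖W p.1‖ + ‖p.2‖ := fun a b p ha hb => by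
    simpa using norm_smul_add_le (V := W p.1) (X := 0) (z := p.2) ha (t := 0) (by simp) hb
  refine (hasDerivAt_integral_comp_curve (μ := P.prod (stdGaussian E))
    (fun z => (hf.differentiable z).hasFDerivAt) hf.contDiff_fderiv.continuous hC hb
    (A := fun u p => Real.sin u • W p.1 + Real.cos u • p.2)
    (A' := fun u p => Real.cos u • W p.1 - Real.sin u • p.2)
    (R := fun p => ‖W p.1‖ + ‖p.2‖) (s := Set.univ) univ_mem
    (fun u _ p => ?_) (fun u => (mW.const_smul _).add (mZ.const_smul _))
    (fun u => (mW.const_smul _).sub (mZ.const_smul _)) (fun u _ p => ?_) (fun u _ p => ?_) ?_).2.2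
  · convert! ((Real.hasDerivAt_sin u).smul_const (W p.1)).add
      ((Real.hasDerivAt_cos u).smul_const p.2) using 1
    rw [neg_smul, sub_eq_add_neg]
  · exact hle _ _ p (Real.abs_sin_le_one u) (Real.abs_cos_le_one u)
  · rw [sub_eq_add_neg, ← neg_smul]
    exact hle _ _ p (Real.abs_cos_le_one u) (by rw [abs_neg]; exact Real.abs_sin_le_one u)
  · simpa using integrable_one_add_pow (by omega) hW (MemLp.zero : MemLp (0 : Ω → E) _ P)

lemma interp_zero (f : E → ℝ) (W : Ω → E) : interp f P W 0 = ∫ z, f z ∂(stdGaussian E) := by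
  simp only [interp, Real.sin_zero, Real.cos_zero, zero_smul, one_smul, zero_add]
  rw [integral_fun_snd]
  simp

lemma interp_pi_div_two (f : E → ℝ) (W : Ω → E) :
    interp f P W (Real.pi / 2) = ∫ ω, f (W ω) ∂P := by
  simp only [interp, Real.sin_pi_div_two, Real.cos_pi_div_two, zero_smul, one_smul, add_zero]
  rw [integral_fun_fst (fun ω => f (W ω))]
  simp

end Interpolation

section StdSum

variable {E : Type*} [NormedAddCommGroup E] [InnerProductSpace ℝ E] [FiniteDimensional ℝ E]
  [MeasurableSpace E] [BorelSpace E] {f : E → ℝ} {k : ℕ}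
  {Ω : Type*} [MeasurableSpace Ω] {P : Measure Ω} [IsProbabilityMeasure P]
  {ι : Type*} [Fintype ι]

/-- `W` is the sum of the finite family `X` of centred square-integrable vectors, each `X i` is
independent of the rest of the sum, and `W` has identity covariance. -/
structure IsStdSum (P : Measure Ω) (X : ι → Ω → E) (W : Ω → E) : Prop where
  meas : ∀ i, Measurable (X i)
  sum : ∀ ω, W ω = ∑ i, X i ω
  indep : ∀ i, IndepFun (X i) (fun ω => W ω - X i ω) P
  mean : ∀ i, ∫ ω, X i ω ∂P = 0
  memLp : ∀ i, MemLp (X i) 2 P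
  cov : ∀ u v : E, ∫ ω, inner ℝ u (W ω) * inner ℝ v (W ω) ∂P = inner ℝ u v

variable {X : ι → Ω → E} {W : Ω → E}

lemma IsStdSum.measurable (h : IsStdSum P X W) : Measurable W := by
  rw [funext h.sum]
  exact Finset.measurable_sum _ fun i _ => h.meas i

lemma IsStdSum.memLp_sum (h : IsStdSum P X W) {p : ℝ≥0∞} (hX : ∀ i, MemLp (X i) p P) :
    MemLp W p P := by
  rw [funext h.sum]
  exact memLp_finsetSum _ fun i _ => hX i

lemma integral_inner_mul_inner_of_indepFun {Y V : Ω → E} (hYV : IndepFun Y V P)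
    (hY : MemLp Y 2 P) (hV : MemLp V 2 P) (hmean : ∫ ω, Y ω ∂P = 0) (u v : E) :
    Integrable (fun ω => inner ℝ u (V ω) * inner ℝ v (Y ω)) P ∧
    ∫ ω, inner ℝ u (V ω) * inner ℝ v (Y ω) ∂P = 0 := by
  have hi : IndepFun (fun ω => (inner ℝ u (V ω) : ℝ)) (fun ω => (inner ℝ v (Y ω) : ℝ)) P :=
    hYV.symm.comp (φ := fun x : E => (inner ℝ u x : ℝ)) (ψ := fun x : E => (inner ℝ v x : ℝ))
      (by fun_prop) (by fun_prop)
  have iY : Integrable (fun ω => (inner ℝ v (Y ω) : ℝ)) P :=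
    (hY.integrable (by norm_num)).const_inner v
  have iV : Integrable (fun ω => (inner ℝ u (V ω) : ℝ)) P :=
    (hV.integrable (by norm_num)).const_inner u
  refine ⟨hi.integrable_mul iV iY, ?_⟩
  have h := hi.integral_mul_eq_mul_integral iV.1 iY.1
  simp only [Pi.mul_apply] at h
  rw [h, integral_inner (hY.integrable (by norm_num)), hmean, inner_zero_right, mul_zero]

lemma IsStdSum.sum_cov (h : IsStdSum P X W) (u v : E) :
    ∑ i, ∫ ω, inner ℝ u (X i ω) * inner ℝ v (X i ω) ∂P = inner ℝ u v := by
  have hW := h.memLp_sum h.memLp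
  have hi := fun i => integral_inner_mul_inner_of_indepFun (h.indep i) (h.memLp i)
    (hW.sub (h.memLp i)) (h.mean i) u v
  have hX := fun i => integrable_inner_mul_inner (h.memLp i) u v
  have e : ∀ ω, inner ℝ u (W ω) * inner ℝ v (W ω) =
      ∑ i, (inner ℝ u (X i ω) * inner ℝ v (X i ω) +
        inner ℝ u (W ω - X i ω) * inner ℝ v (X i ω)) := by
    intro ω
    have : ∀ i, inner ℝ u (X i ω) * inner ℝ v (X i ω) +
        inner ℝ u (W ω - X i ω) * inner ℝ v (X i ω) = inner ℝ u (W ω) * inner ℝ v (X i ω) := by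
      intro i; rw [inner_sub_right]; ring
    simp_rw [this]
    rw [← Finset.mul_sum, ← inner_sum, ← h.sum]
  rw [← h.cov]
  simp_rw [e]
  have hXi : ∀ i, Integrable (fun ω => inner ℝ u (X i ω) * inner ℝ v (X i ω) +
      inner ℝ u (W ω - X i ω) * inner ℝ v (X i ω)) P := fun i => (hX i).add (hi i).1
  rw [integral_finsetSum _ fun i _ => hXi i]
  refine Finset.sum_congr rfl fun i _ => ?_
  rw [integral_add (hX i) (hi i).1, (hi i).2, add_zero]

/-- The derivative of the interpolation is a sum of second-order Taylor remainders, one for each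
summand: by Gaussian integration by parts the Gaussian part of the derivative is a Laplacian, which
is distributed over the summands because the covariances of the `X i` add up to the identity. -/
lemma IsStdSum.abs_deriv_interp_le (h : IsStdSum P X W) (hf : C2Growth f k)
    (hX : ∀ i, MemLp (X i) (k + 2 : ℕ) P) {θ : ℝ} (hθ : 0 ≤ Real.cos θ) {K : ι → E → E → ℝ}
    (hK : ∀ i x y, |∫ ω, smoothedGrad f (Real.cos θ) (Real.sin θ • (W ω - X i ω) +
        Real.sin θ • x) x ∂P -
      ∫ ω, smoothedGrad f (Real.cos θ) (Real.sin θ • (W ω - X i ω)) x ∂P -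
      Real.sin θ * ∫ ω, smoothedHess f (Real.cos θ) (Real.sin θ • (W ω - X i ω) +
        Real.sin θ • y) x ∂P| ≤ K i x y)
    (hKi : ∀ i, Integrable (fun p : Ω × Ω => K i (X i p.1) (X i p.2)) (P.prod P)) :
    |∫ p : Ω × E, fderiv ℝ f (Real.sin θ • W p.1 + Real.cos θ • p.2)
      (Real.cos θ • W p.1 - Real.sin θ • p.2) ∂(P.prod (stdGaussian E))| ≤
      Real.cos θ * ∑ i, ∫ ω', ∫ ω, K i (X i ω') (X i ω) ∂P ∂P := by
  set s := Real.sin θ with hs'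
  set c := Real.cos θ with hc'
  have hs : |s| ≤ 1 := Real.abs_sin_le_one θ
  have hc : |c| ≤ 1 := Real.abs_cos_le_one θ
  have hW := h.memLp_sum hX
  have mW := hW.1.comp_fst (ν := stdGaussian E)
  have mZ : AEStronglyMeasurable (fun p : Ω × E => p.2) (P.prod (stdGaussian E)) :=
    measurable_snd.aestronglyMeasurable
  let b := stdOrthonormalBasis ℝ E
  have hsplit : ∀ i ω, s • (W ω - X i ω) + s • X i ω = s • W ω := fun i ω => by
    rw [← smul_add, sub_add_cancel]
  have hR : Integrable (fun p : Ω × E => (1 + (‖W p.1‖ + ‖p.2‖)) ^ (k + 2))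
      (P.prod (stdGaussian E)) := by
    simpa using integrable_one_add_pow (by omega) hW (MemLp.zero : MemLp (0 : Ω → E) _ P)
  have hAR : ∀ p : Ω × E, ‖s • W p.1 + c • p.2‖ ≤ ‖W p.1‖ + ‖p.2‖ := fun p => by
    simpa using norm_smul_add_le (V := W p.1) (X := 0) (z := p.2) hs (t := 0) (by simp) hc
  have hAm : AEStronglyMeasurable (fun p : Ω × E => s • W p.1 + c • p.2)
      (P.prod (stdGaussian E)) := (mW.const_smul _).add (mZ.const_smul _)
  have iX : ∀ i, Integrable (fun p : Ω × E => fderiv ℝ f (s • W p.1 + c • p.2) (X i p.1))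
      (P.prod (stdGaussian E)) := fun i => by
    have := integrable_fderiv_pair (s := s) (t := s) (c := c) hf (hX i) (hW.sub (hX i)) hs hs hc
    simpa only [Pi.sub_apply, hsplit] using this
  have iZ : Integrable (fun p : Ω × E => fderiv ℝ f (s • W p.1 + c • p.2) p.2)
      (P.prod (stdGaussian E)) :=
    hf.integrable_fderiv hAm mZ hAR (fun p => by linarith [norm_nonneg (W p.1)]) hR
  have iH : ∀ x, Integrable (fun ω => smoothedHess f c (s • W ω) x) P := fun x =>
    (hf.integrable_hess hAm hAR hR x x).integral_prod_left
  -- the Gaussian part, by integration by parts along an orthonormal basis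
  have eZ : ∫ p : Ω × E, fderiv ℝ f (s • W p.1 + c • p.2) p.2 ∂(P.prod (stdGaussian E)) =
      c * ∑ j, ∫ ω, smoothedHess f c (s • W ω) (b j) ∂P := by
    rw [integral_prod _ iZ]
    have e : ∀ ω, ∫ z, fderiv ℝ f (s • W ω + c • z) z ∂(stdGaussian E) =
        c * ∑ j, smoothedHess f c (s • W ω) (b j) := by
      intro ω
      have e1 : ∀ z, fderiv ℝ f (s • W ω + c • z) z =
          ∑ j, inner ℝ (b j) z * fderiv ℝ f (s • W ω + c • z) (b j) := by
        intro z
        conv_lhs => rw [← b.sum_repr' z, map_sum]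
        simp [b.sum_repr' z]
      simp_rw [e1]
      rw [integral_finsetSum _ fun j _ => ((polyBdd_inner (b j)).mul
        ((hf.polyBdd_fderiv.comp_affine (s • W ω) c).clm_apply (b j))).integrable, Finset.mul_sum]
      exact Finset.sum_congr rfl fun j _ => (smoothedHess_eq_integral_fderiv hf c _ _).symm
    simp_rw [e]
    rw [integral_const_mul, integral_finsetSum _ fun j _ => iH (b j)]
  -- the Laplacian is the sum of the quadratic forms averaged over the summands,
  -- because their covariances add up to the identity
  have eTr : ∑ j, ∫ ω, smoothedHess f c (s • W ω) (b j) ∂P =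
      ∑ i, ∫ ω', ∫ ω, smoothedHess f c (s • W ω) (X i ω') ∂P ∂P := by
    simp_rw [integral_smoothedHess_eq_sum hf hW hs hc b]
    have i1 : ∀ i l m, Integrable (fun ω => inner ℝ (b l) (X i ω) * inner ℝ (b m) (X i ω) *
        ∫ p : Ω × E, fderiv ℝ (fderiv ℝ f) (s • W p.1 + c • p.2) (b l) (b m)
          ∂(P.prod (stdGaussian E))) P := fun i l m =>
      (integrable_inner_mul_inner (h.memLp i) _ _).mul_const _
    have e : ∀ i, ∫ ω, (∑ l, ∑ m, inner ℝ (b l) (X i ω) * inner ℝ (b m) (X i ω) *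
        ∫ p : Ω × E, fderiv ℝ (fderiv ℝ f) (s • W p.1 + c • p.2) (b l) (b m)
          ∂(P.prod (stdGaussian E))) ∂P =
        ∑ l, ∑ m, (∫ ω, inner ℝ (b l) (X i ω) * inner ℝ (b m) (X i ω) ∂P) *
        ∫ p : Ω × E, fderiv ℝ (fderiv ℝ f) (s • W p.1 + c • p.2) (b l) (b m)
          ∂(P.prod (stdGaussian E)) := by
      intro i
      rw [integral_finsetSum _ fun l _ => integrable_finsetSum _ fun m _ => i1 i l m]
      refine Finset.sum_congr rfl fun l _ => ?_
      rw [integral_finsetSum _ fun m _ => i1 i l m]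
      simp_rw [integral_mul_const]
    simp_rw [e]
    rw [Finset.sum_comm]
    conv_rhs => rw [Finset.sum_comm]
    refine Finset.sum_congr rfl fun l _ => ?_
    rw [Finset.sum_comm]
    conv_rhs => rw [Finset.sum_comm]
    refine Finset.sum_congr rfl fun m _ => ?_
    rw [← Finset.sum_mul, ← Finset.sum_mul, h.sum_cov, ← b.sum_inner_mul_inner (b l) (b m)]
    congr 1
    exact Finset.sum_congr rfl fun i _ => by rw [real_inner_comm (b m)]
  -- the part with `W`, distributed over the summands
  have eW : ∫ p : Ω × E, fderiv ℝ f (s • W p.1 + c • p.2) (W p.1) ∂(P.prod (stdGaussian E)) =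
      ∑ i, ∫ ω, smoothedGrad f c (s • W ω) (X i ω) ∂P := by
    have e : ∀ p : Ω × E, fderiv ℝ f (s • W p.1 + c • p.2) (W p.1) =
        ∑ i, fderiv ℝ f (s • W p.1 + c • p.2) (X i p.1) := by
      intro p
      rw [← map_sum, ← h.sum]
    simp_rw [e]
    rw [integral_finsetSum _ fun i _ => iX i]
    exact Finset.sum_congr rfl fun i _ => integral_prod _ (iX i)
  have iW : Integrable (fun p : Ω × E => fderiv ℝ f (s • W p.1 + c • p.2) (W p.1))
      (P.prod (stdGaussian E)) :=
    hf.integrable_fderiv hAm mW hAR (fun p => by linarith [norm_nonneg p.2]) hR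
  have eAll : ∫ p : Ω × E, fderiv ℝ f (s • W p.1 + c • p.2) (c • W p.1 - s • p.2)
      ∂(P.prod (stdGaussian E)) = c * ∑ i, (∫ ω, smoothedGrad f c (s • W ω) (X i ω) ∂P -
        s * ∫ ω', ∫ ω, smoothedHess f c (s • W ω) (X i ω') ∂P ∂P) := by
    simp_rw [map_sub, map_smul, smul_eq_mul]
    rw [integral_sub (iW.const_mul c) (iZ.const_mul s), integral_const_mul, integral_const_mul, eW,
      eZ, eTr, Finset.sum_sub_distrib, ← Finset.mul_sum]
    ring
  rw [eAll, abs_mul, abs_of_nonneg hθ]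
  refine mul_le_mul_of_nonneg_left ((Finset.abs_sum_le_sum_abs _ _).trans
    (Finset.sum_le_sum fun i _ => ?_)) hθ
  have key := abs_summand_le hf (h.indep i) (h.meas i) (h.measurable.sub (h.meas i)) (hX i)
    (hW.sub (hX i)) (h.mean i) hs hc (hK i) (hKi i)
  simpa only [hsplit] using key

/-- Integrating the bound on the derivative over `[0, θ₁]`, for a bound that is a sum of products
of a function of the summands and a function `a` of the parameter with primitive `A`. -/
lemma IsStdSum.abs_interp_sub_le (h : IsStdSum P X W) (hf : C2Growth f k)
    (hX : ∀ i, MemLp (X i) (k + 2 : ℕ) P) {θ₁ : ℝ} (h0 : 0 ≤ θ₁) (h1 : θ₁ ≤ Real.pi / 2)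
    {J : Type*} [Fintype J] {u : ι → J → E → E → ℝ} {a A : ι → J → ℝ → ℝ}
    (hu : ∀ i j, Integrable (fun p : Ω × Ω => u i j (X i p.1) (X i p.2)) (P.prod P))
    (hA : ∀ i j, ContinuousOn (A i j) (Set.Icc 0 θ₁))
    (hA' : ∀ i j, ∀ θ ∈ Set.Ico 0 θ₁, HasDerivWithinAt (A i j) (a i j θ) (Set.Ici θ) θ)
    (hK : ∀ θ ∈ Set.Ico 0 θ₁, ∀ i x y, Real.cos θ *
      |∫ ω, smoothedGrad f (Real.cos θ) (Real.sin θ • (W ω - X i ω) + Real.sin θ • x) x ∂P -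
      ∫ ω, smoothedGrad f (Real.cos θ) (Real.sin θ • (W ω - X i ω)) x ∂P -
      Real.sin θ * ∫ ω, smoothedHess f (Real.cos θ) (Real.sin θ • (W ω - X i ω) +
        Real.sin θ • y) x ∂P| ≤ ∑ j, u i j x y * a i j θ) :
    |interp f P W θ₁ - interp f P W 0| ≤
      ∑ i, ∑ j, (A i j θ₁ - A i j 0) * ∫ ω', ∫ ω, u i j (X i ω') (X i ω) ∂P ∂P := by
  have hW := h.memLp_sum hX
  have hd := hasDerivAt_interp hf hW
  have hB : ∀ θ ∈ Set.Ico 0 θ₁, HasDerivWithinAt (fun θ => ∑ i, ∑ j, (A i j θ - A i j 0) *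
      ∫ ω', ∫ ω, u i j (X i ω') (X i ω) ∂P ∂P)
      (∑ i, ∑ j, a i j θ * ∫ ω', ∫ ω, u i j (X i ω') (X i ω) ∂P ∂P) (Set.Ici θ) θ := by
    intro θ hθ
    exact HasDerivWithinAt.fun_sum fun i _ => HasDerivWithinAt.fun_sum fun j _ =>
      ((hA' i j θ hθ).sub_const _).mul_const _
  refine image_norm_le_of_norm_deriv_right_le_deriv_boundary'
    (f := fun θ => interp f P W θ - interp f P W 0)
    (fun θ _ => ((hd θ).sub_const _).continuousAt.continuousWithinAt)
    (fun θ _ => ((hd θ).sub_const _).hasDerivWithinAt) (by simp)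
    (continuousOn_finsetSum _ fun i _ => continuousOn_finsetSum _ fun j _ =>
      ((hA i j).sub continuousOn_const).mul continuousOn_const) hB (fun θ hθ => ?_)
    (Set.right_mem_Icc.2 h0)
  have hc : 0 < Real.cos θ := Real.cos_pos_of_mem_Ioo
    ⟨by linarith [hθ.1, Real.pi_pos], by linarith [hθ.2]⟩
  have hi : ∀ i, Integrable (fun p : Ω × Ω => ∑ j, u i j (X i p.1) (X i p.2) * a i j θ)
      (P.prod P) := fun i => integrable_finsetSum _ fun j _ => (hu i j).mul_const _
  have key := h.abs_deriv_interp_le hf hX hc.le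
    (K := fun i x y => (∑ j, u i j x y * a i j θ) / Real.cos θ)
    (fun i x y => by rw [le_div_iff₀ hc, mul_comm]; exact hK θ hθ i x y)
    (fun i => (hi i).div_const _)
  refine key.trans_eq ?_
  rw [Finset.mul_sum]
  refine Finset.sum_congr rfl fun i _ => ?_
  simp_rw [integral_div]
  rw [mul_div_cancel₀ _ hc.ne', ← integral_prod _ (hi i),
    integral_finsetSum _ fun j _ => (hu i j).mul_const _]
  refine Finset.sum_congr rfl fun j _ => ?_
  rw [integral_mul_const, integral_prod _ (hu i j), mul_comm]

end StdSum

/-! ### Moment inequalities for one random vector -/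

section Moments

variable {E : Type*} [NormedAddCommGroup E] [InnerProductSpace ℝ E] [FiniteDimensional ℝ E]
  [MeasurableSpace E] [BorelSpace E]
  {Ω : Type*} [MeasurableSpace Ω] {P : Measure Ω} [IsProbabilityMeasure P]

/-- Chebyshev's association inequality: similarly ordered random variables are positively
correlated. -/
lemma integral_mul_integral_le_integral_mul {φ g : Ω → ℝ} (hφ : Integrable φ P)
    (hg : Integrable g P) (hφg : Integrable (fun ω => φ ω * g ω) P)
    (hmono : ∀ ω ω', 0 ≤ (φ ω - φ ω') * (g ω - g ω')) :
    (∫ ω, φ ω ∂P) * ∫ ω, g ω ∂P ≤ ∫ ω, φ ω * g ω ∂P := by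
  have h1 : ∀ ω', 0 ≤ ∫ ω, φ ω * g ω ∂P - g ω' * ∫ ω, φ ω ∂P - φ ω' * ∫ ω, g ω ∂P + φ ω' * g ω' := by
    intro ω'
    have e : ∀ ω, (φ ω - φ ω') * (g ω - g ω') =
        φ ω * g ω - g ω' * φ ω - φ ω' * g ω + φ ω' * g ω' := fun ω => by ring
    have h := integral_nonneg (μ := P) (f := fun ω => (φ ω - φ ω') * (g ω - g ω'))
      (fun ω => hmono ω ω')
    simp_rw [e] at h
    have i1 : Integrable (fun ω => φ ω * g ω - g ω' * φ ω) P := hφg.sub (hφ.const_mul _)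
    have i2 : Integrable (fun ω => φ ω * g ω - g ω' * φ ω - φ ω' * g ω) P :=
      i1.sub (hg.const_mul _)
    rw [integral_add i2 (integrable_const _), integral_sub i1 (hg.const_mul _),
      integral_sub hφg (hφ.const_mul _), integral_const_mul, integral_const_mul] at h
    simpa using h
  have h := integral_nonneg (μ := P) (f := fun ω' => ∫ ω, φ ω * g ω ∂P - g ω' * ∫ ω, φ ω ∂P -
    φ ω' * ∫ ω, g ω ∂P + φ ω' * g ω') h1
  have i0 : Integrable (fun ω' => ∫ ω, φ ω * g ω ∂P - g ω' * ∫ ω, φ ω ∂P) P :=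
    (integrable_const _).sub (hg.mul_const _)
  have i1 : Integrable (fun ω' => ∫ ω, φ ω * g ω ∂P - g ω' * ∫ ω, φ ω ∂P -
      φ ω' * ∫ ω, g ω ∂P) P := i0.sub (hφ.mul_const _)
  rw [integral_add i1 hφg, integral_sub i0 (hφ.mul_const _),
    integral_sub (integrable_const _) (hg.mul_const _), integral_mul_const, integral_mul_const] at h
  simp only [integral_const, probReal_univ, one_smul] at h
  linarith

lemma sq_integral_norm_le {Y : Ω → E} (hY : MemLp Y 2 P) :
    (∫ ω, ‖Y ω‖ ∂P) ^ 2 ≤ ∫ ω, ‖Y ω‖ ^ 2 ∂P := by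
  have i2 : Integrable (fun ω => ‖Y ω‖ ^ 2) P := hY.integrable_norm_pow (by norm_num)
  have i1 : Integrable (fun ω => ‖Y ω‖) P := (hY.integrable (by norm_num)).norm
  have := integral_mul_integral_le_integral_mul i1 i1 (by simpa only [← sq] using i2)
    fun ω ω' => mul_self_nonneg _
  simpa only [← sq] using this

lemma integrable_norm_sq_mul_min {X : Ω → E} (hX : MemLp X 2 P) {A B C : ℝ} (hA : 0 ≤ A)
    (hB : 0 ≤ B) (hC : 0 ≤ C) :
    Integrable (fun ω => ‖X ω‖ ^ 2 * min A (B * ‖X ω‖ + C)) P := by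
  have i2 : Integrable (fun ω => ‖X ω‖ ^ 2) P := hX.integrable_norm_pow (by norm_num)
  refine (i2.mul_const A).mono' ?_ (ae_of_all _ fun ω => ?_)
  · have h := hX.1.norm
    exact (h.pow 2).mul (aestronglyMeasurable_const.inf ((h.const_mul B).add_const C))
  · rw [Real.norm_eq_abs, abs_of_nonneg (by positivity)]
    exact mul_le_mul_of_nonneg_left (min_le_left _ _) (by positivity)

lemma integrable_norm_sq_mul_min_pair {X : Ω → E} (hX : MemLp X 2 P) {A B C : ℝ} (hA : 0 ≤ A)
    (hB : 0 ≤ B) (hC : 0 ≤ C) :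
    Integrable (fun p : Ω × Ω =>
      ‖X p.1‖ ^ 2 * min A (B * (‖X p.1‖ / 2 + ‖X p.2‖) + C)) (P.prod P) := by
  have i2 : Integrable (fun ω => ‖X ω‖ ^ 2) P := hX.integrable_norm_pow (by norm_num)
  refine ((i2.comp_fst P).mul_const A).mono' ?_ (ae_of_all _ fun ω => ?_)
  · have h1 := (hX.1.comp_fst (ν := P)).norm
    have h2 := (hX.1.comp_snd (μ := P)).norm
    have h1' : AEStronglyMeasurable (fun p : Ω × Ω => ‖X p.1‖ / 2) (P.prod P) :=
      h1.mul_const (1 / 2) |>.congr (ae_of_all _ fun p => by simp [div_eq_mul_inv])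
    exact (h1.pow 2).mul (aestronglyMeasurable_const.inf (((h1'.add h2).const_mul B).add_const C))
  · rw [Real.norm_eq_abs, abs_of_nonneg (by positivity)]
    exact mul_le_mul_of_nonneg_left (min_le_left _ _) (by positivity)

lemma min_add_le_min_add_min {A x y : ℝ} (hA : 0 ≤ A) (hx : 0 ≤ x) (hy : 0 ≤ y) :
    min A (x + y) ≤ min A x + min A y := by
  rcases le_total A x with h | h <;> rcases le_total A y with h' | h' <;>
    simp only [min_eq_left, min_eq_right, h, h', min_le_iff] <;> first
    | (left; linarith)
    | (right; linarith)

/-- Decoupling of the truncated third moment, with the independent copy inside the truncation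
averaged out. -/
lemma integral_integral_norm_sq_mul_min_le_add {X : Ω → E} (hX : MemLp X 2 P) {A B C : ℝ}
    (hA : 0 ≤ A) (hB : 0 ≤ B) (hC : 0 ≤ C) :
    ∫ ω', ∫ ω, ‖X ω'‖ ^ 2 * min A (B * (‖X ω'‖ / 2 + ‖X ω‖) + C) ∂P ∂P ≤
      ∫ ω, ‖X ω‖ ^ 2 * min A (B / 2 * ‖X ω‖) ∂P +
        (∫ ω, ‖X ω‖ ^ 2 ∂P) * ∫ ω, min A (B * ‖X ω‖ + C) ∂P := by
  have i2 : Integrable (fun ω => ‖X ω‖ ^ 2) P := hX.integrable_norm_pow (by norm_num)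
  have j1 : Integrable (fun ω => ‖X ω‖ ^ 2 * min A (B / 2 * ‖X ω‖)) P := by
    simpa using integrable_norm_sq_mul_min hX hA (div_nonneg hB zero_le_two) le_rfl
  have j2 : Integrable (fun ω => min A (B * ‖X ω‖ + C)) P := by
    refine (integrable_const A).mono' ?_ (ae_of_all _ fun ω => ?_)
    · exact aestronglyMeasurable_const.inf ((hX.1.norm.const_mul B).add_const C)
    · rw [Real.norm_eq_abs, abs_of_nonneg (by positivity)]
      exact min_le_left _ _
  rw [← integral_prod _ (integrable_norm_sq_mul_min_pair hX hA hB hC)]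
  have e : ∫ ω, ‖X ω‖ ^ 2 * min A (B / 2 * ‖X ω‖) ∂P =
      ∫ p : Ω × Ω, ‖X p.1‖ ^ 2 * min A (B / 2 * ‖X p.1‖) ∂(P.prod P) := by
    rw [integral_fun_fst (fun ω => ‖X ω‖ ^ 2 * min A (B / 2 * ‖X ω‖))]
    simp
  rw [e, ← integral_prod_mul (fun ω => ‖X ω‖ ^ 2) (fun ω => min A (B * ‖X ω‖ + C)),
    ← integral_add (j1.comp_fst P) (i2.mul_prod j2)]
  refine integral_mono (integrable_norm_sq_mul_min_pair hX hA hB hC)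
    ((j1.comp_fst P).add (i2.mul_prod j2)) fun p => ?_
  have := min_add_le_min_add_min hA (x := B / 2 * ‖X p.1‖) (y := B * ‖X p.2‖ + C)
    (by positivity) (by positivity)
  have e' : B * (‖X p.1‖ / 2 + ‖X p.2‖) + C = B / 2 * ‖X p.1‖ + (B * ‖X p.2‖ + C) := by ring
  simp only [e']
  rw [← mul_add]
  exact mul_le_mul_of_nonneg_left this (by positivity)

/-- The independent copy is removed by the association inequality, since `‖X‖²` and
`min A (B * ‖X‖)` are both increasing in `‖X‖`. -/
lemma integral_integral_norm_sq_mul_min_le {X : Ω → E} (hX : MemLp X 2 P) {A B : ℝ}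
    (hA : 0 ≤ A) (hB : 0 ≤ B) :
    ∫ ω', ∫ ω, ‖X ω'‖ ^ 2 * min A (B * (‖X ω'‖ / 2 + ‖X ω‖)) ∂P ∂P ≤
      ∫ ω, ‖X ω‖ ^ 2 * min (2 * A) (3 / 2 * B * ‖X ω‖) ∂P := by
  have i2 : Integrable (fun ω => ‖X ω‖ ^ 2) P := hX.integrable_norm_pow (by norm_num)
  have h := integral_integral_norm_sq_mul_min_le_add hX hA hB le_rfl
  simp only [add_zero] at h
  have j2 : Integrable (fun ω => min A (B * ‖X ω‖)) P := by
    refine (integrable_const A).mono' ?_ (ae_of_all _ fun ω => ?_)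
    · exact aestronglyMeasurable_const.inf (hX.1.norm.const_mul B)
    · rw [Real.norm_eq_abs, abs_of_nonneg (by positivity)]
      exact min_le_left _ _
  have j3 : Integrable (fun ω => ‖X ω‖ ^ 2 * min A (B * ‖X ω‖)) P := by
    simpa using integrable_norm_sq_mul_min hX hA hB le_rfl
  have j1 : Integrable (fun ω => ‖X ω‖ ^ 2 * min A (B / 2 * ‖X ω‖)) P := by
    simpa using integrable_norm_sq_mul_min hX hA (div_nonneg hB zero_le_two) le_rfl
  have j4 : Integrable (fun ω => ‖X ω‖ ^ 2 * min (2 * A) (3 / 2 * B * ‖X ω‖)) P := by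
    simpa using integrable_norm_sq_mul_min hX (A := 2 * A) (B := 3 / 2 * B) (by positivity)
      (by positivity) le_rfl
  have hc := integral_mul_integral_le_integral_mul i2 j2 j3 fun ω ω' => by
    rcases le_total ‖X ω‖ ‖X ω'‖ with hle | hle
    · refine mul_nonneg_of_nonpos_of_nonpos (sub_nonpos.2 (by gcongr)) (sub_nonpos.2 ?_)
      exact min_le_min_left _ (by gcongr)
    · refine mul_nonneg (sub_nonneg.2 (by gcongr)) (sub_nonneg.2 ?_)
      exact min_le_min_left _ (by gcongr)
  refine (h.trans (add_le_add_right hc _)).trans ?_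
  rw [← integral_add j1 j3]
  refine integral_mono (j1.add j3) j4 fun ω => ?_
  dsimp only
  rw [← mul_add]
  refine mul_le_mul_of_nonneg_left (le_min ?_ ?_) (by positivity)
  · linarith [min_le_left A (B / 2 * ‖X ω‖), min_le_left A (B * ‖X ω‖)]
  · linarith [min_le_right A (B / 2 * ‖X ω‖), min_le_right A (B * ‖X ω‖)]

/-- Inside a truncated third moment, the mean of `‖X‖` may be replaced by `‖X‖` itself at the cost
of the factor `27 / 23`, which comes from `x² (μ - x) ≤ 4 μ³ / 27`. -/
lemma integral_norm_sq_mul_min_mean_le {X : Ω → E} (hX : MemLp X 2 P) {A B : ℝ}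
    (hA : 0 ≤ A) (hB : 0 < B) :
    (∫ ω, ‖X ω‖ ^ 2 ∂P) * min A (B * ∫ ω, ‖X ω‖ ∂P) ≤
      27 / 23 * ∫ ω, ‖X ω‖ ^ 2 * min A (B * ‖X ω‖) ∂P := by
  have i2 : Integrable (fun ω => ‖X ω‖ ^ 2) P := hX.integrable_norm_pow (by norm_num)
  have j3 : Integrable (fun ω => ‖X ω‖ ^ 2 * min A (B * ‖X ω‖)) P := by
    simpa using integrable_norm_sq_mul_min hX hA hB.le le_rfl
  set m := ∫ ω, ‖X ω‖ ∂P with hm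
  have hm0 : 0 ≤ m := integral_nonneg (f := fun ω => ‖X ω‖) fun ω => norm_nonneg _
  have hm2 : m ^ 2 ≤ ∫ ω, ‖X ω‖ ^ 2 ∂P := sq_integral_norm_le hX
  -- the mean norm, cut off so that the truncation at `A` is not felt up to `μ`
  set μ := min (A / B) m with hμ
  have hμ0 : 0 ≤ μ := le_min (by positivity) hm0
  have hBμ : min A (B * m) = B * μ := by
    rw [hμ, mul_min_of_nonneg _ _ hB.le, mul_div_cancel₀ _ hB.ne']
  -- `x² (μ - x) ≤ 4 μ³ / 27`, as the difference is `(x - 2 μ / 3)² (x + μ / 3)`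
  have hpt : ∀ x : ℝ, 0 ≤ x → B * μ * x ^ 2 - 4 / 27 * B * μ ^ 3 ≤ x ^ 2 * min A (B * x) := by
    intro x hx
    have hA' : B * μ ≤ A := by rw [← hBμ]; exact min_le_left _ _
    rcases le_total A (B * x) with h | h
    · rw [min_eq_left h]
      nlinarith [mul_le_mul_of_nonneg_left hA' (sq_nonneg x), mul_nonneg hB.le (pow_nonneg hμ0 3)]
    · rw [min_eq_right h]
      have : 0 ≤ B * ((x - 2 / 3 * μ) ^ 2 * (x + μ / 3)) := by positivity
      nlinarith
  have hint := integral_mono (((i2.const_mul (B * μ))).sub (integrable_const (4 / 27 * B * μ ^ 3)))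
    j3 fun ω => hpt ‖X ω‖ (norm_nonneg _)
  have e := integral_sub (i2.const_mul (B * μ)) (integrable_const (μ := P) (4 / 27 * B * μ ^ 3))
  simp only [Pi.sub_apply] at hint
  rw [e, integral_const_mul] at hint
  simp only [integral_const, probReal_univ, one_smul] at hint
  rw [hBμ]
  -- the error `4 μ³ / 27` is at most `4 / 27` of the main term `μ E‖X‖²`
  have : μ ^ 2 ≤ ∫ ω, ‖X ω‖ ^ 2 ∂P := le_trans (by gcongr; exact min_le_right _ _) hm2
  nlinarith [mul_le_mul_of_nonneg_left this (mul_nonneg hB.le hμ0)]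

end Moments

/-! ### Error bounds for finite sums and test functions with two or three derivatives -/

section FiniteBounds

variable {E : Type*} [NormedAddCommGroup E] [InnerProductSpace ℝ E] [FiniteDimensional ℝ E]
  [MeasurableSpace E] [BorelSpace E] {f : E → ℝ} {k : ℕ}
  {Ω : Type*} [MeasurableSpace Ω] {P : Measure Ω} [IsProbabilityMeasure P]
  {ι : Type*} [Fintype ι] {X : ι → Ω → E} {W : Ω → E}

lemma integrable_smoothedHess_comp (hf : C2Growth f k) {V : Ω → E} (hV : MemLp V (k + 2 : ℕ) P)
    {s c : ℝ} (hs : |s| ≤ 1) (hc : |c| ≤ 1) (a x : E) :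
    Integrable (fun ω => smoothedHess f c (s • V ω + a) x) P := by
  have := (integrable_hess_pair (X := fun _ => a) hf (memLp_const a) hV hs (t := 1) (by simp) hc
    x x).integral_prod_left
  simpa [smoothedHess] using this

lemma abs_integral_smoothedHess_le {V : Ω → E} {s c A : ℝ} {x : E}
    (hA : ∀ a, |smoothedHess f c a x| ≤ A) (a : E) :
    |∫ ω, smoothedHess f c (s • V ω + a) x ∂P| ≤ A := by
  have := norm_integral_le_of_norm_le_const (μ := P)
    (f := fun ω => smoothedHess f c (s • V ω + a) x) (ae_of_all _ fun ω => hA _)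
  simpa using this

lemma abs_integral_smoothedHess_sub_le (hf : C2Growth f k) {V : Ω → E}
    (hV : MemLp V (k + 2 : ℕ) P) {s c : ℝ} (hs : |s| ≤ 1) (hc : |c| ≤ 1) {B : ℝ} {x : E}
    (hB : ∀ a b, |smoothedHess f c a x - smoothedHess f c b x| ≤ B * ‖a - b‖) (a b : E) :
    |∫ ω, smoothedHess f c (s • V ω + a) x ∂P - ∫ ω, smoothedHess f c (s • V ω + b) x ∂P| ≤
      B * ‖a - b‖ := by
  rw [← integral_sub (integrable_smoothedHess_comp hf hV hs hc a x)
    (integrable_smoothedHess_comp hf hV hs hc b x)]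
  have := norm_integral_le_of_norm_le_const (μ := P)
    (f := fun ω => smoothedHess f c (s • V ω + a) x - smoothedHess f c (s • V ω + b) x)
    (ae_of_all _ fun ω => (hB _ _).trans_eq (by rw [add_sub_add_left_eq_sub]))
  simpa using this

lemma smoothedHess_sub_le_of_lipschitz_hess (hf : C2Growth f k) {B : ℝ} {x : E}
    (hB : ∀ a b, |fderiv ℝ (fderiv ℝ f) a x x - fderiv ℝ (fderiv ℝ f) b x x| ≤ B * ‖a - b‖)
    (c : ℝ) (a b : E) :
    |smoothedHess f c a x - smoothedHess f c b x| ≤ B * ‖a - b‖ := by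
  unfold smoothedHess
  rw [← integral_sub (((hf.polyBdd_hess.comp_affine a c).clm_apply x).clm_apply x).integrable
    (((hf.polyBdd_hess.comp_affine b c).clm_apply x).clm_apply x).integrable]
  have := norm_integral_le_of_norm_le_const (μ := stdGaussian E)
    (f := fun z => fderiv ℝ (fderiv ℝ f) (a + c • z) x x - fderiv ℝ (fderiv ℝ f) (b + c • z) x x)
    (ae_of_all _ fun z => (hB _ _).trans_eq (by rw [add_sub_add_right_eq_sub]))
  simpa using this

lemma smoothedHess_le_of_bdd {A : ℝ} {x : E}
    (hA : ∀ a, |fderiv ℝ (fderiv ℝ f) a x x| ≤ A) (c : ℝ) (a : E) :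
    |smoothedHess f c a x| ≤ A := by
  have := norm_integral_le_of_norm_le_const (μ := stdGaussian E)
    (f := fun z => fderiv ℝ (fderiv ℝ f) (a + c • z) x x) (ae_of_all _ fun z => hA _)
  simpa [smoothedHess] using this

lemma IsStdSum.memLp_rest (h : IsStdSum P X W) {p : ℝ≥0∞} (hX : ∀ i, MemLp (X i) p P) (i : ι) :
    MemLp (fun ω => W ω - X i ω) p P := (h.memLp_sum hX).sub (hX i)

/-- The Taylor remainder is at most `sin² θ * L * ‖x‖² * (‖x‖ / 2 + ‖y‖)` without any smoothing. The
factor `1 / 3` comes from `∫ sin² cos`, and the factor `3 / 2` from `E‖X‖² * E‖X‖ ≤ E‖X‖³`. -/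
lemma IsStdSum.abs_sub_le_of_lipschitz_hess (h : IsStdSum P X W) (hf : C2Growth f 1)
    (hX : ∀ i, MemLp (X i) 3 P) {L : ℝ} (hL0 : 0 ≤ L)
    (hL : ∀ a b x, |fderiv ℝ (fderiv ℝ f) a x x - fderiv ℝ (fderiv ℝ f) b x x| ≤
      L * ‖x‖ ^ 2 * ‖a - b‖) :
    |∫ ω, f (W ω) ∂P - ∫ z, f z ∂(stdGaussian E)| ≤ L / 2 * ∑ i, ∫ ω, ‖X i ω‖ ^ 3 ∂P := by
  have hX3 : ∀ i, MemLp (X i) (1 + 2 : ℕ) P := fun i => by exact_mod_cast hX i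
  have i3 : ∀ i, Integrable (fun ω => ‖X i ω‖ ^ 3) P := fun i =>
    (hX3 i).integrable_norm_pow (by norm_num)
  have i2 : ∀ i, Integrable (fun ω => ‖X i ω‖ ^ 2) P := fun i =>
    (h.memLp i).integrable_norm_pow (by norm_num)
  have i1 : ∀ i, Integrable (fun ω => ‖X i ω‖) P := fun i =>
    ((h.memLp i).integrable (by norm_num)).norm
  have e : ∀ x y : E, ‖x‖ ^ 2 * (‖x‖ / 2 + ‖y‖) = ‖x‖ ^ 3 / 2 + ‖x‖ ^ 2 * ‖y‖ :=
    fun x y => by ring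
  have hu : ∀ i, Integrable (fun p : Ω × Ω => ‖X i p.1‖ ^ 2 * (‖X i p.1‖ / 2 + ‖X i p.2‖))
      (P.prod P) := fun i => by
    simp_rw [e]
    exact (((i3 i).comp_fst P).div_const 2).add ((i2 i).mul_prod (i1 i))
  have key := h.abs_interp_sub_le hf hX3 Real.pi_div_two_pos.le le_rfl (J := Unit)
    (u := fun _ _ x y => ‖x‖ ^ 2 * (‖x‖ / 2 + ‖y‖))
    (a := fun _ _ θ => L * (Real.sin θ ^ 2 * Real.cos θ))
    (A := fun _ _ θ => L * (Real.sin θ ^ 3 / 3)) (fun i _ => hu i)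
    (fun _ _ => by fun_prop) (fun _ _ θ _ => ?_) (fun θ hθ i x y => ?_)
  · rw [interp_zero, interp_pi_div_two] at key
    refine key.trans ?_
    simp only [Finset.univ_unique, Finset.sum_singleton, Real.sin_pi_div_two, Real.sin_zero]
    rw [Finset.mul_sum]
    refine Finset.sum_le_sum fun i _ => ?_
    have e2 : ∫ ω', ∫ ω, ‖X i ω'‖ ^ 2 * (‖X i ω'‖ / 2 + ‖X i ω‖) ∂P ∂P =
        (∫ ω, ‖X i ω‖ ^ 3 ∂P) / 2 + (∫ ω, ‖X i ω‖ ^ 2 ∂P) * ∫ ω, ‖X i ω‖ ∂P := by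
      rw [← integral_prod _ (hu i)]
      simp_rw [e]
      rw [integral_add (((i3 i).comp_fst P).div_const 2) ((i2 i).mul_prod (i1 i)),
        integral_prod_mul (fun ω => ‖X i ω‖ ^ 2) (fun ω => ‖X i ω‖),
        integral_fun_fst (fun ω => ‖X i ω‖ ^ 3 / 2), integral_div]
      simp
    have ha := integral_mul_integral_le_integral_mul (i2 i) (i1 i)
      (by simpa only [← pow_succ] using i3 i) (fun ω ω' => by
        have : (‖X i ω‖ ^ 2 - ‖X i ω'‖ ^ 2) * (‖X i ω‖ - ‖X i ω'‖) =
          (‖X i ω‖ + ‖X i ω'‖) * (‖X i ω‖ - ‖X i ω'‖) ^ 2 := by ring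
        rw [this]; positivity)
    simp only [← pow_succ] at ha
    norm_num at ha
    rw [e2]
    nlinarith
  · convert! (((Real.hasDerivAt_sin θ).pow 3).div_const 3).const_mul L |>.hasDerivWithinAt using 1
    ring
  · have hs0 : 0 ≤ Real.sin θ :=
      Real.sin_nonneg_of_nonneg_of_le_pi hθ.1 (by linarith [hθ.2, Real.pi_pos])
    have hc0 : 0 ≤ Real.cos θ := Real.cos_nonneg_of_neg_pi_div_two_le_of_le
      (by linarith [hθ.1, Real.pi_pos]) hθ.2.le
    have hb := abs_taylor_le_of_lipschitz hf (h.memLp_rest hX3 i) hs0 (Real.abs_sin_le_one θ)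
      (Real.abs_cos_le_one θ) (x := x) (B := L * ‖x‖ ^ 2) (by positivity)
      (fun a b => abs_integral_smoothedHess_sub_le hf (h.memLp_rest hX3 i) (Real.abs_sin_le_one θ)
        (Real.abs_cos_le_one θ) (smoothedHess_sub_le_of_lipschitz_hess hf (hL · · x) _) a b) y
    refine (mul_le_mul_of_nonneg_left hb hc0).trans_eq ?_
    simp only [Finset.univ_unique, Finset.sum_singleton]
    ring

/-- A quadratic test function has the same mean under the two laws. -/
lemma IsStdSum.integral_eq_of_hess_const (h : IsStdSum P X W) (hf : C2Growth f 0)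
    (hL : ∀ a b x, fderiv ℝ (fderiv ℝ f) a x x = fderiv ℝ (fderiv ℝ f) b x x) :
    ∫ ω, f (W ω) ∂P = ∫ z, f z ∂(stdGaussian E) := by
  have hX2 : ∀ i, MemLp (X i) (0 + 2 : ℕ) P := fun i => by exact_mod_cast h.memLp i
  have key := h.abs_interp_sub_le hf hX2 Real.pi_div_two_pos.le le_rfl (J := Empty)
    (u := fun _ _ _ _ => 0) (a := fun _ _ _ => 0) (A := fun _ _ _ => 0) (by simp) (by simp)
    (by simp) (fun θ hθ i x y => ?_)
  · rw [interp_zero, interp_pi_div_two] at key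
    simp only [Finset.univ_eq_empty, Finset.sum_empty, Finset.sum_const_zero] at key
    linarith [abs_nonpos_iff.1 key]
  · have hs0 : 0 ≤ Real.sin θ :=
      Real.sin_nonneg_of_nonneg_of_le_pi hθ.1 (by linarith [hθ.2, Real.pi_pos])
    have hc0 : 0 ≤ Real.cos θ := Real.cos_nonneg_of_neg_pi_div_two_le_of_le
      (by linarith [hθ.1, Real.pi_pos]) hθ.2.le
    have hb := abs_taylor_le_of_lipschitz hf (h.memLp_rest hX2 i) hs0 (Real.abs_sin_le_one θ)
      (Real.abs_cos_le_one θ) (x := x) (B := 0) le_rfl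
      (fun a b => abs_integral_smoothedHess_sub_le hf (h.memLp_rest hX2 i) (Real.abs_sin_le_one θ)
        (Real.abs_cos_le_one θ) (smoothedHess_sub_le_of_lipschitz_hess hf
        (fun a b => by simp [hL a b x]) _) a b) y
    refine (mul_le_mul_of_nonneg_left hb hc0).trans_eq ?_
    simp

/-- Version of `IsStdSum.abs_interp_sub_le` where each Taylor remainder has a crude bound, with
primitive `α`, and a bound linear in `‖x‖ / 2 + ‖y‖`, with primitives `β` and `β'`. Which of them is
used is decided, for each pair `(x, y)`, by the integrated bounds. If `B i = 0` the crude bound must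
be the smaller one, for otherwise the region where the linear bound is used could be unbounded. -/
lemma IsStdSum.abs_interp_sub_le_min (h : IsStdSum P X W) (hf : C2Growth f 0) {θ₁ : ℝ}
    (h0 : 0 ≤ θ₁) (h1 : θ₁ ≤ Real.pi / 2) {a b b' α β β' : ι → ℝ → ℝ}
    (hα : ∀ i, ContinuousOn (α i) (Set.Icc 0 θ₁)) (hβ : ∀ i, ContinuousOn (β i) (Set.Icc 0 θ₁))
    (hβ' : ∀ i, ContinuousOn (β' i) (Set.Icc 0 θ₁))
    (dα : ∀ i, ∀ θ ∈ Set.Ico 0 θ₁, HasDerivWithinAt (α i) (a i θ) (Set.Ici θ) θ)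
    (dβ : ∀ i, ∀ θ ∈ Set.Ico 0 θ₁, HasDerivWithinAt (β i) (b i θ) (Set.Ici θ) θ)
    (dβ' : ∀ i, ∀ θ ∈ Set.Ico 0 θ₁, HasDerivWithinAt (β' i) (b' i θ) (Set.Ici θ) θ)
    {A B B' : ι → ℝ} (hA : ∀ i, α i θ₁ - α i 0 = A i) (hB : ∀ i, β i θ₁ - β i 0 = B i)
    (hB' : ∀ i, β' i θ₁ - β' i 0 = B' i) (hpos : ∀ i, 0 < B i ∨ B i = 0 ∧ A i ≤ B' i)
    (hB'0 : ∀ i, 0 ≤ B' i)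
    (hK1 : ∀ θ ∈ Set.Ico 0 θ₁, ∀ i x y, Real.cos θ *
      |∫ ω, smoothedGrad f (Real.cos θ) (Real.sin θ • (W ω - X i ω) + Real.sin θ • x) x ∂P -
      ∫ ω, smoothedGrad f (Real.cos θ) (Real.sin θ • (W ω - X i ω)) x ∂P -
      Real.sin θ * ∫ ω, smoothedHess f (Real.cos θ) (Real.sin θ • (W ω - X i ω) +
        Real.sin θ • y) x ∂P| ≤ ‖x‖ ^ 2 * a i θ)
    (hK2 : ∀ θ ∈ Set.Ico 0 θ₁, ∀ i x y, Real.cos θ *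
      |∫ ω, smoothedGrad f (Real.cos θ) (Real.sin θ • (W ω - X i ω) + Real.sin θ • x) x ∂P -
      ∫ ω, smoothedGrad f (Real.cos θ) (Real.sin θ • (W ω - X i ω)) x ∂P -
      Real.sin θ * ∫ ω, smoothedHess f (Real.cos θ) (Real.sin θ • (W ω - X i ω) +
        Real.sin θ • y) x ∂P| ≤ ‖x‖ ^ 2 * ((‖x‖ / 2 + ‖y‖) * b i θ + b' i θ)) :
    |interp f P W θ₁ - interp f P W 0| ≤
      ∑ i, ∫ ω', ∫ ω, ‖X i ω'‖ ^ 2 * min (A i) (B i * (‖X i ω'‖ / 2 + ‖X i ω‖) + B' i) ∂P ∂P := by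
  classical
  have hX2 : ∀ i, MemLp (X i) (0 + 2 : ℕ) P := fun i => by exact_mod_cast h.memLp i
  have i2 : ∀ i, Integrable (fun p : Ω × Ω => ‖X i p.1‖ ^ 2) (P.prod P) := fun i =>
    ((h.memLp i).integrable_norm_pow (by norm_num)).comp_fst P
  -- the region where the integrated crude bound is the smaller one
  let S : ι → Set (E × E) := fun i => {q | A i ≤ B i * (‖q.1‖ / 2 + ‖q.2‖) + B' i}
  have hS : ∀ i, MeasurableSet (S i) := fun i =>
    measurableSet_le (by fun_prop) (Continuous.measurable (by fun_prop))
  -- the functions of the summands that multiply `a`, `b` and `b'`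
  let u : ι → Fin 3 → E × E → ℝ := fun i =>
    ![(S i).indicator (fun q => ‖q.1‖ ^ 2),
      (S i)ᶜ.indicator (fun q => ‖q.1‖ ^ 2 * (‖q.1‖ / 2 + ‖q.2‖)),
      (S i)ᶜ.indicator (fun q => ‖q.1‖ ^ 2)]
  have hpair : ∀ i, Measurable (fun p : Ω × Ω => (X i p.1, X i p.2)) := fun i =>
    ((h.meas i).comp measurable_fst).prodMk ((h.meas i).comp measurable_snd)
  have hum : ∀ i j, Measurable (u i j) := by
    intro i j
    fin_cases j
    · exact (Continuous.measurable (by fun_prop)).indicator (hS i)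
    · exact (Continuous.measurable (by fun_prop)).indicator (hS i).compl
    · exact (Continuous.measurable (by fun_prop)).indicator (hS i).compl
  have hu : ∀ i j, Integrable (fun p : Ω × Ω => u i j (X i p.1, X i p.2)) (P.prod P) := by
    intro i j
    have hm := ((hum i j).comp (hpair i)).aestronglyMeasurable (μ := P.prod P)
    have hn : ∀ (T : Set (E × E)) (p : Ω × Ω), ‖T.indicator (fun q : E × E => ‖q.1‖ ^ 2)
        (X i p.1, X i p.2)‖ ≤ ‖X i p.1‖ ^ 2 := fun T p => by
      refine (norm_indicator_le_norm_self _ _).trans_eq ?_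
      simp
    fin_cases j
    · exact (i2 i).mono' hm (ae_of_all _ fun p => hn _ p)
    · refine ((i2 i).mul_const (|A i| / B i)).mono' hm (ae_of_all _ fun p => ?_)
      change ‖(S i)ᶜ.indicator (fun q : E × E => ‖q.1‖ ^ 2 * (‖q.1‖ / 2 + ‖q.2‖))
        (X i p.1, X i p.2)‖ ≤ _
      by_cases hq : (X i p.1, X i p.2) ∈ S i
      · rw [Set.indicator_of_notMem (by simpa using hq), norm_zero]
        rcases hpos i with hp | hp
        · positivity
        · rw [hp.1]; simp
      · rw [Set.indicator_of_mem (by simpa using hq), Real.norm_eq_abs,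
          abs_of_nonneg (by positivity)]
        have hq' : B i * (‖X i p.1‖ / 2 + ‖X i p.2‖) + B' i < A i := not_le.1 hq
        rcases hpos i with hp | hp
        · -- outside `S i`, `‖x‖ / 2 + ‖y‖` is at most `|A i| / B i`
          refine mul_le_mul_of_nonneg_left ?_ (by positivity)
          rw [le_div_iff₀ hp, mul_comm]
          linarith [hB'0 i, le_abs_self (A i)]
        · rw [hp.1, zero_mul] at hq'
          linarith [hp.2]
    · exact (i2 i).mono' hm (ae_of_all _ fun p => hn _ p)
  have key := h.abs_interp_sub_le hf hX2 h0 h1 (J := Fin 3) (u := fun i j x y => u i j (x, y))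
    (a := fun i => ![a i, b i, b' i]) (A := fun i => ![α i, β i, β' i]) hu
    (fun i j => by
      fin_cases j
      exacts [hα i, hβ i, hβ' i])
    (fun i j => by
      fin_cases j
      exacts [dα i, dβ i, dβ' i])
    (fun θ hθ i x y => by
      simp only [Fin.sum_univ_three, u, Matrix.cons_val_zero, Matrix.cons_val_one, Matrix.cons_val]
      by_cases hq : (x, y) ∈ S i
      · have hq' : (x, y) ∉ (S i)ᶜ := by simpa using hq
        rw [Set.indicator_of_mem hq, Set.indicator_of_notMem hq', Set.indicator_of_notMem hq']
        simpa using hK1 θ hθ i x y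
      · have hq' : (x, y) ∈ (S i)ᶜ := by simpa using hq
        rw [Set.indicator_of_notMem hq, Set.indicator_of_mem hq', Set.indicator_of_mem hq']
        refine (hK2 θ hθ i x y).trans_eq ?_
        ring)
  refine key.trans_eq (Finset.sum_congr rfl fun i _ => ?_)
  have e : ∀ p : Ω × Ω, ‖X i p.1‖ ^ 2 * min (A i) (B i * (‖X i p.1‖ / 2 + ‖X i p.2‖) + B' i) =
      A i * u i 0 (X i p.1, X i p.2) + B i * u i 1 (X i p.1, X i p.2) +
        B' i * u i 2 (X i p.1, X i p.2) := by
    intro p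
    simp only [u, Matrix.cons_val_zero, Matrix.cons_val_one, Matrix.cons_val]
    by_cases hq : (X i p.1, X i p.2) ∈ S i
    · have hq' : (X i p.1, X i p.2) ∉ (S i)ᶜ := by simpa using hq
      rw [Set.indicator_of_mem hq, Set.indicator_of_notMem hq', Set.indicator_of_notMem hq',
        min_eq_left hq]
      ring
    · have hq' : (X i p.1, X i p.2) ∈ (S i)ᶜ := by simpa using hq
      rw [Set.indicator_of_notMem hq, Set.indicator_of_mem hq', Set.indicator_of_mem hq',
        min_eq_right (not_le.1 hq).le]
      ring
  have j01 : Integrable (fun p : Ω × Ω => A i * u i 0 (X i p.1, X i p.2) +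
      B i * u i 1 (X i p.1, X i p.2)) (P.prod P) :=
    ((hu i 0).const_mul (A i)).add ((hu i 1).const_mul (B i))
  have hi : Integrable (fun p : Ω × Ω => ‖X i p.1‖ ^ 2 *
      min (A i) (B i * (‖X i p.1‖ / 2 + ‖X i p.2‖) + B' i)) (P.prod P) := by
    simp_rw [e]
    exact j01.add ((hu i 2).const_mul (B' i))
  rw [← integral_prod _ hi]
  simp_rw [e]
  rw [integral_add j01 ((hu i 2).const_mul (B' i)), integral_add ((hu i 0).const_mul (A i))
    ((hu i 1).const_mul (B i)), integral_const_mul, integral_const_mul, integral_const_mul,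
    integral_prod _ (hu i 0), integral_prod _ (hu i 1), integral_prod _ (hu i 2)]
  simp only [Fin.sum_univ_three, Matrix.cons_val_zero, Matrix.cons_val_one, Matrix.cons_val,
    hA, hB, hB']

/-- The left side is about `0.93999`, so that `π` has to be known to four decimals. -/
lemma sqrt_two_div_pi_mul_pi_le : 3 / 2 * (√(2 / Real.pi) * (Real.pi / 4)) ≤ 0.94 := by
  have h : √(2 / Real.pi) ≤ 2.50666 / Real.pi := by
    refine Real.sqrt_le_iff.2 ⟨by positivity, ?_⟩
    rw [div_pow, div_le_div_iff₀ Real.pi_pos (by positivity)]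
    nlinarith [Real.pi_lt_d4, Real.pi_pos]
  have : √(2 / Real.pi) * (Real.pi / 4) ≤ 2.50666 / Real.pi * (Real.pi / 4) := by gcongr
  have e : 2.50666 / Real.pi * (Real.pi / 4) = 2.50666 / 4 := by field_simp
  rw [e] at this
  norm_num at this ⊢
  linarith

/-- The crude bound on the derivative of the interpolation is `2 * L * sin θ * cos θ` times `‖x‖²`,
with integral `L`. The smoothed Hessian has Lipschitz constant `√(2 / π) * L / cos θ`, and so the
linear bound has the coefficient `√(2 / π) * L * sin² θ`, with integral `√(2 / π) * L * π / 4`. -/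
lemma IsStdSum.abs_sub_le_of_lipschitz_fderiv_of_c2Growth (h : IsStdSum P X W) (hf : C2Growth f 0)
    {L : ℝ} (hL0 : 0 ≤ L)
    (hL : ∀ a b x, |fderiv ℝ f a x - fderiv ℝ f b x| ≤ L * ‖a - b‖ * ‖x‖)
    (hH : ∀ a x, |fderiv ℝ (fderiv ℝ f) a x x| ≤ L * ‖x‖ ^ 2) :
    |∫ ω, f (W ω) ∂P - ∫ z, f z ∂(stdGaussian E)| ≤
      L * ∑ i, ∫ ω, ‖X i ω‖ ^ 2 * min 2.5 (0.94 * ‖X i ω‖) ∂P := by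
  have hX2 : ∀ i, MemLp (X i) (0 + 2 : ℕ) P := fun i => by exact_mod_cast h.memLp i
  have hs0 : ∀ θ ∈ Set.Ico 0 (Real.pi / 2), 0 ≤ Real.sin θ := fun θ hθ =>
    Real.sin_nonneg_of_nonneg_of_le_pi hθ.1 (by linarith [hθ.2, Real.pi_pos])
  have hc0 : ∀ θ ∈ Set.Ico 0 (Real.pi / 2), 0 < Real.cos θ := fun θ hθ =>
    Real.cos_pos_of_mem_Ioo ⟨by linarith [hθ.1, Real.pi_pos], hθ.2⟩
  have hq : 0 < √(2 / Real.pi) := by positivity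
  have key := h.abs_interp_sub_le_min hf Real.pi_div_two_pos.le le_rfl
    (a := fun _ θ => 2 * Real.sin θ * Real.cos θ * L)
    (b := fun _ θ => √(2 / Real.pi) * L * Real.sin θ ^ 2) (b' := fun _ _ => 0)
    (α := fun _ θ => L * Real.sin θ ^ 2)
    (β := fun _ θ => √(2 / Real.pi) * L * ((θ - Real.sin θ * Real.cos θ) / 2)) (β' := fun _ _ => 0)
    (A := fun _ => L) (B := fun _ => √(2 / Real.pi) * L * (Real.pi / 4)) (B' := fun _ => 0)
    (fun _ => by fun_prop) (fun _ => by fun_prop) (fun _ => by fun_prop)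
    (fun _ θ _ => by
      convert! (((Real.hasDerivAt_sin θ).pow 2).const_mul L).hasDerivWithinAt using 1
      simp; ring)
    (fun _ θ _ => by
      have hd := (((hasDerivAt_id θ).sub ((Real.hasDerivAt_sin θ).mul
        (Real.hasDerivAt_cos θ))).div_const 2).const_mul (√(2 / Real.pi) * L)
      convert! hd.hasDerivWithinAt using 1
      have := Real.sin_sq_add_cos_sq θ
      rw [show Real.cos θ * Real.cos θ = 1 - Real.sin θ ^ 2 by linarith]
      ring)
    (fun _ θ _ => hasDerivWithinAt_const _ _ _)
    (fun _ => by simp)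
    (fun _ => by
      simp only [Real.sin_pi_div_two, Real.cos_pi_div_two, Real.sin_zero]
      ring)
    (fun _ => by simp)
    (fun _ => by
      rcases hL0.eq_or_lt with h0 | h0
      · right; simp [← h0]
      · left; positivity)
    (fun _ => le_rfl)
    (fun θ hθ i x y => by
      have hb := abs_taylor_le_of_bdd hf (h.memLp_rest hX2 i) (hs0 θ hθ) (Real.abs_sin_le_one θ)
        (Real.abs_cos_le_one θ) (x := x) (A := L * ‖x‖ ^ 2)
        (fun a => abs_integral_smoothedHess_le (smoothedHess_le_of_bdd (hH · x) _) a) y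
      refine (mul_le_mul_of_nonneg_left hb (hc0 θ hθ).le).trans_eq ?_
      ring)
    (fun θ hθ i x y => by
      have hb := abs_taylor_le_of_lipschitz hf (h.memLp_rest hX2 i) (hs0 θ hθ)
        (Real.abs_sin_le_one θ) (Real.abs_cos_le_one θ) (x := x)
        (B := √(2 / Real.pi) * L / Real.cos θ * ‖x‖ ^ 2)
        (by have := hc0 θ hθ; positivity)
        (fun a b => abs_integral_smoothedHess_sub_le hf (h.memLp_rest hX2 i)
          (Real.abs_sin_le_one θ) (Real.abs_cos_le_one θ)
          (fun a b => smoothedHess_sub_le_of_lipschitz_fderiv hf hL (hc0 θ hθ) a b x) a b) y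
      refine (mul_le_mul_of_nonneg_left hb (hc0 θ hθ).le).trans_eq ?_
      have := (hc0 θ hθ).ne'
      field_simp
      ring)
  rw [interp_zero, interp_pi_div_two] at key
  refine key.trans ?_
  rw [Finset.mul_sum]
  refine Finset.sum_le_sum fun i _ => ?_
  simp only [add_zero]
  refine (integral_integral_norm_sq_mul_min_le (h.memLp i) hL0 (by positivity)).trans ?_
  rw [← integral_const_mul]
  refine integral_mono ?_ ?_ fun ω => ?_
  · simpa using integrable_norm_sq_mul_min (h.memLp i) (A := 2 * L)
      (B := 3 / 2 * (√(2 / Real.pi) * L * (Real.pi / 4))) (by positivity) (by positivity) le_rfl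
  · simpa using (integrable_norm_sq_mul_min (h.memLp i) (A := 2.5)
      (B := 0.94) (by positivity) (by positivity) le_rfl).const_mul L
  · dsimp only
    rw [mul_left_comm L, mul_min_of_nonneg _ _ hL0]
    refine mul_le_mul_of_nonneg_left (min_le_min (by linarith) ?_) (sq_nonneg ‖X i ω‖)
    rw [← mul_assoc L]
    refine mul_le_mul_of_nonneg_right ?_ (norm_nonneg (X i ω))
    have := mul_le_mul_of_nonneg_left sqrt_two_div_pi_mul_pi_le hL0
    linarith

end FiniteBounds

/-! ### The bootstrap for Lipschitz test functions -/

section Bootstrap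

variable {E : Type*} [NormedAddCommGroup E] [InnerProductSpace ℝ E] [FiniteDimensional ℝ E]
  [MeasurableSpace E] [BorelSpace E] {f : E → ℝ} {k : ℕ}
  {Ω : Type*} [MeasurableSpace Ω] {P : Measure Ω} [IsProbabilityMeasure P]
  {ι : Type*} [Fintype ι] {X : ι → Ω → E} {W : Ω → E}

/-- `Δ` dominates the Wasserstein distance between the law of `W` and the standard normal law:
the error is at most `K * Δ` for every `K`-Lipschitz test function. -/
def WassersteinLE (P : Measure Ω) (W : Ω → E) (Δ : ℝ) : Prop :=
  ∀ (g : E → ℝ) (K : ℝ), 0 ≤ K → (∀ a b, |g a - g b| ≤ K * ‖a - b‖) →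
    |∫ ω, g (W ω) ∂P - ∫ z, g z ∂(stdGaussian E)| ≤ K * Δ

/-- Averaging over an independent `s • Z` restores smoothing at unit scale, as `s ^ 2 + c ^ 2 = 1`. -/
lemma integral_smoothedHess_stdGaussian (hf : C2Growth f k) {s c : ℝ} (hsc : s ^ 2 + c ^ 2 = 1)
    (a x : E) :
    Integrable (fun z => smoothedHess f c (s • z + a) x) (stdGaussian E) ∧
    ∫ z, smoothedHess f c (s • z + a) x ∂(stdGaussian E) = smoothedHess f 1 a x := by
  have h := integral_rotation_stdGaussian hsc
    (((hf.polyBdd_hess.comp_affine a 1).clm_apply x).clm_apply x).integrable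
  have e : ∀ z z' : E, a + (1 : ℝ) • (s • z + c • z') = s • z + a + c • z' := fun z z' => by
    rw [one_smul]; abel
  simp_rw [e] at h
  exact ⟨h.1.integral_prod_left, h.2⟩

lemma integrable_comp_of_lipschitz {g : E → ℝ} {K : ℝ}
    (hg : ∀ a b, |g a - g b| ≤ K * ‖a - b‖) {V : Ω → E} (hV : MemLp V 1 P) :
    Integrable (fun ω => g (V ω)) P := by
  have hc : Continuous g := (LipschitzWith.of_dist_le' (K := K) fun a b => by
    rw [Real.dist_eq, dist_eq_norm]; exact hg a b).continuous
  refine (((hV.integrable le_rfl).norm.const_mul K).add (integrable_const |g 0|)).mono'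
    (hc.comp_aestronglyMeasurable hV.1) (ae_of_all _ fun ω => ?_)
  have h1 := hg (V ω) 0
  rw [sub_zero] at h1
  have h2 := abs_sub_abs_le_abs_sub (g (V ω)) (g 0)
  rw [Real.norm_eq_abs, Pi.add_apply]
  linarith

/-- The bootstrap: the averaged smoothed Hessian is Lipschitz with a constant controlled by the
Wasserstein distance `Δ` itself. The increment of the smoothed Hessian between two points is a
Lipschitz function of the remaining sum, whose mean is compared with the Gaussian mean, and the
latter only sees the Hessian smoothed at unit scale. -/
lemma IsStdSum.abs_integral_smoothedHess_sub_le_bootstrap (h : IsStdSum P X W) (hf : C2Growth f 0)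
    (hL : ∀ a b, |f a - f b| ≤ ‖a - b‖) {Δ : ℝ} (hΔ : WassersteinLE P W Δ) (i : ι) {s c : ℝ}
    (hs : 0 ≤ s) (hc : 0 < c) (hsc : s ^ 2 + c ^ 2 = 1) (x a b : E) :
    |∫ ω, smoothedHess f c (s • (W ω - X i ω) + a) x ∂P -
      ∫ ω, smoothedHess f c (s • (W ω - X i ω) + b) x ∂P| ≤
      (1 + 2 * √2 * √(2 / Real.pi) * s * (Δ + ∫ ω, ‖X i ω‖ ∂P) / c ^ 3) * ‖x‖ ^ 2 * ‖a - b‖ := by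
  have hX2 : ∀ i, MemLp (X i) (0 + 2 : ℕ) P := fun i => by exact_mod_cast h.memLp i
  have hs1 : |s| ≤ 1 := abs_le_one_iff_mul_self_le_one.2 (by nlinarith)
  have hc1 : |c| ≤ 1 := abs_le_one_iff_mul_self_le_one.2 (by nlinarith)
  have hW2 := h.memLp_sum hX2
  have hL1 : ∀ a b, |f a - f b| ≤ 1 * ‖a - b‖ := by simpa using hL
  set κ := 2 * √2 * √(2 / Real.pi) * 1 / c ^ 3 * ‖x‖ ^ 2 * s * ‖a - b‖ with hκ
  have hκ0 : 0 ≤ κ := by positivity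
  let g : E → ℝ := fun v => smoothedHess f c (s • v + a) x - smoothedHess f c (s • v + b) x
  have hg : ∀ v v', |g v - g v'| ≤ κ * ‖v - v'‖ := by
    intro v v'
    have H := abs_secondDiff_smoothedHess_le hf hL1 hc (s • v' + b) (s • (v - v')) (a - b) x
    rw [show s • v' + b + (a - b) + s • (v - v') = s • v + a by rw [smul_sub]; abel,
      show s • v' + b + s • (v - v') = s • v + b by rw [smul_sub]; abel,
      show s • v' + b + (a - b) = s • v' + a by abel, norm_smul, Real.norm_eq_abs,
      abs_of_nonneg hs] at H
    refine H.trans_eq ?_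
    rw [hκ]; ring
  have iW : Integrable (fun ω => g (W ω)) P :=
    (integrable_smoothedHess_comp hf hW2 hs1 hc1 a x).sub
      (integrable_smoothedHess_comp hf hW2 hs1 hc1 b x)
  have iV : Integrable (fun ω => g (W ω - X i ω)) P :=
    (integrable_smoothedHess_comp hf (h.memLp_rest hX2 i) hs1 hc1 a x).sub
      (integrable_smoothedHess_comp hf (h.memLp_rest hX2 i) hs1 hc1 b x)
  have iX : Integrable (fun ω => ‖X i ω‖) P := ((h.memLp i).integrable (by norm_num)).norm
  have h1 : |∫ ω, g (W ω - X i ω) ∂P - ∫ ω, g (W ω) ∂P| ≤ κ * ∫ ω, ‖X i ω‖ ∂P := by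
    rw [← integral_sub iV iW, ← integral_const_mul, ← Real.norm_eq_abs]
    refine norm_integral_le_of_norm_le (f := fun ω => g (W ω - X i ω) - g (W ω))
      (iX.const_mul κ) (ae_of_all _ fun ω => ?_)
    refine (hg _ _).trans_eq ?_
    rw [sub_sub_cancel_left, norm_neg]
  have h2 := hΔ g κ hκ0 hg
  have h3 : |∫ z, g z ∂(stdGaussian E)| ≤ ‖x‖ ^ 2 * ‖a - b‖ := by
    have ga := integral_smoothedHess_stdGaussian hf hsc a x
    have gb := integral_smoothedHess_stdGaussian hf hsc b x
    rw [integral_sub ga.1 gb.1, ga.2, gb.2]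
    simpa using smoothedHess_sub_le_of_lipschitz hf hL1 one_pos a b x
  rw [← integral_sub (integrable_smoothedHess_comp hf (h.memLp_rest hX2 i) hs1 hc1 a x)
    (integrable_smoothedHess_comp hf (h.memLp_rest hX2 i) hs1 hc1 b x)]
  change |∫ ω, g (W ω - X i ω) ∂P| ≤ _
  have h4 : |∫ ω, g (W ω - X i ω) ∂P| ≤
      κ * (∫ ω, ‖X i ω‖ ∂P) + κ * Δ + ‖x‖ ^ 2 * ‖a - b‖ := by
    have t1 := abs_add_le (∫ ω, g (W ω - X i ω) ∂P - ∫ ω, g (W ω) ∂P) (∫ ω, g (W ω) ∂P)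
    have t2 := abs_add_le (∫ ω, g (W ω) ∂P - ∫ z, g z ∂(stdGaussian E))
      (∫ z, g z ∂(stdGaussian E))
    rw [sub_add_cancel] at t1 t2
    linarith
  refine h4.trans_eq ?_
  rw [hκ]
  field_simp
  ring

/-- The primitive, in the variable `u = cos θ`, of the coefficient of the linear bound. The weight
is `0` up to `p`, then `1 / u` up to `q`, then `u + κ / u ^ 2`. -/
noncomputable def linPrim (p q κ u : ℝ) : ℝ :=
  Real.log (max p (min u q)) + (max u q ^ 2 / 2 - κ / max u q)

open Classical in
/-- The coefficient of the linear bound, as a function of `u = cos θ`. It is `u` times the bound used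
for the Lipschitz constant of the averaged Hessian, which is `1 / u ^ 2` between `p` and `q`, and
`1 + κ / u ^ 3` above `q`. Below `p` the crude bound is used instead. -/
noncomputable def linWeight (p q κ u : ℝ) : ℝ :=
  if u ≤ p then 0 else if u ≤ q then 1 / u else u + κ / u ^ 2

open Classical in
/-- The coefficient of the crude bound, as a function of `u = cos θ`. -/
noncomputable def crudeWeight (p A u : ℝ) : ℝ := if u ≤ p then A else 0

lemma hasDerivWithinAt_linPrim {p q κ u : ℝ} (hp : 0 < p) (hpq : p ≤ q) :
    HasDerivWithinAt (linPrim p q κ) (linWeight p q κ u) (Set.Iic u) u := by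
  have hq := hp.trans_le hpq
  unfold linWeight
  split_ifs with h1 h2
  · refine (hasDerivWithinAt_const u (Set.Iic u) (Real.log p + (q ^ 2 / 2 - κ / q))).congr
      (fun v hv => ?_) ?_
    · have hv' : v ≤ p := le_trans hv h1
      rw [linPrim, min_eq_left (hv'.trans hpq), max_eq_left hv', max_eq_right (hv'.trans hpq)]
    · rw [linPrim, min_eq_left (h1.trans hpq), max_eq_left h1, max_eq_right (h1.trans hpq)]
  · push Not at h1
    have hd := ((Real.hasDerivAt_log (hp.trans h1).ne').add_const
      (q ^ 2 / 2 - κ / q)).hasDerivWithinAt (s := Set.Iic u)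
    rw [one_div]
    refine hd.congr_of_eventuallyEq ?_ ?_
    · filter_upwards [self_mem_nhdsWithin, mem_nhdsWithin_of_mem_nhds (lt_mem_nhds h1)] with v hv hv'
      have hvq : v ≤ q := le_trans hv h2
      rw [linPrim, min_eq_left hvq, max_eq_right (le_of_lt hv'), max_eq_right hvq]
    · rw [linPrim, min_eq_left h2, max_eq_right h1.le, max_eq_right h2]
  · push Not at h1 h2
    have hu := hq.trans h2
    have hd := ((((hasDerivAt_id u).pow 2).div_const 2).sub
      ((hasDerivAt_inv hu.ne').const_mul κ)).const_add (Real.log q)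
    have hd' : HasDerivAt (fun v : ℝ => Real.log q + (v ^ 2 / 2 - κ / v)) (u + κ / u ^ 2) u := by
      convert! hd using 1
      simp; ring
    refine (hd'.congr_of_eventuallyEq ?_).hasDerivWithinAt
    filter_upwards [lt_mem_nhds h2] with v hv
    rw [linPrim, min_eq_right hv.le, max_eq_right hpq, max_eq_left hv.le]

lemma continuous_linPrim {p q κ : ℝ} (hp : 0 < p) (hpq : p ≤ q) : Continuous (linPrim p q κ) := by
  have hq := hp.trans_le hpq
  unfold linPrim
  refine Continuous.add (Continuous.log (by fun_prop) fun u => ?_)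
    (Continuous.sub (by fun_prop) (Continuous.div (by fun_prop) (by fun_prop) fun u => ?_))
  · exact (hp.trans_le (le_max_left _ _)).ne'
  · exact (hq.trans_le (le_max_right _ _)).ne'

lemma hasDerivWithinAt_crudePrim {p A u : ℝ} :
    HasDerivWithinAt (fun v => A * min v p) (crudeWeight p A u) (Set.Iic u) u := by
  unfold crudeWeight
  split_ifs with h1
  · have hd := ((hasDerivAt_id u).const_mul A).hasDerivWithinAt (s := Set.Iic u)
    rw [mul_one] at hd
    refine hd.congr (fun v hv => ?_) ?_
    · rw [min_eq_left (le_trans hv h1), id]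
    · rw [min_eq_left h1, id]
  · push Not at h1
    refine ((hasDerivAt_const u (A * p)).congr_of_eventuallyEq ?_).hasDerivWithinAt
    filter_upwards [lt_mem_nhds h1] with v hv
    rw [min_eq_right hv.le]

lemma hasDerivWithinAt_neg_comp_cos {F : ℝ → ℝ} {F' θ : ℝ} (h0 : 0 ≤ θ) (h1 : θ < Real.pi / 2)
    (hF : HasDerivWithinAt F F' (Set.Iic (Real.cos θ)) (Real.cos θ)) :
    HasDerivWithinAt (fun θ => - F (Real.cos θ)) (Real.sin θ * F') (Set.Ici θ) θ := by
  have hd : HasDerivWithinAt (fun θ => - F (Real.cos θ)) (Real.sin θ * F')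
      (Set.Icc θ Real.pi) θ := by
    have := (hF.comp θ (Real.hasDerivAt_cos θ).hasDerivWithinAt (fun t ht =>
      Real.cos_le_cos_of_nonneg_of_le_pi h0 ht.2 ht.1 : Set.MapsTo Real.cos (Set.Icc θ Real.pi)
        (Set.Iic (Real.cos θ)))).neg
    convert! this using 1
    ring
  exact hd.mono_of_mem_nhdsWithin (Icc_mem_nhdsGE (by linarith [Real.pi_pos]))

lemma abs_fderiv_le_of_lipschitz {g : E → ℝ} {K : ℝ} (hK : 0 ≤ K)
    (hg : ∀ a b, |g a - g b| ≤ K * ‖a - b‖) (a x : E) : |fderiv ℝ g a x| ≤ K * ‖x‖ := by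
  have hl : LipschitzWith ⟨K, hK⟩ g := LipschitzWith.of_dist_le_mul fun a b => by
    rw [Real.dist_eq, dist_eq_norm]; exact hg a b
  exact ((fderiv ℝ g a).le_opNorm x).trans
    (mul_le_mul_of_nonneg_right (norm_fderiv_le_of_lipschitz ℝ hl) (norm_nonneg x))

lemma linPrim_sub {p q κ e : ℝ} (hep : e ≤ p) (hpq : p ≤ q) (hq1 : q ≤ 1) :
    linPrim p q κ 1 - linPrim p q κ e =
      Real.log q - Real.log p + ((1 - q ^ 2) / 2 + (κ / q - κ)) := by
  rw [linPrim, linPrim, min_eq_right hq1, max_eq_right hpq, max_eq_left hq1,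
    min_eq_left (hep.trans hpq), max_eq_left hep, max_eq_right (hep.trans hpq)]
  ring

lemma linPrim_sub_pos {p q κ e : ℝ} (hp : 0 < p) (hep : e ≤ p) (hpq : p ≤ q) (hq1 : q ≤ 1)
    (hκ : 0 ≤ κ) (hne : p < 1) : 0 < linPrim p q κ 1 - linPrim p q κ e := by
  have hq := hp.trans_le hpq
  rw [linPrim_sub hep hpq hq1]
  have h1 : 0 ≤ κ / q - κ := by
    rw [sub_nonneg, le_div_iff₀ hq]
    nlinarith
  have h2 : Real.log p ≤ Real.log q := Real.log_le_log hp hpq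
  rcases hq1.eq_or_lt with h | h
  · have : Real.log p < Real.log q := Real.log_lt_log hp (by linarith)
    subst h
    linarith
  · nlinarith

/-- The interpolation bound up to `cos θ = e`, where for each summand the crude bound
`2 * √(2 / π) * sin θ` is used while `cos θ ≤ p`, the Lipschitz constant `1 / cos² θ` while
`p < cos θ ≤ q`, and the bootstrap constant `1 + κ / cos³ θ` beyond. -/
lemma IsStdSum.abs_interp_sub_le_bootstrap (h : IsStdSum P X W) (hf : C2Growth f 0)
    (hL : ∀ a b, |f a - f b| ≤ ‖a - b‖) {Δ : ℝ} (hΔ0 : 0 ≤ Δ) (hΔ : WassersteinLE P W Δ)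
    {e : ℝ} (he0 : 0 < e) (he1 : e ≤ 1) {p q κ : ι → ℝ} (hep : ∀ i, e ≤ p i)
    (hpq : ∀ i, p i ≤ q i) (hq1 : ∀ i, q i ≤ 1)
    (hκ : ∀ i, 2 * √2 * √(2 / Real.pi) * (Δ + ∫ ω, ‖X i ω‖ ∂P) ≤ κ i) :
    |interp f P W (Real.arccos e) - ∫ z, f z ∂(stdGaussian E)| ≤
      ∑ i, ∫ ω', ∫ ω, ‖X i ω'‖ ^ 2 * min (2 * √(2 / Real.pi) * (1 - e))
        ((linPrim (p i) (q i) (κ i) 1 - linPrim (p i) (q i) (κ i) e) * (‖X i ω'‖ / 2 + ‖X i ω‖) +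
          2 * √(2 / Real.pi) * (p i - e)) ∂P ∂P := by
  have hX2 : ∀ i, MemLp (X i) (0 + 2 : ℕ) P := fun i => by exact_mod_cast h.memLp i
  have hp : ∀ i, 0 < p i := fun i => he0.trans_le (hep i)
  have hθ1 : Real.arccos e ≤ Real.pi / 2 := Real.arccos_le_pi_div_two.2 he0.le
  have hθ0 : 0 ≤ Real.arccos e := Real.arccos_nonneg e
  have hcos : Real.cos (Real.arccos e) = e := Real.cos_arccos (by linarith) he1
  have hlt : ∀ θ ∈ Set.Ico 0 (Real.arccos e), θ < Real.pi / 2 := fun θ hθ => hθ.2.trans_le hθ1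
  have hs0 : ∀ θ ∈ Set.Ico 0 (Real.arccos e), 0 ≤ Real.sin θ := fun θ hθ =>
    Real.sin_nonneg_of_nonneg_of_le_pi hθ.1 (by linarith [hlt θ hθ, Real.pi_pos])
  have hc0 : ∀ θ ∈ Set.Ico 0 (Real.arccos e), 0 < Real.cos θ := fun θ hθ =>
    Real.cos_pos_of_mem_Ioo ⟨by linarith [hθ.1, Real.pi_pos], hlt θ hθ⟩
  have hm : ∀ i, 0 ≤ ∫ ω, ‖X i ω‖ ∂P := fun i =>
    integral_nonneg (f := fun ω => ‖X i ω‖) fun ω => norm_nonneg _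
  have hκ0 : ∀ i, 0 ≤ κ i := fun i => le_trans (by have := hm i; positivity) (hκ i)
  have hL1 : ∀ a b, |f a - f b| ≤ 1 * ‖a - b‖ := by simpa using hL
  have hcrude : ∀ θ ∈ Set.Ico 0 (Real.arccos e), ∀ i x y, Real.cos θ *
      |∫ ω, smoothedGrad f (Real.cos θ) (Real.sin θ • (W ω - X i ω) + Real.sin θ • x) x ∂P -
      ∫ ω, smoothedGrad f (Real.cos θ) (Real.sin θ • (W ω - X i ω)) x ∂P -
      Real.sin θ * ∫ ω, smoothedHess f (Real.cos θ) (Real.sin θ • (W ω - X i ω) +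
        Real.sin θ • y) x ∂P| ≤ ‖x‖ ^ 2 * (Real.sin θ * (2 * √(2 / Real.pi))) := by
    intro θ hθ i x y
    have hc := hc0 θ hθ
    have hb := abs_taylor_le_of_bdd hf (h.memLp_rest hX2 i) (hs0 θ hθ) (Real.abs_sin_le_one θ)
      (Real.abs_cos_le_one θ) (x := x) (A := √(2 / Real.pi) * 1 / Real.cos θ * ‖x‖ ^ 2)
      (fun a => abs_integral_smoothedHess_le
        (smoothedHess_le_of_lipschitz hf (abs_fderiv_le_of_lipschitz zero_le_one hL1) hc · x) a) y
    refine (mul_le_mul_of_nonneg_left hb hc.le).trans_eq ?_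
    field_simp
  have hlin : ∀ θ ∈ Set.Ico 0 (Real.arccos e), ∀ i x y, ∀ B, 0 ≤ B →
      (∀ a b, |∫ ω, smoothedHess f (Real.cos θ) (Real.sin θ • (W ω - X i ω) + a) x ∂P -
        ∫ ω, smoothedHess f (Real.cos θ) (Real.sin θ • (W ω - X i ω) + b) x ∂P| ≤
          B * ‖x‖ ^ 2 * ‖a - b‖) → Real.cos θ *
      |∫ ω, smoothedGrad f (Real.cos θ) (Real.sin θ • (W ω - X i ω) + Real.sin θ • x) x ∂P -
      ∫ ω, smoothedGrad f (Real.cos θ) (Real.sin θ • (W ω - X i ω)) x ∂P -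
      Real.sin θ * ∫ ω, smoothedHess f (Real.cos θ) (Real.sin θ • (W ω - X i ω) +
        Real.sin θ • y) x ∂P| ≤
        ‖x‖ ^ 2 * ((‖x‖ / 2 + ‖y‖) * (Real.sin θ * (Real.cos θ * B))) := by
    intro θ hθ i x y B hB0 hB
    have hc := hc0 θ hθ
    have hs := hs0 θ hθ
    have hb := abs_taylor_le_of_lipschitz hf (h.memLp_rest hX2 i) hs (Real.abs_sin_le_one θ)
      (Real.abs_cos_le_one θ) (x := x) (B := B * ‖x‖ ^ 2) (by positivity) hB y
    calc _ ≤ _ := mul_le_mul_of_nonneg_left hb hc.le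
      _ ≤ Real.cos θ * (Real.sin θ * 1 * (B * ‖x‖ ^ 2) * (‖x‖ / 2 + ‖y‖)) := by
        rw [sq (Real.sin θ)]
        gcongr
        exact Real.sin_le_one θ
      _ = _ := by ring
  have key := h.abs_interp_sub_le_min hf hθ0 hθ1
    (a := fun _ θ => Real.sin θ * (2 * √(2 / Real.pi)))
    (b := fun i θ => Real.sin θ * linWeight (p i) (q i) (κ i) (Real.cos θ))
    (b' := fun i θ => Real.sin θ * crudeWeight (p i) (2 * √(2 / Real.pi)) (Real.cos θ))
    (α := fun _ θ => - (2 * √(2 / Real.pi) * Real.cos θ))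
    (β := fun i θ => - linPrim (p i) (q i) (κ i) (Real.cos θ))
    (β' := fun i θ => - (2 * √(2 / Real.pi) * min (Real.cos θ) (p i)))
    (A := fun _ => 2 * √(2 / Real.pi) * (1 - e))
    (B := fun i => linPrim (p i) (q i) (κ i) 1 - linPrim (p i) (q i) (κ i) e)
    (B' := fun i => 2 * √(2 / Real.pi) * (p i - e))
    (fun _ => by fun_prop)
    (fun i => ((continuous_linPrim (hp i) (hpq i)).comp Real.continuous_cos).neg.continuousOn)
    (fun i => by fun_prop)
    (fun _ θ _ => by
      convert! ((Real.hasDerivAt_cos θ).const_mul (2 * √(2 / Real.pi))).neg.hasDerivWithinAt using 1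
      ring)
    (fun i θ hθ => hasDerivWithinAt_neg_comp_cos hθ.1 (hlt θ hθ)
      (hasDerivWithinAt_linPrim (hp i) (hpq i)))
    (fun i θ hθ => hasDerivWithinAt_neg_comp_cos hθ.1 (hlt θ hθ) hasDerivWithinAt_crudePrim)
    (fun _ => by simp only [hcos, Real.cos_zero]; ring)
    (fun i => by simp only [hcos, Real.cos_zero]; ring)
    (fun i => by
      simp only [hcos, Real.cos_zero, min_eq_left (hep i), min_eq_right ((hpq i).trans (hq1 i))]
      ring)
    (fun i => by
      rcases ((hpq i).trans (hq1 i)).eq_or_lt with h1 | h1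
      · have h2 : q i = 1 := le_antisymm (hq1 i) (h1 ▸ hpq i)
        -- for `p i = 1` the linear bound is never used
        right
        rw [linPrim_sub (hep i) (hpq i) (hq1 i), h1, h2]
        simp
      · exact Or.inl (linPrim_sub_pos (hp i) (hep i) (hpq i) (hq1 i) (hκ0 i) h1))
    (fun i => mul_nonneg (by positivity) (sub_nonneg.2 (hep i)))
    hcrude
    (fun θ hθ i x y => by
      have hc := hc0 θ hθ
      have hs := hs0 θ hθ
      unfold linWeight crudeWeight
      split_ifs with h1 h2
      · simpa using hcrude θ hθ i x y
      · refine (hlin θ hθ i x y (1 / Real.cos θ ^ 2) (by positivity) fun a b =>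
          abs_integral_smoothedHess_sub_le hf (h.memLp_rest hX2 i)
            (Real.abs_sin_le_one θ) (Real.abs_cos_le_one θ)
            (fun a b => smoothedHess_sub_le_of_lipschitz hf hL1 hc a b x) a b).trans_eq ?_
        field_simp
        ring
      · have hm' : 0 ≤ Δ + ∫ ω, ‖X i ω‖ ∂P := add_nonneg hΔ0 (hm i)
        refine (hlin θ hθ i x y _ (by positivity) (h.abs_integral_smoothedHess_sub_le_bootstrap hf hL hΔ i hs
          hc (Real.sin_sq_add_cos_sq θ) x)).trans ?_
        rw [mul_zero, add_zero]
        gcongr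
        rw [mul_add, mul_one]
        gcongr
        rw [mul_div_assoc', div_le_div_iff₀ (by positivity) (by positivity)]
        have h3 : 2 * √2 * √(2 / Real.pi) * Real.sin θ * (Δ + ∫ ω, ‖X i ω‖ ∂P) ≤ κ i := by
          refine le_trans ?_ (hκ i)
          refine mul_le_mul_of_nonneg_right ?_ hm'
          exact mul_le_of_le_one_right (by positivity) (Real.sin_le_one θ)
        calc _ = (2 * √2 * √(2 / Real.pi) * Real.sin θ * (Δ + ∫ ω, ‖X i ω‖ ∂P)) *
              Real.cos θ ^ 3 := by ring
          _ ≤ κ i * Real.cos θ ^ 3 := by gcongr)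
  rw [interp_zero] at key
  exact key

/-- The cost of stopping the interpolation at `cos θ = e`. -/
lemma abs_interp_arccos_sub_le (hL : ∀ a b, |f a - f b| ≤ ‖a - b‖) {W : Ω → E}
    (hW : MemLp W 1 P) {e D : ℝ} (he0 : 0 ≤ e) (he1 : e ≤ 1) (hWD : ∫ ω, ‖W ω‖ ∂P ≤ D)
    (hD : √(Module.finrank ℝ E) ≤ D) :
    |∫ ω, f (W ω) ∂P - interp f P W (Real.arccos e)| ≤ e * (1 + e) * D := by
  have hL1 : ∀ a b, |f a - f b| ≤ 1 * ‖a - b‖ := by simpa using hL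
  have iW : Integrable (fun ω => ‖W ω‖) P := (hW.integrable le_rfl).norm
  have iZ : Integrable (fun z : E => ‖z‖) (stdGaussian E) := by
    simpa using integrable_norm_pow_stdGaussian (E := E) 1
  set s := Real.sin (Real.arccos e) with hs
  have hs2 : s ^ 2 + e ^ 2 = 1 := by
    have := Real.sin_sq_add_cos_sq (Real.arccos e)
    rwa [Real.cos_arccos (by linarith) he1] at this
  have hs0 : 0 ≤ s := Real.sin_nonneg_of_nonneg_of_le_pi (Real.arccos_nonneg e) (Real.arccos_le_pi e)
  have hs1 : s ≤ 1 := Real.sin_le_one _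
  have hse : 1 - s ≤ e ^ 2 := by nlinarith
  have i1 : Integrable (fun p : Ω × E => f (W p.1)) (P.prod (stdGaussian E)) :=
    (integrable_comp_of_lipschitz hL1 hW).comp_fst _
  have hm : MemLp (fun p : Ω × E => s • W p.1 + e • p.2) 1 (P.prod (stdGaussian E)) := by
    rw [memLp_one_iff_integrable]
    refine (((hW.integrable le_rfl).comp_fst _).smul s).add (Integrable.smul e ?_)
    have : Integrable (fun z : E => z) (stdGaussian E) :=
      (integrable_norm_iff aestronglyMeasurable_id).1 iZ
    exact this.comp_snd P
  have i2 := integrable_comp_of_lipschitz hL1 hm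
  have e1 : ∫ ω, f (W ω) ∂P = ∫ p : Ω × E, f (W p.1) ∂(P.prod (stdGaussian E)) := by
    rw [integral_fun_fst (fun ω => f (W ω))]; simp
  have e2 : interp f P W (Real.arccos e) =
      ∫ p : Ω × E, f (s • W p.1 + e • p.2) ∂(P.prod (stdGaussian E)) := by
    rw [interp, Real.cos_arccos (by linarith) he1]
  have j1 : Integrable (fun p : Ω × E => e ^ 2 * ‖W p.1‖) (P.prod (stdGaussian E)) :=
    (iW.comp_fst _).const_mul _
  have j2 : Integrable (fun p : Ω × E => e * ‖p.2‖) (P.prod (stdGaussian E)) :=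
    (iZ.comp_snd P).const_mul _
  have hle := norm_integral_le_of_norm_le (j1.add j2)
    (f := fun p : Ω × E => f (W p.1) - f (s • W p.1 + e • p.2)) (ae_of_all _ fun p => by
      have h1 := hL (W p.1) (s • W p.1 + e • p.2)
      have h2 : ‖W p.1 - (s • W p.1 + e • p.2)‖ ≤ (1 - s) * ‖W p.1‖ + e * ‖p.2‖ := by
        have h3 : W p.1 - (s • W p.1 + e • p.2) = (1 - s) • W p.1 - e • p.2 := by
          rw [sub_smul, one_smul]; abel
        rw [h3]
        refine (norm_sub_le _ _).trans_eq ?_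
        rw [norm_smul, norm_smul, Real.norm_eq_abs, Real.norm_eq_abs, abs_of_nonneg he0,
          abs_of_nonneg (by linarith)]
      rw [Real.norm_eq_abs, Pi.add_apply]
      have h4 := mul_le_mul_of_nonneg_right hse (norm_nonneg (W p.1))
      linarith)
  rw [integral_sub i1 i2, ← e1, ← e2] at hle
  refine hle.trans ?_
  have e3 := integral_add j1 j2
  simp only [Pi.add_apply]
  rw [e3, integral_const_mul, integral_const_mul, integral_fun_fst (fun ω => ‖W ω‖),
    integral_fun_snd (fun z : E => ‖z‖)]
  simp only [probReal_univ, one_smul]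
  have hZ := (integral_norm_stdGaussian_le (E := E)).trans hD
  nlinarith [mul_le_mul_of_nonneg_left hWD (sq_nonneg e), mul_le_mul_of_nonneg_left hZ he0]

lemma sqrt_two_div_pi_le : √(2 / Real.pi) ≤ 0.8 := by
  refine Real.sqrt_le_iff.2 ⟨by norm_num, ?_⟩
  rw [div_le_iff₀ Real.pi_pos]
  linarith [Real.pi_gt_d2]

lemma two_mul_sqrt_two_mul_le : 2 * √2 * √(2 / Real.pi) ≤ 2.27 := by
  have h : √2 ≤ 1.415 := Real.sqrt_le_iff.2 ⟨by norm_num, by norm_num⟩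
  have := sqrt_two_div_pi_le
  have h0 := Real.sqrt_nonneg (2 / Real.pi)
  nlinarith

/-- If `2 * (Δ + m) ≤ q`, the bootstrap contributes at most `2.27 / 2 = 1.135`, and the integral of
`u` at most `1 / 2`. -/
lemma linPrim_sub_le {e p q Δ m κ Λ : ℝ} (hp : 0 < p) (hep : e ≤ p) (hpq : p ≤ q)
    (hq1 : q ≤ 1) (hκ : κ ≤ 2.27 * (Δ + m)) (hκ0 : 0 ≤ κ) (hq : q = 1 ∨ 2 * (Δ + m) ≤ q)
    (hΛ : Real.log (q / p) ≤ Λ) :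
    linPrim p q κ 1 - linPrim p q κ e ≤ Λ + 1.635 := by
  have hq0 := hp.trans_le hpq
  rw [linPrim_sub hep hpq hq1, ← Real.log_div hq0.ne' hp.ne']
  have h1 : κ / q - κ ≤ 1.135 := by
    rcases hq with h | h
    · rw [h]; norm_num
    · have : κ / q ≤ 1.135 := by
        rw [div_le_iff₀ hq0]
        nlinarith
      linarith
  nlinarith

/-- The contribution of a summand whose mean norm is at most the Wasserstein distance. Removing the
independent copy doubles `A`, which gives `3.2 ≤ 0.945 * 4.5`, and multiplies `B` by `3 / 2`, where
`3 / 2 * 6.488 ≤ 0.945 * 11.1` and `3 / 2 * (1 / 2) ≤ 0.945 * 0.83`. -/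
lemma integral_bootstrap_le_of_le {X : Ω → E} (hX : MemLp X 2 P) {A B ℓ : ℝ}
    (hA0 : 0 ≤ A) (hA : A ≤ 1.6) (hB0 : 0 ≤ B) (hB : B ≤ 4.853 + ℓ / 2 + 1.635) (hℓ : 0 ≤ ℓ) :
    ∫ ω', ∫ ω, ‖X ω'‖ ^ 2 * min A (B * (‖X ω'‖ / 2 + ‖X ω‖)) ∂P ∂P ≤
      0.945 * ∫ ω, ‖X ω‖ ^ 2 * min 4.5 ((11.1 + 0.83 * ℓ) * ‖X ω‖) ∂P := by
  refine (integral_integral_norm_sq_mul_min_le hX hA0 hB0).trans ?_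
  rw [← integral_const_mul]
  refine integral_mono ?_ ?_ fun ω => ?_
  · simpa using integrable_norm_sq_mul_min hX (A := 2 * A) (B := 3 / 2 * B) (by positivity)
      (by positivity) le_rfl
  · simpa using (integrable_norm_sq_mul_min hX (A := 4.5)
      (B := 11.1 + 0.83 * ℓ) (by positivity) (by positivity) le_rfl).const_mul 0.945
  · dsimp only
    rw [mul_left_comm 0.945, mul_min_of_nonneg _ _ (by norm_num : (0 : ℝ) ≤ 0.945)]
    refine mul_le_mul_of_nonneg_left (min_le_min (by linarith) ?_) (sq_nonneg ‖X ω‖)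
    rw [← mul_assoc 0.945]
    exact mul_le_mul_of_nonneg_right (by linarith) (norm_nonneg (X ω))

/-- The contribution of a summand whose mean norm `m` exceeds the Wasserstein distance. The crude
bound is used for `cos θ ≤ m`. -/
lemma integral_bootstrap_le_of_lt {X : Ω → E} (hX : MemLp X 2 P) {A B C ℓ : ℝ}
    (hA0 : 0 ≤ A) (hA : A ≤ 1.6) (hB0 : 0 ≤ B) (hB : B ≤ 3.03) (hC0 : 0 ≤ C)
    (hC : C ≤ 1.6 * ∫ ω, ‖X ω‖ ∂P) (hℓ : 0 ≤ ℓ) :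
    ∫ ω', ∫ ω, ‖X ω'‖ ^ 2 * min A (B * (‖X ω'‖ / 2 + ‖X ω‖) + C) ∂P ∂P ≤
      0.945 * ∫ ω, ‖X ω‖ ^ 2 * min 4.5 ((11.1 + 0.83 * ℓ) * ‖X ω‖) ∂P := by
  have i1 : Integrable (fun ω => ‖X ω‖) P := (hX.integrable (by norm_num)).norm
  refine (integral_integral_norm_sq_mul_min_le_add hX hA0 hB0 hC0).trans ?_
  have j2 : Integrable (fun ω => min A (B * ‖X ω‖ + C)) P := by
    refine (integrable_const A).mono' ?_ (ae_of_all _ fun ω => ?_)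
    · exact aestronglyMeasurable_const.inf ((hX.1.norm.const_mul B).add_const C)
    · rw [Real.norm_eq_abs, abs_of_nonneg (by positivity)]
      exact min_le_left _ _
  have h1 : ∫ ω, min A (B * ‖X ω‖ + C) ∂P ≤ min 1.6 (4.63 * ∫ ω, ‖X ω‖ ∂P) := by
    refine le_min ?_ ?_
    · refine (integral_mono j2 (integrable_const A) fun ω => min_le_left _ _).trans ?_
      simpa using hA
    · have := integral_mono j2 ((i1.const_mul B).add (integrable_const C))
        fun ω => min_le_right _ _
      have e := integral_add (i1.const_mul B) (integrable_const (μ := P) C)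
      simp only [Pi.add_apply] at this
      rw [e, integral_const_mul] at this
      simp only [integral_const, probReal_univ, one_smul] at this
      have hm : 0 ≤ ∫ ω, ‖X ω‖ ∂P := integral_nonneg (f := fun ω => ‖X ω‖) fun ω => norm_nonneg _
      nlinarith
  have h2 := integral_norm_sq_mul_min_mean_le hX (A := 1.6) (B := 4.63) (by norm_num) (by norm_num)
  have h3 : 0 ≤ ∫ ω, ‖X ω‖ ^ 2 ∂P :=
    integral_nonneg (f := fun ω => ‖X ω‖ ^ 2) fun ω => by positivity
  have j1 : Integrable (fun ω => ‖X ω‖ ^ 2 * min A (B / 2 * ‖X ω‖)) P := by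
    simpa using integrable_norm_sq_mul_min hX hA0 (div_nonneg hB0 zero_le_two) le_rfl
  have j3 : Integrable (fun ω => 27 / 23 * (‖X ω‖ ^ 2 * min 1.6 (4.63 * ‖X ω‖))) P := by
    simpa using (integrable_norm_sq_mul_min hX (A := 1.6) (B := 4.63) (by norm_num) (by norm_num)
      le_rfl).const_mul (27 / 23)
  have j4 : Integrable (fun ω => 0.945 * (‖X ω‖ ^ 2 * min 4.5 ((11.1 + 0.83 * ℓ) * ‖X ω‖))) P := by
    simpa using (integrable_norm_sq_mul_min hX (A := 4.5)
      (B := 11.1 + 0.83 * ℓ) (by positivity) (by positivity) le_rfl).const_mul 0.945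
  refine (add_le_add_right ((mul_le_mul_of_nonneg_left h1 h3).trans h2) _).trans ?_
  rw [← integral_const_mul, ← integral_const_mul, ← integral_add j1 j3]
  refine integral_mono (j1.add j3) j4 fun ω => ?_
  dsimp only
  rw [mul_left_comm (27 / 23), mul_left_comm 0.945, ← mul_add]
  refine mul_le_mul_of_nonneg_left ?_ (sq_nonneg ‖X ω‖)
  rw [mul_min_of_nonneg _ _ (by norm_num : (0 : ℝ) ≤ 0.945)]
  have hn := norm_nonneg (X ω)
  refine le_min ?_ ?_
  · have a1 := min_le_left A (B / 2 * ‖X ω‖)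
    have a2 := min_le_left 1.6 (4.63 * ‖X ω‖)
    linarith
  · have a1 := min_le_right A (B / 2 * ‖X ω‖)
    have a2 := min_le_right 1.6 (4.63 * ‖X ω‖)
    have a3 := mul_le_mul_of_nonneg_right hB hn
    have a4 := mul_nonneg hℓ hn
    linarith

lemma IsStdSum.integral_norm_le (h : IsStdSum P X W) :
    ∫ ω, ‖W ω‖ ∂P ≤ √(Module.finrank ℝ E) := by
  have hW := h.memLp_sum h.memLp
  have h2 : ∫ ω, ‖W ω‖ ^ 2 ∂P = Module.finrank ℝ E := by
    let b := stdOrthonormalBasis ℝ E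
    have e : ∀ ω, ‖W ω‖ ^ 2 = ∑ j, inner ℝ (b j) (W ω) * inner ℝ (b j) (W ω) := fun ω => by
      rw [← b.sum_sq_norm_inner_right]
      exact Finset.sum_congr rfl fun j _ => by rw [Real.norm_eq_abs, sq_abs, sq]
    simp_rw [e]
    rw [integral_finsetSum _ fun j _ => integrable_inner_mul_inner hW _ _]
    simp [h.cov]
  refine Real.le_sqrt_of_sq_le ?_
  rw [← h2]
  exact sq_integral_norm_le hW

/-- The inequality to be solved for `Δ`. The interpolation is stopped at `cos θ = e`. For a summand
with mean norm `m ≤ Δ` the bootstrap takes over from the plain Lipschitz bound at `q = 4 * Δ`, and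
`q / p ≤ 80 * √d` gives rise to the logarithm of the dimension. For `m > Δ` the linear bound is used
only from `p = m` on, and `q = 4 * m`, so that no logarithm appears. Both are capped at `1`. -/
lemma IsStdSum.abs_sub_le_bootstrap (h : IsStdSum P X W) (hf : C2Growth f 0)
    (hL : ∀ a b, |f a - f b| ≤ ‖a - b‖) {Δ : ℝ} (hΔ0 : 0 < Δ) (hΔ : WassersteinLE P W Δ)
    (hd : 1 ≤ Module.finrank ℝ E) (hΔd : Δ ≤ 2 * √(Module.finrank ℝ E)) :
    |∫ ω, f (W ω) ∂P - ∫ z, f z ∂(stdGaussian E)| ≤ 0.055 * Δ + 0.945 *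
      ∑ i, ∫ ω, ‖X i ω‖ ^ 2 *
        min 4.5 ((11.1 + 0.83 * Real.log (Module.finrank ℝ E)) * ‖X i ω‖) ∂P := by
  set D := √(Module.finrank ℝ E : ℝ) with hD
  have hd' : (1 : ℝ) ≤ Module.finrank ℝ E := by exact_mod_cast hd
  have hD1 : 1 ≤ D := Real.one_le_sqrt.2 hd'
  have hℓ : 0 ≤ Real.log (Module.finrank ℝ E) := Real.log_nonneg hd'
  have hlogD : Real.log D = Real.log (Module.finrank ℝ E) / 2 := by
    rw [hD, Real.log_sqrt (by linarith)]
  -- the stopping point is proportional to `Δ`, so that the smoothing loss is `0.055 * Δ`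
  set e := Δ / (20 * D) with he
  have he0 : 0 < e := by positivity
  have heD : e * D = Δ / 20 := by rw [he]; field_simp
  have he1 : e ≤ 0.1 := by
    rw [he, div_le_iff₀ (by positivity)]; linarith
  have heΔ : 20 * e ≤ Δ := by nlinarith
  set m : ι → ℝ := fun i => ∫ ω, ‖X i ω‖ ∂P with hm
  have hm0 : ∀ i, 0 ≤ m i := fun i =>
    integral_nonneg (f := fun ω => ‖X i ω‖) fun ω => norm_nonneg _
  set κ : ι → ℝ := fun i => 2 * √2 * √(2 / Real.pi) * (Δ + m i) with hκ
  have hκ0 : ∀ i, 0 ≤ κ i := fun i => by have := hm0 i; positivity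
  have hκ1 : ∀ i, κ i ≤ 2.27 * (Δ + m i) := fun i =>
    mul_le_mul_of_nonneg_right two_mul_sqrt_two_mul_le (by have := hm0 i; positivity)
  set p : ι → ℝ := fun i => if m i ≤ Δ then e else min (m i) 1 with hp
  set q : ι → ℝ := fun i => if m i ≤ Δ then min (4 * Δ) 1 else min (4 * m i) 1 with hq
  have hep : ∀ i, e ≤ p i := fun i => by
    simp only [hp]
    split_ifs with h1
    · exact le_rfl
    · exact le_min (by linarith) (by linarith)
  have hpq : ∀ i, p i ≤ q i := fun i => by
    simp only [hp, hq]
    split_ifs with h1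
    · exact le_min (by linarith) (by linarith)
    · exact min_le_min_right _ (by linarith [hm0 i])
  have hq1 : ∀ i, q i ≤ 1 := fun i => by
    simp only [hq]
    split_ifs <;> exact min_le_right _ _
  have hloss := abs_interp_arccos_sub_le hL ((h.memLp_sum h.memLp).mono_exponent (by norm_num))
    he0.le (by linarith) h.integral_norm_le le_rfl (P := P)
  have hint := h.abs_interp_sub_le_bootstrap hf hL hΔ0.le hΔ he0 (by linarith) hep hpq hq1
    (κ := κ) fun i => le_rfl
  have hloss' : e * (1 + e) * D ≤ 0.055 * Δ := by
    rw [mul_right_comm, heD]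
    nlinarith
  have hA0 : 0 ≤ 2 * √(2 / Real.pi) * (1 - e) := mul_nonneg (by positivity) (by linarith)
  have hc2 := sqrt_two_div_pi_le
  have hc20 : 0 ≤ √(2 / Real.pi) := by positivity
  have hA : 2 * √(2 / Real.pi) * (1 - e) ≤ 1.6 := by nlinarith
  have hsum : |interp f P W (Real.arccos e) - ∫ z, f z ∂(stdGaussian E)| ≤
      0.945 * ∑ i, ∫ ω, ‖X i ω‖ ^ 2 *
        min 4.5 ((11.1 + 0.83 * Real.log (Module.finrank ℝ E)) * ‖X i ω‖) ∂P := by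
    refine hint.trans ?_
    rw [Finset.mul_sum]
    refine Finset.sum_le_sum fun i _ => ?_
    have hB0 : 0 ≤ linPrim (p i) (q i) (κ i) 1 - linPrim (p i) (q i) (κ i) e := by
      rcases ((hpq i).trans (hq1 i)).eq_or_lt with h1 | h1
      · have h2 : q i = 1 := le_antisymm (hq1 i) (h1 ▸ hpq i)
        rw [linPrim_sub (hep i) (hpq i) (hq1 i), h1, h2]
        simp
      · exact (linPrim_sub_pos (he0.trans_le (hep i)) (hep i) (hpq i) (hq1 i) (hκ0 i) h1).le
    by_cases hmi : m i ≤ Δ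
    · have hpi : p i = e := if_pos hmi
      have hqi : q i = min (4 * Δ) 1 := if_pos hmi
      have hB := linPrim_sub_le (he0.trans_le (hep i)) (hep i) (hpq i) (hq1 i) (hκ1 i) (hκ0 i)
        (Λ := 4.853 + Real.log (Module.finrank ℝ E) / 2)
        (by
          rw [hqi]
          rcases le_total (4 * Δ) 1 with h1 | h1
          · right; rw [min_eq_left h1]; linarith
          · left; exact min_eq_right h1)
        (by
          have h128 : Real.log (2 ^ 7) ≤ 4.853 := by
            rw [Real.log_pow]
            have := Real.log_two_lt_d9
            norm_num at this ⊢
            linarith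
          have hle : q i / p i ≤ 2 ^ 7 * D := by
            rw [hpi, div_le_iff₀ he0, mul_assoc, mul_comm D, heD, hqi]
            exact (min_le_left _ _).trans (by linarith)
          refine (Real.log_le_log (div_pos (he0.trans_le ((hep i).trans (hpq i)))
            (he0.trans_le (hep i))) hle).trans ?_
          rw [Real.log_mul (by norm_num) (by linarith), hlogD]
          linarith)
      rw [hpi, sub_self, mul_zero]
      rw [hpi] at hB hB0
      simp only [add_zero]
      exact integral_bootstrap_le_of_le (h.memLp i) hA0 hA hB0 hB hℓ
    · have hpi : p i = min (m i) 1 := if_neg hmi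
      have hqi : q i = min (4 * m i) 1 := if_neg hmi
      have hB := linPrim_sub_le (he0.trans_le (hep i)) (hep i) (hpq i) (hq1 i) (hκ1 i) (hκ0 i)
        (Λ := 1.39)
        (by
          rw [hqi]
          rcases le_total (4 * m i) 1 with h1 | h1
          · right; rw [min_eq_left h1]; linarith
          · left; exact min_eq_right h1)
        (by
          have h4 : Real.log (2 ^ 2) ≤ 1.39 := by
            rw [Real.log_pow]
            have := Real.log_two_lt_d9
            norm_num at this ⊢
            linarith
          have hle : q i / p i ≤ 2 ^ 2 := by
            rw [div_le_iff₀ (he0.trans_le (hep i)), hqi, hpi,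
              mul_min_of_nonneg _ _ (by norm_num : (0 : ℝ) ≤ 2 ^ 2)]
            exact min_le_min (by linarith) (by norm_num)
          exact (Real.log_le_log (div_pos (he0.trans_le ((hep i).trans (hpq i)))
            (he0.trans_le (hep i))) hle).trans h4)
      refine integral_bootstrap_le_of_lt (h.memLp i) hA0 hA hB0 (hB.trans (by norm_num))
        (mul_nonneg (by positivity) (sub_nonneg.2 (hep i))) ?_ hℓ
      have h1 : p i - e ≤ m i := by
        rw [hpi]; linarith [min_le_left (m i) 1]
      calc _ ≤ 2 * √(2 / Real.pi) * m i := by gcongr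
        _ ≤ 1.6 * m i := mul_le_mul_of_nonneg_right (by linarith) (hm0 i)
  have := abs_sub_le (∫ ω, f (W ω) ∂P) (interp f P W (Real.arccos e)) (∫ z, f z ∂(stdGaussian E))
  linarith

end Bootstrap

/-! ### Mollification of test functions -/

section Mollify

variable {E : Type*} [NormedAddCommGroup E] [InnerProductSpace ℝ E] [FiniteDimensional ℝ E]
  [MeasurableSpace E] [BorelSpace E] {g : E → ℝ} {φ : E → ℝ} {μ : Measure E} [μ.IsAddHaarMeasure]

open scoped Convolution

/-- The convolution of `g` with a kernel `φ`. -/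
noncomputable def mollify (μ : Measure E) (g φ : E → ℝ) : E → ℝ :=
  g ⋆[ContinuousLinearMap.lsmul ℝ ℝ, μ] φ

lemma mollify_eq (g φ : E → ℝ) (a : E) : mollify μ g φ a = ∫ t, g (a - t) * φ t ∂μ := by
  rw [mollify, convolution_eq_swap]
  simp

lemma integrable_mul_of_hasCompactSupport (hg : Continuous g) (hφ : Continuous φ)
    (hφc : HasCompactSupport φ) : Integrable (fun t => g t * φ t) μ :=
  (hg.mul hφ).integrable_of_hasCompactSupport (hφc.mul_left (f := g))

lemma mollify_const (φ : E → ℝ) (c : ℝ) (a : E) :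
    mollify μ (fun _ => c) φ a = c * ∫ t, φ t ∂μ := by
  rw [mollify_eq, integral_const_mul]

/-- The derivatives of a convolution fall on the kernel. -/
lemma differentiableAt_mollify (hg : Continuous g) (hφ : ContDiff ℝ 1 φ) (hφc : HasCompactSupport φ)
    (a : E) : DifferentiableAt ℝ (mollify μ g φ) a ∧
      ∀ x, fderiv ℝ (mollify μ g φ) a x = mollify μ g (fun t => fderiv ℝ φ t x) a := by
  have h := hφc.hasFDerivAt_convolution_right (ContinuousLinearMap.lsmul ℝ ℝ)
    (hg.locallyIntegrable (μ := μ)) hφ a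
  refine ⟨h.differentiableAt, fun x => ?_⟩
  rw [mollify, h.fderiv]
  exact convolution_precompR_apply _ hg.locallyIntegrable (hφc.fderiv ℝ)
    (hφ.continuous_fderiv one_ne_zero) a x

lemma hasCompactSupport_fderiv_apply (hφc : HasCompactSupport φ) (x : E) :
    HasCompactSupport (fun t => fderiv ℝ φ t x) :=
  (hφc.fderiv ℝ).comp_left (g := fun B : E →L[ℝ] ℝ => B x) rfl

lemma hess_mollify (hg : Continuous g) (hφ : ContDiff ℝ 2 φ) (hφc : HasCompactSupport φ)
    (a x y : E) : fderiv ℝ (fderiv ℝ (mollify μ g φ)) a x y =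
      mollify μ g (fun t => fderiv ℝ (fderiv ℝ φ) t x y) a := by
  have h1 : ContDiff ℝ 1 (fderiv ℝ φ) := hφ.fderiv_right (by norm_num)
  have hc : ContDiff ℝ 2 (mollify μ g φ) :=
    hφc.contDiff_convolution_right (n := 2) _ hg.locallyIntegrable hφ
  have hd : DifferentiableAt ℝ (fderiv ℝ (mollify μ g φ)) a :=
    ((hc.fderiv_right (m := 1) (by norm_num)).differentiable one_ne_zero) a
  have e1 : fderiv ℝ (fderiv ℝ (mollify μ g φ)) a x y =
      fderiv ℝ (fun b => fderiv ℝ (mollify μ g φ) b y) a x := by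
    rw [fderiv_clm_apply hd (differentiableAt_const y)]
    simp
  have e2 : (fun b => fderiv ℝ (mollify μ g φ) b y) = mollify μ g (fun t => fderiv ℝ φ t y) :=
    funext fun b => (differentiableAt_mollify hg (hφ.of_le (by norm_num)) hφc b).2 y
  rw [e1, e2, (differentiableAt_mollify hg (h1.clm_apply contDiff_const)
    (hasCompactSupport_fderiv_apply hφc y) a).2 x]
  congr 1
  funext t
  rw [fderiv_clm_apply ((h1.differentiable one_ne_zero) t) (differentiableAt_const y)]
  simp

lemma integral_hess_eq_zero (hφ : ContDiff ℝ 2 φ) (hφc : HasCompactSupport φ) (x y : E) :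
    ∫ t, fderiv ℝ (fderiv ℝ φ) t x y ∂μ = 0 := by
  have h := hess_mollify (μ := μ) (g := fun _ => 1) continuous_const hφ hφc 0 x y
  rw [funext (mollify_const (μ := μ) φ 1), mollify_const] at h
  simpa using h.symm

/-- The sum of the absolute values of the matrix entries of a bilinear form. -/
noncomputable def bilinBound (B : E →L[ℝ] E →L[ℝ] ℝ) : ℝ :=
  ∑ i, ∑ j, |B (stdOrthonormalBasis ℝ E i) (stdOrthonormalBasis ℝ E j)|

lemma bilinBound_nonneg (B : E →L[ℝ] E →L[ℝ] ℝ) : 0 ≤ bilinBound B :=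
  Finset.sum_nonneg fun _ _ => Finset.sum_nonneg fun _ _ => abs_nonneg _

lemma abs_le_bilinBound (B : E →L[ℝ] E →L[ℝ] ℝ) (x y : E) :
    |B x y| ≤ bilinBound B * ‖x‖ * ‖y‖ := by
  let b := stdOrthonormalBasis ℝ E
  have hb : ∀ i, ‖b i‖ = 1 := b.norm_eq_one
  have e : B x y = ∑ i, ∑ j, inner ℝ (b i) x * (inner ℝ (b j) y * B (b i) (b j)) := by
    conv_lhs => rw [← b.sum_repr' x, ← b.sum_repr' y]
    simp only [map_sum, map_smul, _root_.sum_apply, _root_.smul_apply, smul_eq_mul,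
      Finset.mul_sum]
    rw [Finset.sum_comm]
    refine Finset.sum_congr rfl fun i _ => Finset.sum_congr rfl fun j _ => ?_
    ring
  have hi : ∀ i x, |inner ℝ (b i) x| ≤ ‖x‖ := fun i x => by
    have := abs_real_inner_le_norm (b i) x
    rwa [hb, one_mul] at this
  rw [e, bilinBound, Finset.sum_mul, Finset.sum_mul]
  refine (Finset.abs_sum_le_sum_abs _ _).trans (Finset.sum_le_sum fun i _ => ?_)
  rw [Finset.sum_mul, Finset.sum_mul]
  refine (Finset.abs_sum_le_sum_abs _ _).trans (Finset.sum_le_sum fun j _ => ?_)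
  rw [abs_mul, abs_mul]
  calc _ ≤ ‖x‖ * (‖y‖ * |B (b i) (b j)|) := by
        gcongr
        · exact hi i x
        · exact hi j y
    _ = _ := by ring

lemma continuous_bilinBound {H : E → E →L[ℝ] E →L[ℝ] ℝ} (hH : Continuous H) :
    Continuous (fun t => bilinBound (H t)) :=
  continuous_finsetSum _ fun _ _ => continuous_finsetSum _ fun _ _ =>
    ((hH.clm_apply continuous_const).clm_apply continuous_const).abs

lemma hasCompactSupport_bilinBound {H : E → E →L[ℝ] E →L[ℝ] ℝ} (hH : HasCompactSupport H) :
    HasCompactSupport (fun t => bilinBound (H t)) :=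
  hH.comp_left (g := bilinBound) (by simp [bilinBound])

/-- The Hessian of a mollified Lipschitz function is bounded, in terms of a continuous compactly
supported bound `h` for the Hessian of the kernel. -/
lemma norm_hess_mollify_le {K : ℝ} (hK : 0 ≤ K) (hg : ∀ a b, |g a - g b| ≤ K * ‖a - b‖)
    (hφ : ContDiff ℝ 2 φ) (hφc : HasCompactSupport φ) {h : E → ℝ} (hh : Continuous h)
    (hhc : HasCompactSupport h) (hle : ∀ t x y, |fderiv ℝ (fderiv ℝ φ) t x y| ≤ h t * ‖x‖ * ‖y‖)
    (hh0 : ∀ t, 0 ≤ h t) (a : E) :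
    ‖fderiv ℝ (fderiv ℝ (mollify μ g φ)) a‖ ≤ ∫ t, K * ‖t‖ * h t ∂μ := by
  have hgc : Continuous g := (LipschitzWith.of_dist_le' (K := K) fun a b => by
    rw [Real.dist_eq, dist_eq_norm]; exact hg a b).continuous
  have hHc : Continuous (fderiv ℝ (fderiv ℝ φ)) :=
    (hφ.fderiv_right (m := 1) (by norm_num)).continuous_fderiv one_ne_zero
  have hI : Integrable (fun t => K * ‖t‖ * h t) μ :=
    integrable_mul_of_hasCompactSupport (by fun_prop) hh hhc
  have hI0 : 0 ≤ ∫ t, K * ‖t‖ * h t ∂μ :=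
    integral_nonneg (f := fun t => K * ‖t‖ * h t) fun t =>
      mul_nonneg (by positivity) (hh0 t)
  refine ContinuousLinearMap.opNorm_le_bound₂ _ hI0 fun x y => ?_
  have hs : HasCompactSupport (fun t => fderiv ℝ (fderiv ℝ φ) t x y) := by
    refine hhc.mono fun t ht => ?_
    rw [Function.mem_support] at ht ⊢
    intro h0
    have := hle t x y
    rw [h0, zero_mul, zero_mul] at this
    exact ht (abs_nonpos_iff.1 this)
  have hcont : Continuous (fun t => fderiv ℝ (fderiv ℝ φ) t x y) :=
    (hHc.clm_apply continuous_const).clm_apply continuous_const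
  rw [hess_mollify hgc hφ hφc, mollify_eq]
  -- the Hessian of the kernel has integral zero, so that `g a` may be subtracted
  have e : ∫ t, g (a - t) * fderiv ℝ (fderiv ℝ φ) t x y ∂μ =
      ∫ t, (g (a - t) - g a) * fderiv ℝ (fderiv ℝ φ) t x y ∂μ := by
    simp_rw [sub_mul]
    rw [integral_sub (integrable_mul_of_hasCompactSupport (g := fun t => g (a - t))
      (by fun_prop) hcont hs) (integrable_mul_of_hasCompactSupport continuous_const hcont hs),
      integral_const_mul, integral_hess_eq_zero hφ hφc]
    simp
  rw [e, ← integral_mul_const, ← integral_mul_const]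
  refine norm_integral_le_of_norm_le (f := fun t => (g (a - t) - g a) *
    fderiv ℝ (fderiv ℝ φ) t x y) ((hI.mul_const _).mul_const _) (ae_of_all _ fun t => ?_)
  have h1 := hg (a - t) a
  rw [sub_sub_cancel_left, norm_neg] at h1
  rw [norm_mul]
  calc _ ≤ K * ‖t‖ * (h t * ‖x‖ * ‖y‖) :=
        mul_le_mul h1 (hle t x y) (abs_nonneg _) (by positivity)
    _ = _ := by ring

lemma abs_mollify_sub_le (hg : Continuous g) (hφ : Continuous φ) (hφc : HasCompactSupport φ)
    (hφ0 : ∀ t, 0 ≤ φ t) (hφ1 : ∫ t, φ t ∂μ = 1) {a b : E} {C : ℝ}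
    (h : ∀ t, |g (a - t) - g (b - t)| ≤ C) : |mollify μ g φ a - mollify μ g φ b| ≤ C := by
  have i := fun a => integrable_mul_of_hasCompactSupport (μ := μ) (g := fun t => g (a - t))
    (by fun_prop) hφ hφc
  have iφ := hφ.integrable_of_hasCompactSupport hφc (μ := μ)
  rw [mollify_eq, mollify_eq, ← integral_sub (i a) (i b)]
  have := norm_integral_le_of_norm_le (iφ.const_mul C)
    (f := fun t => g (a - t) * φ t - g (b - t) * φ t) (ae_of_all _ fun t => by
      rw [← sub_mul, norm_mul, Real.norm_eq_abs, Real.norm_eq_abs, abs_of_nonneg (hφ0 t)]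
      exact mul_le_mul_of_nonneg_right (h t) (hφ0 t))
  simpa [integral_const_mul, hφ1] using this

lemma abs_secondDiff_mollify_le (hg : Continuous g) (hφ : Continuous φ)
    (hφc : HasCompactSupport φ) (hφ0 : ∀ t, 0 ≤ φ t) (hφ1 : ∫ t, φ t ∂μ = 1) {a b u : E} {C : ℝ}
    (h : ∀ t, |(g (a + u - t) - g (a - t)) - (g (b + u - t) - g (b - t))| ≤ C) :
    |(mollify μ g φ (a + u) - mollify μ g φ a) -
      (mollify μ g φ (b + u) - mollify μ g φ b)| ≤ C := by
  have hlin : ∀ c, mollify μ (fun v => g (v + u) - g v) φ c =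
      mollify μ g φ (c + u) - mollify μ g φ c := fun c => by
    rw [mollify_eq, mollify_eq, mollify_eq, ← integral_sub
      (integrable_mul_of_hasCompactSupport (g := fun t => g (c + u - t)) (by fun_prop) hφ hφc)
      (integrable_mul_of_hasCompactSupport (g := fun t => g (c - t)) (by fun_prop) hφ hφc)]
    refine integral_congr_ae (ae_of_all _ fun t => ?_)
    simp only
    rw [show c - t + u = c + u - t by abel]
    ring
  rw [← hlin, ← hlin]
  refine abs_mollify_sub_le (by fun_prop) hφ hφc hφ0 hφ1 fun t => ?_
  rw [show a - t + u = a + u - t by abel, show b - t + u = b + u - t by abel]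
  exact h t

lemma abs_mollify_sub_self_le (hg : Continuous g) (φ : ContDiffBump (0 : E)) {a : E} {C : ℝ}
    (h : ∀ t ∈ Metric.ball a φ.rOut, |g t - g a| ≤ C) :
    |mollify μ g (φ.normed μ) a - g a| ≤ C := by
  have := φ.dist_normed_convolution_le (μ := μ) (x₀ := a) (ε := C) (g := g)
    hg.aestronglyMeasurable (fun t ht => by rw [Real.dist_eq]; exact h t ht)
  have e : (φ.normed μ ⋆[ContinuousLinearMap.lsmul ℝ ℝ, μ] g) a = mollify μ g (φ.normed μ) a := by
    rw [mollify_eq, convolution_def]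
    refine integral_congr_ae (ae_of_all _ fun t => ?_)
    simp [mul_comm]
  rwa [e, Real.dist_eq] at this

/-- A Lipschitz function is uniformly approximated by functions with the same Lipschitz constant
and bounded second derivative. -/
lemma exists_C2Growth_of_lipschitz {K : ℝ} (hK : 0 ≤ K)
    (hg : ∀ a b, |g a - g b| ≤ K * ‖a - b‖) {η : ℝ} (hη : 0 < η) :
    ∃ f : E → ℝ, C2Growth f 0 ∧ (∀ a b, |f a - f b| ≤ K * ‖a - b‖) ∧
      ∀ a, |f a - g a| ≤ K * η := by
  have hgc : Continuous g := (LipschitzWith.of_dist_le' (K := K) fun a b => by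
    rw [Real.dist_eq, dist_eq_norm]; exact hg a b).continuous
  let μ : Measure E := Measure.addHaar
  let φ : ContDiffBump (0 : E) := ⟨η / 2, η, by positivity, by linarith⟩
  have hφ : ContDiff ℝ 2 (φ.normed μ) := φ.contDiff_normed
  have hφc : HasCompactSupport (φ.normed μ) := φ.hasCompactSupport_normed
  refine ⟨mollify μ g (φ.normed μ), ⟨?_, ?_⟩, fun a b => ?_, fun a => ?_⟩
  · exact hφc.contDiff_convolution_right (n := 2) _ hgc.locallyIntegrable hφ
  · have hHc : Continuous (fderiv ℝ (fderiv ℝ (φ.normed μ))) :=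
      (hφ.fderiv_right (m := 1) (by norm_num)).continuous_fderiv one_ne_zero
    have hHs : HasCompactSupport (fderiv ℝ (fderiv ℝ (φ.normed μ))) := (hφc.fderiv ℝ).fderiv ℝ
    have hb := norm_hess_mollify_le (μ := μ) hK hg hφ hφc
      (continuous_bilinBound hHc) (hasCompactSupport_bilinBound hHs)
      (fun t x y => abs_le_bilinBound _ x y) (fun t => bilinBound_nonneg _)
    exact ⟨max 0 _, le_max_left _ _, fun a => by
      rw [pow_zero, mul_one]; exact (hb a).trans (le_max_right _ _)⟩
  · exact abs_mollify_sub_le hgc hφ.continuous hφc φ.nonneg_normed φ.integral_normed fun t => by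
      simpa using hg (a - t) (b - t)
  · refine abs_mollify_sub_self_le hgc φ fun t ht => (hg t a).trans ?_
    rw [mem_ball_iff_norm] at ht
    gcongr

lemma abs_secondDiff_le_of_lipschitz_fderiv (hgd : Differentiable ℝ g) {L : ℝ}
    (hg : ∀ a b x, |fderiv ℝ g a x - fderiv ℝ g b x| ≤ L * ‖a - b‖ * ‖x‖) (a b u : E) :
    |(g (a + u) - g a) - (g (b + u) - g b)| ≤ L * ‖a - b‖ * ‖u‖ := by
  have hd : ∀ (c : E) (t : ℝ), HasDerivAt (fun t : ℝ => g (c + t • u)) (fderiv ℝ g (c + t • u) u) t :=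
    fun c t => by
      have h1 : HasDerivAt (fun t : ℝ => c + t • u) u t := by
        simpa using ((hasDerivAt_id t).smul_const u).const_add c
      exact (hgd (c + t • u)).hasFDerivAt.comp_hasDerivAt t h1
  have := norm_image_sub_le_of_norm_deriv_le_segment_01'
    (f := fun t : ℝ => g (a + t • u) - g (b + t • u)) (C := L * ‖a - b‖ * ‖u‖)
    (fun t _ => ((hd a t).sub (hd b t)).hasDerivWithinAt) (fun t _ => by
      refine (hg _ _ _).trans_eq ?_
      rw [add_sub_add_right_eq_sub])
  simp only [one_smul, zero_smul, add_zero, Real.norm_eq_abs] at this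
  rwa [sub_sub_sub_comm] at this

lemma abs_fderiv_sub_le_of_secondDiff (hgd : Differentiable ℝ g) {L : ℝ}
    (hg : ∀ a b u, |(g (a + u) - g a) - (g (b + u) - g b)| ≤ L * ‖a - b‖ * ‖u‖) (a b x : E) :
    |fderiv ℝ g a x - fderiv ℝ g b x| ≤ L * ‖a - b‖ * ‖x‖ := by
  have hd : ∀ c : E, HasDerivAt (fun t : ℝ => g (c + t • x)) (fderiv ℝ g c x) 0 := fun c => by
    have h1 : HasDerivAt (fun t : ℝ => c + t • x) x 0 := by
      simpa using ((hasDerivAt_id (0 : ℝ)).smul_const x).const_add c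
    have h2 : HasFDerivAt g (fderiv ℝ g c) (c + (0 : ℝ) • x) := by
      rw [zero_smul, add_zero]; exact (hgd c).hasFDerivAt
    exact h2.comp_hasDerivAt 0 h1
  have ht := ((hd a).sub (hd b)).tendsto_slope_zero_right
  refine le_of_tendsto ht.abs ?_
  filter_upwards [self_mem_nhdsWithin] with t ht
  have ht0 : (0 : ℝ) < t := ht
  have := hg a b (t • x)
  simp only [zero_add, zero_smul, add_zero, smul_eq_mul, Pi.sub_apply]
  rw [abs_mul, abs_of_pos (inv_pos.2 ht0), inv_mul_le_iff₀ ht0, sub_sub_sub_comm]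
  refine this.trans_eq ?_
  rw [norm_smul, Real.norm_eq_abs, abs_of_pos ht0]
  ring

lemma abs_hess_le_of_lipschitz_fderiv (hgd : Differentiable ℝ (fderiv ℝ g)) {L : ℝ}
    (hg : ∀ a b x, |fderiv ℝ g a x - fderiv ℝ g b x| ≤ L * ‖a - b‖ * ‖x‖) (a x y : E) :
    |fderiv ℝ (fderiv ℝ g) a x y| ≤ L * ‖x‖ * ‖y‖ := by
  have hd : HasDerivAt (fun t : ℝ => fderiv ℝ g (a + t • x) y) (fderiv ℝ (fderiv ℝ g) a x y) 0 := by
    have h1 : HasDerivAt (fun t : ℝ => a + t • x) x 0 := by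
      simpa using ((hasDerivAt_id (0 : ℝ)).smul_const x).const_add a
    have h2 : HasFDerivAt (fderiv ℝ g) (fderiv ℝ (fderiv ℝ g) a) (a + (0 : ℝ) • x) := by
      rw [zero_smul, add_zero]; exact (hgd a).hasFDerivAt
    have h3 := h2.comp_hasDerivAt 0 h1
    simpa using h3.clm_apply (hasDerivAt_const (0 : ℝ) y)
  refine le_of_tendsto hd.tendsto_slope_zero_right.abs ?_
  filter_upwards [self_mem_nhdsWithin] with t ht
  have ht0 : (0 : ℝ) < t := ht
  have := hg (a + t • x) a y
  simp only [zero_add, zero_smul, add_zero, smul_eq_mul]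
  rw [abs_mul, abs_of_pos (inv_pos.2 ht0), inv_mul_le_iff₀ ht0]
  refine this.trans_eq ?_
  rw [add_sub_cancel_left, norm_smul, Real.norm_eq_abs, abs_of_pos ht0]
  ring

/-- A function with Lipschitz gradient is approximated, up to a small multiple of `1 + ‖a‖`, by
twice continuously differentiable functions whose gradient has the same Lipschitz constant. -/
lemma exists_C2Growth_of_lipschitz_fderiv (hgd : Differentiable ℝ g) {L : ℝ} (hL : 0 ≤ L)
    (hg : ∀ a b x, |fderiv ℝ g a x - fderiv ℝ g b x| ≤ L * ‖a - b‖ * ‖x‖) {η : ℝ} (hη : 0 < η) :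
    ∃ f : E → ℝ, C2Growth f 0 ∧
      (∀ a b x, |fderiv ℝ f a x - fderiv ℝ f b x| ≤ L * ‖a - b‖ * ‖x‖) ∧
      (∀ a x, |fderiv ℝ (fderiv ℝ f) a x x| ≤ L * ‖x‖ ^ 2) ∧
      ∀ a, |f a - g a| ≤ (‖fderiv ℝ g 0‖ + L * (‖a‖ + η)) * η := by
  have hgc := hgd.continuous
  let μ : Measure E := Measure.addHaar
  let φ : ContDiffBump (0 : E) := ⟨η / 2, η, by positivity, by linarith⟩
  have hφ : ContDiff ℝ 2 (φ.normed μ) := φ.contDiff_normed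
  have hφc : HasCompactSupport (φ.normed μ) := φ.hasCompactSupport_normed
  have hf : ContDiff ℝ 2 (mollify μ g (φ.normed μ)) :=
    hφc.contDiff_convolution_right (n := 2) _ hgc.locallyIntegrable hφ
  have h1 := abs_fderiv_sub_le_of_secondDiff (hf.differentiable (by norm_num)) (L := L)
    fun a b u => abs_secondDiff_mollify_le hgc hφ.continuous hφc φ.nonneg_normed
      φ.integral_normed fun t => by
      have := abs_secondDiff_le_of_lipschitz_fderiv hgd hg (a - t) (b - t) u
      rwa [show a - t + u = a + u - t by abel, show b - t + u = b + u - t by abel,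
        sub_sub_sub_cancel_right] at this
  have h2 := abs_hess_le_of_lipschitz_fderiv
    ((hf.fderiv_right (m := 1) (by norm_num)).differentiable one_ne_zero) h1
  refine ⟨mollify μ g (φ.normed μ), ⟨hf, L, hL, fun a => ?_⟩, h1, fun a x => ?_, fun a => ?_⟩
  · rw [pow_zero, mul_one]
    exact ContinuousLinearMap.opNorm_le_bound₂ _ hL fun x y => h2 a x y
  · exact (h2 a x x).trans_eq (by ring)
  · refine abs_mollify_sub_self_le hgc φ fun t ht => ?_
    have hb : ∀ v ∈ Metric.ball a η, ‖fderiv ℝ g v‖ ≤ ‖fderiv ℝ g 0‖ + L * (‖a‖ + η) := by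
      intro v hv
      rw [mem_ball_iff_norm] at hv
      have h3 : ‖fderiv ℝ g v - fderiv ℝ g 0‖ ≤ L * ‖v - 0‖ :=
        ContinuousLinearMap.opNorm_le_bound _ (by positivity) fun x => hg v 0 x
      have h4 : ‖v‖ ≤ ‖a‖ + η := by
        have := norm_add_le a (v - a)
        rw [add_sub_cancel] at this
        linarith
      have h5 := norm_add_le (fderiv ℝ g 0) (fderiv ℝ g v - fderiv ℝ g 0)
      rw [add_sub_cancel] at h5
      rw [sub_zero] at h3
      have := mul_le_mul_of_nonneg_left h4 hL
      linarith
    have := (convex_ball a η).norm_image_sub_le_of_norm_fderiv_le (𝕜 := ℝ) (f := g)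
      (fun v _ => hgd v) hb (Metric.mem_ball_self hη) ht
    rw [mem_ball_iff_norm] at ht
    refine this.trans ?_
    gcongr

end Mollify

/-! ### Error bounds for finite sums and general test functions -/

section FiniteGeneral

variable {E : Type*} [NormedAddCommGroup E] [InnerProductSpace ℝ E] [FiniteDimensional ℝ E]
  [MeasurableSpace E] [BorelSpace E] {f : E → ℝ}
  {Ω : Type*} [MeasurableSpace Ω] {P : Measure Ω} [IsProbabilityMeasure P]
  {ι : Type*} [Fintype ι] {X : ι → Ω → E} {W : Ω → E}

lemma memLp_id_stdGaussian (p : ℝ≥0∞) (hp : p ≠ ∞) :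
    MemLp (fun z : E => z) p (stdGaussian E) := IsGaussian.memLp_id (stdGaussian E) p hp

/-- It suffices to test the Wasserstein distance on functions with Lipschitz constant one. -/
lemma wassersteinLE_of_lipschitz_one {Δ : ℝ}
    (h : ∀ g : E → ℝ, (∀ a b, |g a - g b| ≤ ‖a - b‖) →
      |∫ ω, g (W ω) ∂P - ∫ z, g z ∂(stdGaussian E)| ≤ Δ) : WassersteinLE P W Δ := by
  intro g K hK hg
  rcases hK.eq_or_lt with rfl | hK
  · have hc : ∀ a, g a = g 0 := fun a => by
      have := hg a 0
      rw [zero_mul] at this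
      linarith [abs_nonpos_iff.1 this]
    simp [hc]
  · have := h (fun a => K⁻¹ * g a) fun a b => by
      rw [← mul_sub, abs_mul, abs_of_pos (inv_pos.2 hK), inv_mul_le_iff₀ hK]
      exact hg a b
    rw [integral_const_mul, integral_const_mul, ← mul_sub, abs_mul, abs_of_pos (inv_pos.2 hK),
      inv_mul_le_iff₀ hK] at this
    exact this

lemma abs_integral_sub_le_of_lipschitz {g : E → ℝ} (hg : ∀ a b, |g a - g b| ≤ ‖a - b‖) {V : Ω → E}
    (hV : MemLp V 1 P) : |∫ ω, g (V ω) ∂P - g 0| ≤ ∫ ω, ‖V ω‖ ∂P := by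
  have hi := integrable_comp_of_lipschitz (K := 1) (by simpa using hg) hV
  have e : ∫ ω, g (V ω) ∂P - g 0 = ∫ ω, (g (V ω) - g 0) ∂P := by
    rw [integral_sub hi (integrable_const _)]; simp
  rw [e, ← Real.norm_eq_abs]
  exact norm_integral_le_of_norm_le (hV.integrable le_rfl).norm (ae_of_all _ fun ω => by
    simpa using hg (V ω) 0)

lemma abs_integral_comp_sub_le {f g : E → ℝ} {V : Ω → E} (hf : Integrable (fun ω => f (V ω)) P)
    (hg : Integrable (fun ω => g (V ω)) P) {b : Ω → ℝ} (hb : Integrable b P)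
    (h : ∀ ω, |f (V ω) - g (V ω)| ≤ b ω) :
    |∫ ω, f (V ω) ∂P - ∫ ω, g (V ω) ∂P| ≤ ∫ ω, b ω ∂P := by
  rw [← integral_sub hf hg, ← Real.norm_eq_abs]
  exact norm_integral_le_of_norm_le (f := fun ω => f (V ω) - g (V ω)) hb (ae_of_all _ h)

lemma abs_integral_comp_sub_le_affine {f g : E → ℝ} {V : Ω → E}
    (hf : Integrable (fun ω => f (V ω)) P) (hg : Integrable (fun ω => g (V ω)) P)
    (hV : MemLp V 2 P) {A B D : ℝ} (h : ∀ a, |f a - g a| ≤ A + B * ‖a‖) (hB : 0 ≤ B)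
    (hD : ∫ ω, ‖V ω‖ ∂P ≤ D) :
    |∫ ω, f (V ω) ∂P - ∫ ω, g (V ω) ∂P| ≤ A + B * D := by
  have i1 : Integrable (fun ω => B * ‖V ω‖) P := (hV.integrable (by norm_num)).norm.const_mul B
  have i2 : Integrable (fun ω => A + B * ‖V ω‖) P := (integrable_const A).add i1
  refine (abs_integral_comp_sub_le hf hg i2 fun ω => h (V ω)).trans ?_
  rw [integral_add (integrable_const A) i1, integral_const_mul]
  simp only [integral_const, probReal_univ, one_smul]
  linarith [mul_le_mul_of_nonneg_left hD hB]

/-- The Wasserstein distance from `W` to the standard normal law is finite, which is needed to solve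
the bootstrap inequality. -/
lemma IsStdSum.abs_sub_le_trivial (h : IsStdSum P X W) {g : E → ℝ}
    (hg : ∀ a b, |g a - g b| ≤ ‖a - b‖) :
    |∫ ω, g (W ω) ∂P - ∫ z, g z ∂(stdGaussian E)| ≤ 2 * √(Module.finrank ℝ E) := by
  have h1 := abs_integral_sub_le_of_lipschitz hg
    ((h.memLp_sum h.memLp).mono_exponent (p := 1) (by norm_num))
  have h2 := abs_integral_sub_le_of_lipschitz hg (memLp_id_stdGaussian (E := E) 1 (by simp))
  have h3 := h.integral_norm_le
  have h4 := integral_norm_stdGaussian_le (E := E)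
  have h5 := abs_sub_le (∫ ω, g (W ω) ∂P) (g 0) (∫ z, g z ∂(stdGaussian E))
  rw [abs_sub_comm] at h2
  linarith

/-- The error bound for a finite sum and Lipschitz test functions, obtained by applying the bootstrap
inequality with `Δ` equal to the Wasserstein distance itself. -/
theorem IsStdSum.wassersteinLE (h : IsStdSum P X W) (hd : 1 ≤ Module.finrank ℝ E) :
    WassersteinLE P W (∑ i, ∫ ω, ‖X i ω‖ ^ 2 *
        min 4.5 ((11.1 + 0.83 * Real.log (Module.finrank ℝ E)) * ‖X i ω‖) ∂P) := by
  set R := ∑ i, ∫ ω, ‖X i ω‖ ^ 2 *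
        min 4.5 ((11.1 + 0.83 * Real.log (Module.finrank ℝ E)) * ‖X i ω‖) ∂P with hR
  have hR0 : 0 ≤ R := Finset.sum_nonneg fun i _ => integral_nonneg
    (f := fun ω => ‖X i ω‖ ^ 2 *
      min 4.5 ((11.1 + 0.83 * Real.log (Module.finrank ℝ E)) * ‖X i ω‖)) fun ω => by
      have : 0 ≤ Real.log (Module.finrank ℝ E) := Real.log_natCast_nonneg _
      have hm : 0 ≤ min 4.5 ((11.1 + 0.83 * Real.log (Module.finrank ℝ E)) * ‖X i ω‖) :=
        le_min (by norm_num) (by positivity)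
      exact mul_nonneg (by positivity) hm
  have hW1 : MemLp W 1 P := (h.memLp_sum h.memLp).mono_exponent (by norm_num)
  let S : Set ℝ := {r | ∃ g : E → ℝ, (∀ a b, |g a - g b| ≤ ‖a - b‖) ∧
    r = |∫ ω, g (W ω) ∂P - ∫ z, g z ∂(stdGaussian E)|}
  have hbdd : BddAbove S := ⟨2 * √(Module.finrank ℝ E), by
    rintro _ ⟨g, hg, rfl⟩
    exact h.abs_sub_le_trivial hg⟩
  have h0S : (0 : ℝ) ∈ S := ⟨fun _ => 0, by simp, by simp⟩
  set Δ := sSup S with hΔ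
  have hΔ0 : 0 ≤ Δ := le_csSup hbdd h0S
  have hW : WassersteinLE P W Δ := wassersteinLE_of_lipschitz_one fun g hg =>
    le_csSup hbdd ⟨g, hg, rfl⟩
  have hΔd : Δ ≤ 2 * √(Module.finrank ℝ E) := csSup_le ⟨0, h0S⟩ (by
    rintro _ ⟨g, hg, rfl⟩
    exact h.abs_sub_le_trivial hg)
  have hle : Δ ≤ R := by
    rcases hΔ0.eq_or_lt with h0 | h0
    · -- the bootstrap needs a positive stopping point, hence `Δ > 0`
      rw [← h0]; exact hR0
    · have : Δ ≤ 0.055 * Δ + 0.945 * R := by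
        refine csSup_le ⟨0, h0S⟩ ?_
        rintro _ ⟨g, hg, rfl⟩
        refine le_of_forall_pos_le_add fun η hη => ?_
        have hg1 : ∀ a b, |g a - g b| ≤ 1 * ‖a - b‖ := by simpa using hg
        obtain ⟨f, hf, hfl, hfg⟩ := exists_C2Growth_of_lipschitz zero_le_one hg1 (half_pos hη)
        have hb := h.abs_sub_le_bootstrap hf (by simpa using hfl) h0 hW hd hΔd
        have h1 := abs_integral_comp_sub_le (integrable_comp_of_lipschitz hfl hW1)
          (integrable_comp_of_lipschitz hg1 hW1) (integrable_const (1 * (η / 2)))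
          fun ω => hfg (W ω)
        have hZ1 := memLp_id_stdGaussian (E := E) 1 (by simp)
        have h2 := abs_integral_comp_sub_le (integrable_comp_of_lipschitz hfl hZ1)
          (integrable_comp_of_lipschitz hg1 hZ1) (integrable_const (1 * (η / 2)))
          fun z => hfg z
        simp only [integral_const, probReal_univ, one_smul, one_mul] at h1 h2
        have h3 := abs_sub_le (∫ ω, g (W ω) ∂P) (∫ ω, f (W ω) ∂P) (∫ z, g z ∂(stdGaussian E))
        have h4 := abs_sub_le (∫ ω, f (W ω) ∂P) (∫ z, f z ∂(stdGaussian E))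
          (∫ z, g z ∂(stdGaussian E))
        rw [abs_sub_comm] at h1
        linarith
      linarith
  intro g K hK hg
  exact (hW g K hK hg).trans (mul_le_mul_of_nonneg_left hle hK)

lemma abs_sub_zero_le_of_lipschitz_fderiv (hfd : Differentiable ℝ f) {L : ℝ} (hL : 0 ≤ L)
    (hf : ∀ a b x, |fderiv ℝ f a x - fderiv ℝ f b x| ≤ L * ‖a - b‖ * ‖x‖) (a : E) :
    |f a - f 0| ≤ (‖fderiv ℝ f 0‖ + L * ‖a‖) * ‖a‖ := by
  have hb : ∀ v ∈ Metric.closedBall (0 : E) ‖a‖, ‖fderiv ℝ f v‖ ≤ ‖fderiv ℝ f 0‖ + L * ‖a‖ := by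
    intro v hv
    rw [mem_closedBall_zero_iff] at hv
    have h3 : ‖fderiv ℝ f v - fderiv ℝ f 0‖ ≤ L * ‖v - 0‖ :=
      ContinuousLinearMap.opNorm_le_bound _ (by positivity) fun x => hf v 0 x
    have h5 := norm_add_le (fderiv ℝ f 0) (fderiv ℝ f v - fderiv ℝ f 0)
    rw [add_sub_cancel] at h5
    rw [sub_zero] at h3
    have := mul_le_mul_of_nonneg_left hv hL
    linarith
  have := (convex_closedBall (0 : E) ‖a‖).norm_image_sub_le_of_norm_fderiv_le (𝕜 := ℝ) (f := f)
    (fun v _ => hfd v) hb (Metric.mem_closedBall_self (norm_nonneg a))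
    (mem_closedBall_zero_iff.2 le_rfl : a ∈ _)
  simpa using this

lemma integrable_comp_of_lipschitz_fderiv (hfd : Differentiable ℝ f) {L : ℝ} (hL : 0 ≤ L)
    (hf : ∀ a b x, |fderiv ℝ f a x - fderiv ℝ f b x| ≤ L * ‖a - b‖ * ‖x‖) {V : Ω → E}
    (hV : MemLp V 2 P) : Integrable (fun ω => f (V ω)) P := by
  have i2 : Integrable (fun ω => ‖V ω‖ ^ 2) P := hV.integrable_norm_pow (by norm_num)
  have i1 : Integrable (fun ω => ‖V ω‖) P := (hV.integrable (by norm_num)).norm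
  refine (((i1.const_mul ‖fderiv ℝ f 0‖).add (i2.const_mul L)).add
    (integrable_const |f 0|)).mono' (hfd.continuous.comp_aestronglyMeasurable hV.1)
    (ae_of_all _ fun ω => ?_)
  have h1 := abs_sub_zero_le_of_lipschitz_fderiv hfd hL hf (V ω)
  have h2 := abs_sub_abs_le_abs_sub (f (V ω)) (f 0)
  simp only [Real.norm_eq_abs, Pi.add_apply]
  nlinarith

theorem IsStdSum.abs_sub_le_of_lipschitz_fderiv (h : IsStdSum P X W) (hfd : Differentiable ℝ f)
    {L : ℝ} (hL : 0 ≤ L)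
    (hf : ∀ a b x, |fderiv ℝ f a x - fderiv ℝ f b x| ≤ L * ‖a - b‖ * ‖x‖) :
    |∫ ω, f (W ω) ∂P - ∫ z, f z ∂(stdGaussian E)| ≤
      L * ∑ i, ∫ ω, ‖X i ω‖ ^ 2 * min 2.5 (0.94 * ‖X i ω‖) ∂P := by
  have hW2 := h.memLp_sum h.memLp
  have hZ2 := memLp_id_stdGaussian (E := E) 2 (by simp)
  set D := √(Module.finrank ℝ E : ℝ) with hD
  set C := ‖fderiv ℝ f 0‖ with hC
  have key : ∀ η > 0, |∫ ω, f (W ω) ∂P - ∫ z, f z ∂(stdGaussian E)| ≤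
      L * ∑ i, ∫ ω, ‖X i ω‖ ^ 2 * min 2.5 (0.94 * ‖X i ω‖) ∂P + 2 * ((C + L * (D + η)) * η) := by
    intro η hη
    obtain ⟨g, hg, hgl, hgH, hfg⟩ := exists_C2Growth_of_lipschitz_fderiv hfd hL hf hη
    have hb := h.abs_sub_le_of_lipschitz_fderiv_of_c2Growth hg hL hgl hgH
    have hgd := hg.differentiable
    have hfg' : ∀ a, |g a - f a| ≤ (C + L * η) * η + L * η * ‖a‖ := fun a =>
      (hfg a).trans_eq (by ring)
    have h1 := abs_integral_comp_sub_le_affine (integrable_comp_of_lipschitz_fderiv hgd hL hgl hW2)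
      (integrable_comp_of_lipschitz_fderiv hfd hL hf hW2) hW2 hfg' (by positivity)
      h.integral_norm_le
    have h2 := abs_integral_comp_sub_le_affine (integrable_comp_of_lipschitz_fderiv hgd hL hgl hZ2)
      (integrable_comp_of_lipschitz_fderiv hfd hL hf hZ2) hZ2 hfg' (by positivity)
      integral_norm_stdGaussian_le
    have h3 := abs_sub_le (∫ ω, f (W ω) ∂P) (∫ ω, g (W ω) ∂P) (∫ z, f z ∂(stdGaussian E))
    have h4 := abs_sub_le (∫ ω, g (W ω) ∂P) (∫ z, g z ∂(stdGaussian E)) (∫ z, f z ∂(stdGaussian E))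
    rw [abs_sub_comm] at h1
    linarith
  have ht : Tendsto (fun η : ℝ => L * ∑ i, ∫ ω, ‖X i ω‖ ^ 2 * min 2.5 (0.94 * ‖X i ω‖) ∂P +
      2 * ((C + L * (D + η)) * η)) (𝓝[>] 0) (𝓝 (L * ∑ i, ∫ ω, ‖X i ω‖ ^ 2 *
        min 2.5 (0.94 * ‖X i ω‖) ∂P + 2 * ((C + L * (D + 0)) * 0))) :=
    tendsto_nhdsWithin_of_tendsto_nhds (Continuous.tendsto (by fun_prop) 0)
  rw [mul_zero, mul_zero, add_zero] at ht
  exact ge_of_tendsto ht (by filter_upwards [self_mem_nhdsWithin] with η hη using key η hη)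

end FiniteGeneral

/-! ### Sums of countable families of independent centred vectors -/

lemma measurable_limUnder_atTop {α F : Type*} {m : MeasurableSpace α} [NormedAddCommGroup F]
    [CompleteSpace F] [SecondCountableTopology F] [MeasurableSpace F] [BorelSpace F]
    {Y : ℕ → α → F} (hY : ∀ n, Measurable[m] (Y n)) :
    Measurable[m] (fun a => limUnder atTop fun n => Y n a) :=
  (StronglyMeasurable.limUnder fun n => (hY n).stronglyMeasurable).measurable

section Series

variable {E : Type*} [NormedAddCommGroup E] [InnerProductSpace ℝ E] [FiniteDimensional ℝ E]
  [MeasurableSpace E] [BorelSpace E]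
  {Ω : Type*} [mΩ : MeasurableSpace Ω] {P : Measure Ω} [IsProbabilityMeasure P]
  {ι : Type*} {X : ι → Ω → E} {W : Ω → E}

lemma memLp_natCast_iff {Y : Ω → E} (hY : AEStronglyMeasurable Y P) {k : ℕ} (hk : k ≠ 0) :
    MemLp Y k P ↔ ∫⁻ ω, ‖Y ω‖ₑ ^ k ∂P < ∞ := by
  rw [MemLp, and_iff_right hY,
    eLpNorm_lt_top_iff_lintegral_rpow_enorm_lt_top (by exact_mod_cast hk) (ENNReal.natCast_ne_top k)]
  simp

lemma lintegral_enorm_pow_eq {Y : Ω → E} {k : ℕ} (hY : MemLp Y k P) :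
    ∫⁻ ω, ‖Y ω‖ₑ ^ k ∂P = ENNReal.ofReal (∫ ω, ‖Y ω‖ ^ k ∂P) := by
  rcases eq_or_ne k 0 with rfl | hk
  · simp
  rw [ofReal_integral_eq_lintegral_ofReal (hY.integrable_norm_pow hk)
    (ae_of_all _ fun ω => by positivity)]
  refine lintegral_congr fun ω => ?_
  rw [ENNReal.ofReal_pow (norm_nonneg _), ofReal_norm]

/-- Fatou's lemma for moments of almost surely convergent sequences. -/
lemma lintegral_enorm_pow_le_of_tendsto {Y : ℕ → Ω → E} {Z : Ω → E} (hY : ∀ n, Measurable (Y n))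
    (hlim : ∀ᵐ ω ∂P, Tendsto (fun n => Y n ω) atTop (𝓝 (Z ω))) {k : ℕ} {C : ℝ≥0∞}
    (hC : ∀ᶠ n in atTop, ∫⁻ ω, ‖Y n ω‖ₑ ^ k ∂P ≤ C) : ∫⁻ ω, ‖Z ω‖ₑ ^ k ∂P ≤ C := by
  calc ∫⁻ ω, ‖Z ω‖ₑ ^ k ∂P = ∫⁻ ω, liminf (fun n => ‖Y n ω‖ₑ ^ k) atTop ∂P := by
        refine lintegral_congr_ae ?_
        filter_upwards [hlim] with ω hω
        exact (((ENNReal.continuous_pow k).tendsto _).comp hω.enorm).liminf_eq.symm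
    _ ≤ liminf (fun n => ∫⁻ ω, ‖Y n ω‖ₑ ^ k ∂P) atTop :=
        lintegral_liminf_le fun n => (hY n).enorm.pow_const k
    _ ≤ C := liminf_le_of_frequently_le' hC.frequently

/-- A family of independent centred random vectors with summable second moments. -/
structure IndepCentered (P : Measure Ω) (X : ι → Ω → E) : Prop where
  meas : ∀ i, Measurable (X i)
  indep : iIndepFun X P
  mean : ∀ i, ∫ ω, X i ω ∂P = 0
  sq : ∑' i, ∫⁻ ω, ‖X i ω‖ₑ ^ 2 ∂P ≠ ∞

lemma IndepCentered.memLp (h : IndepCentered P X) (i : ι) : MemLp (X i) 2 P := by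
  have := (memLp_natCast_iff (h.meas i).aestronglyMeasurable (k := 2) (by norm_num)).2
    ((ENNReal.le_tsum i).trans_lt h.sq.lt_top)
  exact_mod_cast this

/-- The σ-algebra generated by the vectors with index in `S`. -/
abbrev sigmaOf (X : ι → Ω → E) (S : Set ι) : MeasurableSpace Ω :=
  ⨆ i ∈ S, MeasurableSpace.comap (X i) inferInstance

lemma sigmaOf_le (hm : ∀ i, Measurable (X i)) (S : Set ι) : sigmaOf X S ≤ mΩ :=
  iSup₂_le fun i _ => (hm i).comap_le

lemma sigmaOf_mono {S T : Set ι} (h : S ⊆ T) : sigmaOf X S ≤ sigmaOf X T :=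
  biSup_mono h

lemma IndepCentered.indep_sigmaOf (h : IndepCentered P X) {S T : Set ι} (hST : Disjoint S T) :
    Indep (sigmaOf X S) (sigmaOf X T) P :=
  indep_iSup_of_disjoint (fun i => (h.meas i).comap_le) h.indep.iIndep hST

lemma measurable_sum_sigmaOf {S : Set ι} {t : Finset ι} (ht : ∀ i ∈ t, i ∈ S) :
    Measurable[sigmaOf X S] (fun ω => ∑ i ∈ t, X i ω) :=
  Finset.measurable_sum _ fun i hi => (comap_measurable (X i)).mono
    (le_biSup (fun i => MeasurableSpace.comap (X i) inferInstance) (ht i hi)) le_rfl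

lemma IndepCentered.indepFun_of_measurable (h : IndepCentered P X) {S T : Set ι}
    (hST : Disjoint S T) {Y V : Ω → E} (hY : Measurable[sigmaOf X S] Y)
    (hV : Measurable[sigmaOf X T] V) : IndepFun Y V P := by
  rw [IndepFun_iff_Indep]
  exact indep_of_indep_of_le_left (indep_of_indep_of_le_right (h.indep_sigmaOf hST)
    hV.comap_le) hY.comap_le

lemma IndepCentered.measurable_sum (h : IndepCentered P X) (t : Finset ι) :
    Measurable (fun ω => ∑ i ∈ t, X i ω) := Finset.measurable_sum _ fun i _ => h.meas i

lemma IndepCentered.memLp_sum (h : IndepCentered P X) (t : Finset ι) :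
    MemLp (fun ω => ∑ i ∈ t, X i ω) 2 P := memLp_finsetSum _ fun i _ => h.memLp i

lemma IndepCentered.integral_sum (h : IndepCentered P X) (t : Finset ι) :
    ∫ ω, ∑ i ∈ t, X i ω ∂P = 0 := by
  rw [integral_finsetSum _ fun i _ => (h.memLp i).integrable (by norm_num)]
  exact Finset.sum_eq_zero fun i _ => h.mean i

lemma integral_norm_add_sq_of_indepFun {Y V : Ω → E} (hYV : IndepFun Y V P)
    (hY : MemLp Y 2 P) (hV : MemLp V 2 P) (hmean : ∫ ω, Y ω ∂P = 0) :
    ∫ ω, ‖V ω + Y ω‖ ^ 2 ∂P = ∫ ω, ‖V ω‖ ^ 2 ∂P + ∫ ω, ‖Y ω‖ ^ 2 ∂P := by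
  have iY : Integrable (fun ω => ‖Y ω‖ ^ 2) P := hY.integrable_norm_pow (by norm_num)
  have iV : Integrable (fun ω => ‖V ω‖ ^ 2) P := hV.integrable_norm_pow (by norm_num)
  let b := stdOrthonormalBasis ℝ E
  have hi := fun j => integral_inner_mul_inner_of_indepFun hYV hY hV hmean (b j) (b j)
  have e : ∀ ω, ‖V ω + Y ω‖ ^ 2 = ‖V ω‖ ^ 2 + ‖Y ω‖ ^ 2 +
      2 * ∑ j, inner ℝ (b j) (V ω) * inner ℝ (b j) (Y ω) := fun ω => by
    rw [norm_add_sq_real, ← b.sum_inner_mul_inner (V ω) (Y ω)]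
    have : ∀ j, inner ℝ (V ω) (b j) = inner ℝ (b j) (V ω) := fun j => real_inner_comm _ _
    simp_rw [this]
    ring
  have iS : Integrable (fun ω => 2 * ∑ j, inner ℝ (b j) (V ω) * inner ℝ (b j) (Y ω)) P :=
    (integrable_finsetSum _ fun j _ => (hi j).1).const_mul 2
  have iVY : Integrable (fun ω => ‖V ω‖ ^ 2 + ‖Y ω‖ ^ 2) P := iV.add iY
  simp_rw [e]
  rw [integral_add iVY iS, integral_add iV iY, integral_const_mul,
    integral_finsetSum _ fun j _ => (hi j).1]
  simp [fun j => (hi j).2]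

lemma IndepCentered.indepFun_sum (h : IndepCentered P X) {i : ι} {t : Finset ι} (hi : i ∉ t) :
    IndepFun (X i) (fun ω => ∑ j ∈ t, X j ω) P := by
  have : Disjoint ({i} : Set ι) (t : Set ι) := by simpa using hi
  refine h.indepFun_of_measurable this ?_ (measurable_sum_sigmaOf fun j hj => hj)
  simpa using measurable_sum_sigmaOf (X := X) (S := {i}) (t := {i}) (by simp)

lemma IndepCentered.integral_norm_sum_sq (h : IndepCentered P X) (t : Finset ι) :
    ∫ ω, ‖∑ i ∈ t, X i ω‖ ^ 2 ∂P = ∑ i ∈ t, ∫ ω, ‖X i ω‖ ^ 2 ∂P := by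
  classical
  induction t using Finset.induction_on with
  | empty => simp
  | insert i t hi ih =>
    simp_rw [Finset.sum_insert hi]
    rw [← ih, add_comm]
    simp_rw [add_comm (X i _)]
    exact integral_norm_add_sq_of_indepFun (h.indepFun_sum hi) (h.memLp i) (h.memLp_sum t)
      (h.mean i)

lemma IndepCentered.lintegral_enorm_sum_sq (h : IndepCentered P X) (t : Finset ι) :
    ∫⁻ ω, ‖∑ i ∈ t, X i ω‖ₑ ^ 2 ∂P = ∑ i ∈ t, ∫⁻ ω, ‖X i ω‖ₑ ^ 2 ∂P := by
  have h2 : ∀ i, MemLp (X i) (2 : ℕ) P := fun i => by exact_mod_cast h.memLp i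
  have h2' : MemLp (fun ω => ∑ i ∈ t, X i ω) (2 : ℕ) P := by exact_mod_cast h.memLp_sum t
  simp_rw [lintegral_enorm_pow_eq (h2 _)]
  rw [lintegral_enorm_pow_eq h2', h.integral_norm_sum_sq, ENNReal.ofReal_sum_of_nonneg]
  exact fun i _ => integral_nonneg (f := fun ω => ‖X i ω‖ ^ 2) fun ω => by positivity

/-- The sum of `a` over the complement of the finite set `t`. -/
noncomputable def tail (a : ι → ℝ≥0∞) (t : Finset ι) : ℝ≥0∞ := ∑' i : {i // i ∉ t}, a i

lemma sum_le_tail (a : ι → ℝ≥0∞) {u t : Finset ι} (h : ∀ i ∈ u, i ∉ t) :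
    ∑ i ∈ u, a i ≤ tail a t := by
  classical
  rw [tail, ← Finset.sum_subtype_of_mem a h]
  exact ENNReal.sum_le_tsum _

lemma tail_le (a : ι → ℝ≥0∞) (t : Finset ι) : tail a t ≤ ∑' i, a i :=
  ENNReal.tsum_comp_le_tsum_of_injective Subtype.val_injective a

lemma Exhausts.tendsto {s : ℕ → Finset ι} (hs : Exhausts s) :
    Tendsto s atTop atTop := by
  classical
  refine tendsto_atTop_finset_of_monotone hs.1 hs.2

lemma tendsto_tail {a : ι → ℝ≥0∞} (ha : ∑' i, a i ≠ ∞) {s : ℕ → Finset ι} (hs : Exhausts s) :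
    Tendsto (fun n => tail a (s n)) atTop (𝓝 0) :=
  (ENNReal.tendsto_tsum_compl_atTop_zero ha).comp hs.tendsto

/-- Almost sure convergence of the partial sums, in a general finite-dimensional space. -/
def ASLimit (P : Measure Ω) (X : ι → Ω → E) (s : ℕ → Finset ι) (W : Ω → E) : Prop :=
  ∀ᵐ ω ∂P, Tendsto (fun n => ∑ i ∈ s n, X i ω) atTop (𝓝 (W ω))

lemma ASLimit.sub_sum {s : ℕ → Finset ι} (hs : Exhausts s) (hW : ASLimit P X s W) [DecidableEq ι]
    (t : Finset ι) : ∀ᵐ ω ∂P, Tendsto (fun n => ∑ i ∈ s n \ t, X i ω) atTop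
      (𝓝 (W ω - ∑ i ∈ t, X i ω)) := by
  filter_upwards [hW] with ω hω
  refine (hω.sub_const _).congr' ?_
  filter_upwards [hs.tendsto.eventually_ge_atTop t] with n hn
  rw [sub_eq_iff_eq_add, Finset.sum_sdiff hn]

lemma IndepCentered.lintegral_sub_sum_le (h : IndepCentered P X) {s : ℕ → Finset ι}
    (hs : Exhausts s) (hW : ASLimit P X s W) (t : Finset ι) :
    ∫⁻ ω, ‖W ω - ∑ i ∈ t, X i ω‖ₑ ^ 2 ∂P ≤ tail (fun i => ∫⁻ ω, ‖X i ω‖ₑ ^ 2 ∂P) t := by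
  classical
  refine lintegral_enorm_pow_le_of_tendsto (fun n => h.measurable_sum (s n \ t))
    (hW.sub_sum hs t) (Eventually.of_forall fun n => ?_)
  rw [h.lintegral_enorm_sum_sq]
  exact sum_le_tail _ fun i hi => (Finset.mem_sdiff.1 hi).2

/-- The remainder of the series is, up to a null set, measurable with respect to the remaining
vectors. -/
lemma exists_measurable_sub_sum {s : ℕ → Finset ι}
    (hs : Exhausts s) (hW : ASLimit P X s W) (t : Finset ι) :
    ∃ T : Ω → E, Measurable[sigmaOf X (t : Set ι)ᶜ] T ∧ T =ᵐ[P] fun ω => W ω - ∑ i ∈ t, X i ω := by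
  classical
  have hm : ∀ n, Measurable[sigmaOf X (t : Set ι)ᶜ] (fun ω => ∑ i ∈ s n \ t, X i ω) :=
    fun n => measurable_sum_sigmaOf fun i hi => by simpa using (Finset.mem_sdiff.1 hi).2
  refine ⟨fun ω => limUnder atTop (fun n => ∑ i ∈ s n \ t, X i ω),
    measurable_limUnder_atTop hm, ?_⟩
  filter_upwards [hW.sub_sum hs t] with ω hω
  exact hω.limUnder_eq

lemma IndepCentered.indepFun_sub_sum (h : IndepCentered P X) {s : ℕ → Finset ι}
    (hs : Exhausts s) (hW : ASLimit P X s W) (t : Finset ι) :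
    IndepFun (fun ω => ∑ i ∈ t, X i ω) (fun ω => W ω - ∑ i ∈ t, X i ω) P := by
  obtain ⟨T, hT, hTW⟩ := exists_measurable_sub_sum hs hW t
  exact (h.indepFun_of_measurable disjoint_compl_right
    (measurable_sum_sigmaOf fun i hi => hi) hT).congr EventuallyEq.rfl hTW

/-- The partial sums converge almost surely along every exhaustion, by the martingale convergence
theorem applied to their coordinates. -/
lemma IndepCentered.exists_asLimit (h : IndepCentered P X) {s : ℕ → Finset ι} (hs : Exhausts s) :
    ∃ W : Ω → E, Measurable W ∧ ASLimit P X s W := by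
  classical
  let F : Filtration ℕ mΩ := ⟨fun n => sigmaOf X (s n : Set ι),
    fun m n hmn => sigmaOf_mono (Finset.coe_subset.2 (hs.1 hmn)), fun n => sigmaOf_le h.meas _⟩
  have hF : ∀ n, F n = sigmaOf X (s n : Set ι) := fun n => rfl
  let b := stdOrthonormalBasis ℝ E
  have hint : ∀ t : Finset ι, Integrable (fun ω => ∑ i ∈ t, X i ω) P := fun t =>
    (h.memLp_sum t).integrable (by norm_num)
  have hsub : ∀ j, Submartingale (fun n ω => (inner ℝ (b j) (∑ i ∈ s n, X i ω) : ℝ)) F P := by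
    intro j
    refine submartingale_nat (fun n => ?_) (fun n => (hint _).const_inner _) fun n => ?_
    · have hm : Measurable[F n] (fun ω => ∑ i ∈ s n, X i ω) :=
        measurable_sum_sigmaOf fun i hi => hi
      exact ((continuous_const.inner continuous_id : Continuous fun x : E =>
        (inner ℝ (b j) x : ℝ)).measurable.comp hm).stronglyMeasurable
    · have hm : Measurable[F n] (fun ω => ∑ i ∈ s n, X i ω) :=
        measurable_sum_sigmaOf fun i hi => hi
      have hm' : StronglyMeasurable[F n] (fun ω => (inner ℝ (b j) (∑ i ∈ s n, X i ω) : ℝ)) :=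
        ((continuous_const.inner continuous_id : Continuous fun x : E =>
          (inner ℝ (b j) x : ℝ)).measurable.comp hm).stronglyMeasurable
      have hd : Measurable[sigmaOf X ((s (n + 1) \ s n : Finset ι) : Set ι)]
          (fun ω => ∑ i ∈ s (n + 1) \ s n, X i ω) := measurable_sum_sigmaOf fun i hi => hi
      have hd' : StronglyMeasurable[sigmaOf X ((s (n + 1) \ s n : Finset ι) : Set ι)]
          (fun ω => (inner ℝ (b j) (∑ i ∈ s (n + 1) \ s n, X i ω) : ℝ)) :=
        ((continuous_const.inner continuous_id : Continuous fun x : E =>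
          (inner ℝ (b j) x : ℝ)).measurable.comp hd).stronglyMeasurable
      have hI : Indep (sigmaOf X ((s (n + 1) \ s n : Finset ι) : Set ι)) (F n) P :=
        h.indep_sigmaOf (by
          rw [Finset.disjoint_coe]
          exact Finset.sdiff_disjoint)
      have e : (fun ω => (inner ℝ (b j) (∑ i ∈ s (n + 1), X i ω) : ℝ)) =
          (fun ω => (inner ℝ (b j) (∑ i ∈ s (n + 1) \ s n, X i ω) : ℝ)) +
            fun ω => (inner ℝ (b j) (∑ i ∈ s n, X i ω) : ℝ) := by
        funext ω
        rw [Pi.add_apply, ← inner_add_right, Finset.sum_sdiff (hs.1 n.le_succ)]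
      have h1 := condExp_add ((hint (s (n + 1) \ s n)).const_inner (𝕜 := ℝ) (b j))
        ((hint (s n)).const_inner (𝕜 := ℝ) (b j)) (F n)
      have h2 := condExp_indep_eq (sigmaOf_le h.meas _) (F.le n) hd' hI
      have h3 := condExp_of_stronglyMeasurable (F.le n) hm' ((hint (s n)).const_inner (b j))
      rw [e]
      filter_upwards [h1, h2] with ω h1 h2
      rw [h1, Pi.add_apply, h2, h3, integral_inner (hint _), h.integral_sum, inner_zero_right,
        zero_add]
  have hconv : ∀ j, ∀ᵐ ω ∂P, ∃ c, Tendsto (fun n => (inner ℝ (b j) (∑ i ∈ s n, X i ω) : ℝ))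
      atTop (𝓝 c) := by
    intro j
    refine (hsub j).exists_ae_tendsto_of_bdd
      (R := (1 + ∑' i, ∫⁻ ω, ‖X i ω‖ₑ ^ 2 ∂P).toNNReal) fun n => ?_
    rw [ENNReal.coe_toNNReal (ENNReal.add_ne_top.2 ⟨ENNReal.one_ne_top, h.sq⟩),
      eLpNorm_one_eq_lintegral_enorm]
    calc ∫⁻ ω, ‖(inner ℝ (b j) (∑ i ∈ s n, X i ω) : ℝ)‖ₑ ∂P
        ≤ ∫⁻ ω, (1 + ‖∑ i ∈ s n, X i ω‖ₑ ^ 2) ∂P := by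
          refine lintegral_mono fun ω => ?_
          have h1 : ‖(inner ℝ (b j) (∑ i ∈ s n, X i ω) : ℝ)‖ₑ ≤ ‖∑ i ∈ s n, X i ω‖ₑ := by
            rw [enorm_le_iff_norm_le]
            have := norm_inner_le_norm (𝕜 := ℝ) (b j) (∑ i ∈ s n, X i ω)
            rwa [b.norm_eq_one, one_mul] at this
          refine h1.trans ?_
          rcases le_total ‖∑ i ∈ s n, X i ω‖ₑ 1 with h2 | h2
          · exact h2.trans le_self_add
          · exact (le_self_pow h2 (by norm_num)).trans le_add_self
      _ = 1 + ∑ i ∈ s n, ∫⁻ ω, ‖X i ω‖ₑ ^ 2 ∂P := by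
          rw [lintegral_add_left measurable_const, h.lintegral_enorm_sum_sq]
          simp
      _ ≤ _ := by
          gcongr
          exact ENNReal.sum_le_tsum _
  have hall : ∀ᵐ ω ∂P, ∃ x, Tendsto (fun n => ∑ i ∈ s n, X i ω) atTop (𝓝 x) := by
    filter_upwards [ae_all_iff.2 hconv] with ω hω
    choose c hc using hω
    refine ⟨∑ j, c j • b j, ?_⟩
    refine (tendsto_finsetSum _ fun j _ => (hc j).smul_const (b j)).congr fun n => ?_
    exact b.sum_repr' _
  exact measurable_limit_of_tendsto_metrizable_ae (fun n => (h.measurable_sum (s n)).aemeasurable)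
    hall

lemma IndepCentered.aemeasurable_of_asLimit (h : IndepCentered P X) {s : ℕ → Finset ι}
    (hW : ASLimit P X s W) : AEMeasurable W P :=
  aemeasurable_of_tendsto_metrizable_ae atTop (fun n => (h.measurable_sum (s n)).aemeasurable) hW

lemma ASLimit.congr {s : ℕ → Finset ι} {W' : Ω → E} (hW : ASLimit P X s W) (h : W =ᵐ[P] W') :
    ASLimit P X s W' := by
  filter_upwards [hW, h] with ω hω h
  rwa [← h]

lemma ennreal_add_sq_le (a b : ℝ≥0∞) : (a + b) ^ 2 ≤ 4 * (a ^ 2 + b ^ 2) := by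
  have key : ∀ a b : ℝ≥0∞, a ≤ b → (a + b) ^ 2 ≤ 4 * (a ^ 2 + b ^ 2) := by
    intro a b h
    calc (a + b) ^ 2 ≤ (b + b) ^ 2 := by gcongr
      _ = 4 * b ^ 2 := by ring
      _ ≤ _ := by gcongr; exact le_add_self
  rcases le_total a b with h | h
  · exact key a b h
  · rw [add_comm a, add_comm (a ^ 2)]
    exact key b a h

/-- The limits along two exhaustions agree, since both are close in mean square to the same partial
sum. -/
lemma IndepCentered.ae_eq_of_asLimit (h : IndepCentered P X) {s s' : ℕ → Finset ι}
    (hs : Exhausts s) (hs' : Exhausts s') {W' : Ω → E} (hW : ASLimit P X s W)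
    (hW' : ASLimit P X s' W') : W =ᵐ[P] W' := by
  have hm := h.aemeasurable_of_asLimit hW
  have hm' := h.aemeasurable_of_asLimit hW'
  have hle : ∀ n, ∫⁻ ω, ‖W ω - W' ω‖ₑ ^ 2 ∂P ≤
      8 * tail (fun i => ∫⁻ ω, ‖X i ω‖ₑ ^ 2 ∂P) (s n) := by
    intro n
    have hS : AEMeasurable (fun ω => ‖W ω - ∑ i ∈ s n, X i ω‖ₑ ^ 2) P :=
      (hm.sub (h.measurable_sum (s n)).aemeasurable).enorm.pow_const 2
    calc ∫⁻ ω, ‖W ω - W' ω‖ₑ ^ 2 ∂P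
        ≤ ∫⁻ ω, 4 * (‖W ω - ∑ i ∈ s n, X i ω‖ₑ ^ 2 + ‖W' ω - ∑ i ∈ s n, X i ω‖ₑ ^ 2) ∂P := by
          refine lintegral_mono fun ω => ?_
          refine le_trans ?_ (ennreal_add_sq_le _ _)
          gcongr
          rw [← sub_sub_sub_cancel_right _ _ (∑ i ∈ s n, X i ω)]
          exact enorm_sub_le
      _ = 4 * (∫⁻ ω, ‖W ω - ∑ i ∈ s n, X i ω‖ₑ ^ 2 ∂P +
            ∫⁻ ω, ‖W' ω - ∑ i ∈ s n, X i ω‖ₑ ^ 2 ∂P) := by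
          rw [lintegral_const_mul' _ _ (by norm_num),
            lintegral_add_left' hS]
      _ ≤ 4 * (tail (fun i => ∫⁻ ω, ‖X i ω‖ₑ ^ 2 ∂P) (s n) +
            tail (fun i => ∫⁻ ω, ‖X i ω‖ₑ ^ 2 ∂P) (s n)) := by
          gcongr
          · exact h.lintegral_sub_sum_le hs hW _
          · exact h.lintegral_sub_sum_le hs' hW' _
      _ = _ := by ring
  have ht : Tendsto (fun n => 8 * tail (fun i => ∫⁻ ω, ‖X i ω‖ₑ ^ 2 ∂P) (s n)) atTop (𝓝 0) := by
    simpa using ENNReal.Tendsto.const_mul (tendsto_tail h.sq hs) (Or.inr (by norm_num))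
  have h0 : ∫⁻ ω, ‖W ω - W' ω‖ₑ ^ 2 ∂P = 0 :=
    le_antisymm (ge_of_tendsto' ht hle) zero_le
  have hd : AEMeasurable (fun ω => ‖W ω - W' ω‖ₑ ^ 2) P := (hm.sub hm').enorm.pow_const 2
  rw [lintegral_eq_zero_iff' hd] at h0
  filter_upwards [h0] with ω hω
  simpa [sub_eq_zero] using hω

lemma exists_exhausts (ι : Type*) [Countable ι] : ∃ s : ℕ → Finset ι, Exhausts s := by
  obtain ⟨f, hf⟩ := exists_injective_nat ι
  have hfin : ∀ n, (f ⁻¹' Set.Iio n).Finite := fun n =>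
    (Set.finite_Iio n).preimage hf.injOn
  refine ⟨fun n => (hfin n).toFinset, fun m n hmn => ?_, fun i => ⟨f i + 1, by simp⟩⟩
  intro i hi
  simp only [Set.Finite.mem_toFinset, Set.mem_preimage, Set.mem_Iio] at hi ⊢
  omega

theorem IndepCentered.exists_asLimit_forall [Countable ι] (h : IndepCentered P X) :
    ∃ W : Ω → E, Measurable W ∧ ∀ s : ℕ → Finset ι, Exhausts s → ASLimit P X s W := by
  obtain ⟨s₀, hs₀⟩ := exists_exhausts ι
  obtain ⟨W, hWm, hW⟩ := h.exists_asLimit hs₀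
  refine ⟨W, hWm, fun s hs => ?_⟩
  obtain ⟨W', -, hW'⟩ := h.exists_asLimit hs
  exact hW'.congr (h.ae_eq_of_asLimit hs hs₀ hW' hW)

lemma IndepCentered.memLp_sub_sum (h : IndepCentered P X) {s : ℕ → Finset ι}
    (hs : Exhausts s) (hW : ASLimit P X s W) (t : Finset ι) :
    MemLp (fun ω => W ω - ∑ i ∈ t, X i ω) 2 P := by
  have := (memLp_natCast_iff ((h.aemeasurable_of_asLimit hW).sub
    (h.measurable_sum t).aemeasurable).aestronglyMeasurable (k := 2) (by norm_num)).2
    ((h.lintegral_sub_sum_le hs hW t).trans_lt ((tail_le _ t).trans_lt h.sq.lt_top))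
  exact_mod_cast this

lemma IndepCentered.memLp_limit (h : IndepCentered P X) {s : ℕ → Finset ι}
    (hs : Exhausts s) (hW : ASLimit P X s W) : MemLp W 2 P := by
  simpa using h.memLp_sub_sum hs hW ∅

lemma IndepCentered.integral_limit (h : IndepCentered P X) {s : ℕ → Finset ι}
    (hs : Exhausts s) (hW : ASLimit P X s W) : ∫ ω, W ω ∂P = 0 := by
  have hle : ∀ n, ENNReal.ofReal (‖∫ ω, W ω ∂P‖ ^ 2) ≤
      tail (fun i => ∫⁻ ω, ‖X i ω‖ₑ ^ 2 ∂P) (s n) := by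
    intro n
    refine le_trans ?_ (h.lintegral_sub_sum_le hs hW (s n))
    have hT := h.memLp_sub_sum hs hW (s n)
    have hT' : MemLp (fun ω => W ω - ∑ i ∈ s n, X i ω) (2 : ℕ) P := by exact_mod_cast hT
    rw [lintegral_enorm_pow_eq hT']
    refine ENNReal.ofReal_le_ofReal (le_trans ?_ (sq_integral_norm_le hT))
    have e : ∫ ω, W ω ∂P = ∫ ω, (W ω - ∑ i ∈ s n, X i ω) ∂P := by
      rw [integral_sub ((h.memLp_limit hs hW).integrable (by norm_num))
        ((h.memLp_sum _).integrable (by norm_num)), h.integral_sum, sub_zero]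
    rw [e]
    exact pow_le_pow_left₀ (norm_nonneg _) (norm_integral_le_integral_norm _) 2
  have h0 : ENNReal.ofReal (‖∫ ω, W ω ∂P‖ ^ 2) = 0 :=
    le_antisymm (ge_of_tendsto' (tendsto_tail h.sq hs) hle) zero_le
  rw [ENNReal.ofReal_eq_zero] at h0
  have h1 : ‖∫ ω, W ω ∂P‖ ^ 2 = 0 := le_antisymm h0 (sq_nonneg _)
  simpa using h1

/-- The finite family consisting of the `X i` with `i ∈ t` and the remainder of the series. -/
def truncFamily (X : ι → Ω → E) (W : Ω → E) (t : Finset ι) : Option t → Ω → E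
  | none => fun ω => W ω - ∑ i ∈ t, X i ω
  | some i => X i

lemma sum_truncFamily {F : Type*} [AddCommMonoid F] (g : (Ω → E) → F) (t : Finset ι) :
    ∑ k, g (truncFamily X W t k) = g (fun ω => W ω - ∑ i ∈ t, X i ω) + ∑ i ∈ t, g (X i) := by
  rw [Fintype.sum_option]
  congr 1
  exact Finset.sum_coe_sort t fun i => g (X i)

/-- The remainder of the series is independent of the partial sum over `t`. The special case
`t = {i}` shows that `X i` is independent of the rest of the whole sum. -/
lemma IndepCentered.isStdSum (h : IndepCentered P X) {s : ℕ → Finset ι}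
    (hs : Exhausts s) (hW : ASLimit P X s W) (hWm : Measurable W)
    (hcov : ∀ u v : E, ∫ ω, inner ℝ u (W ω) * inner ℝ v (W ω) ∂P = inner ℝ u v) (t : Finset ι) :
    IsStdSum P (truncFamily X W t) W where
  meas
    | none => hWm.sub (h.measurable_sum t)
    | some i => h.meas i
  sum ω := by
    have := sum_truncFamily (X := X) (W := W) (fun Y => Y ω) t
    rw [this, sub_add_cancel]
  indep
    | none => by
      have := (h.indepFun_sub_sum hs hW t).symm
      refine this.congr EventuallyEq.rfl (EventuallyEq.of_eq (funext fun ω => ?_))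
      simp [truncFamily]
    | some i => by simpa [truncFamily] using h.indepFun_sub_sum hs hW {(i : ι)}
  mean
    | none => by
      change ∫ ω, (W ω - ∑ i ∈ t, X i ω) ∂P = 0
      rw [integral_sub ((h.memLp_limit hs hW).integrable (by norm_num))
        ((h.memLp_sum _).integrable (by norm_num)), h.integral_sum, h.integral_limit hs hW,
        sub_zero]
    | some i => h.mean i
  memLp
    | none => h.memLp_sub_sum hs hW t
    | some i => h.memLp i
  cov := hcov

/-- Truncated moments of the remainder of the series vanish in the limit, so that an error bound for
all the finite families `truncFamily X W (s n)` gives one for the series. -/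
lemma IndepCentered.ofReal_le_tsum_min (h : IndepCentered P X) {s : ℕ → Finset ι}
    (hs : Exhausts s) (hW : ASLimit P X s W) {D L A B : ℝ} (hL : 0 ≤ L) (hA : 0 ≤ A) (hB : 0 ≤ B)
    (hD : ∀ t : Finset ι, D ≤ L * ∑ k, ∫ ω, ‖truncFamily X W t k ω‖ ^ 2 *
      min A (B * ‖truncFamily X W t k ω‖) ∂P) :
    ENNReal.ofReal D ≤ ENNReal.ofReal L *
      ∑' i, ∫⁻ ω, ENNReal.ofReal (‖X i ω‖ ^ 2 * min A (B * ‖X i ω‖)) ∂P := by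
  have hlin : ∀ Y : Ω → E, MemLp Y 2 P →
      ENNReal.ofReal (∫ ω, ‖Y ω‖ ^ 2 * min A (B * ‖Y ω‖) ∂P) =
      ∫⁻ ω, ENNReal.ofReal (‖Y ω‖ ^ 2 * min A (B * ‖Y ω‖)) ∂P := fun Y hY =>
    ofReal_integral_eq_lintegral_ofReal
      (by simpa using integrable_norm_sq_mul_min hY hA hB le_rfl)
      (ae_of_all _ fun ω => mul_nonneg (sq_nonneg _) (le_min hA (by positivity)))
  have hle : ∀ n, ENNReal.ofReal D ≤ ENNReal.ofReal L *
      (ENNReal.ofReal A * tail (fun i => ∫⁻ ω, ‖X i ω‖ₑ ^ 2 ∂P) (s n) +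
        ∑' i, ∫⁻ ω, ENNReal.ofReal (‖X i ω‖ ^ 2 * min A (B * ‖X i ω‖)) ∂P) := by
    intro n
    have h1 := hD (s n)
    rw [sum_truncFamily (fun Y => ∫ ω, ‖Y ω‖ ^ 2 * min A (B * ‖Y ω‖) ∂P)] at h1
    have hnn : ∀ Y : Ω → E, 0 ≤ ∫ ω, ‖Y ω‖ ^ 2 * min A (B * ‖Y ω‖) ∂P := fun Y =>
      integral_nonneg (f := fun ω => ‖Y ω‖ ^ 2 * min A (B * ‖Y ω‖)) fun ω =>
        mul_nonneg (sq_nonneg _) (le_min hA (by positivity))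
    refine (ENNReal.ofReal_le_ofReal h1).trans ?_
    rw [ENNReal.ofReal_mul hL, ENNReal.ofReal_add (hnn _)
      (Finset.sum_nonneg fun i _ => hnn _), ENNReal.ofReal_sum_of_nonneg fun i _ => hnn _,
      hlin _ (h.memLp_sub_sum hs hW (s n))]
    gcongr
    · calc _ ≤ ∫⁻ ω, ENNReal.ofReal A * ‖W ω - ∑ i ∈ s n, X i ω‖ₑ ^ 2 ∂P := by
            refine lintegral_mono fun ω => ?_
            rw [← ofReal_norm, ← ENNReal.ofReal_pow (norm_nonneg _), ← ENNReal.ofReal_mul hA,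
              mul_comm A]
            exact ENNReal.ofReal_le_ofReal
              (mul_le_mul_of_nonneg_left (min_le_left _ _) (sq_nonneg _))
        _ = ENNReal.ofReal A * ∫⁻ ω, ‖W ω - ∑ i ∈ s n, X i ω‖ₑ ^ 2 ∂P :=
            lintegral_const_mul' _ _ ENNReal.ofReal_ne_top
        _ ≤ _ := by gcongr; exact h.lintegral_sub_sum_le hs hW _
    · calc _ = ∑ i ∈ s n, ∫⁻ ω, ENNReal.ofReal (‖X i ω‖ ^ 2 * min A (B * ‖X i ω‖)) ∂P :=
            Finset.sum_congr rfl fun i _ => hlin _ (h.memLp i)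
        _ ≤ _ := ENNReal.sum_le_tsum _
  have ht : Tendsto (fun n => ENNReal.ofReal L *
      (ENNReal.ofReal A * tail (fun i => ∫⁻ ω, ‖X i ω‖ₑ ^ 2 ∂P) (s n) +
        ∑' i, ∫⁻ ω, ENNReal.ofReal (‖X i ω‖ ^ 2 * min A (B * ‖X i ω‖)) ∂P)) atTop
      (𝓝 (ENNReal.ofReal L * (ENNReal.ofReal A * 0 +
        ∑' i, ∫⁻ ω, ENNReal.ofReal (‖X i ω‖ ^ 2 * min A (B * ‖X i ω‖)) ∂P))) :=
    ENNReal.Tendsto.const_mul ((ENNReal.Tendsto.const_mul (tendsto_tail h.sq hs)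
      (Or.inr ENNReal.ofReal_ne_top)).add_const _) (Or.inr ENNReal.ofReal_ne_top)
  rw [mul_zero, zero_add] at ht
  exact ge_of_tendsto' ht hle

end Series

section ThirdMoments

variable {E : Type*} [NormedAddCommGroup E] [InnerProductSpace ℝ E] [FiniteDimensional ℝ E]
  [MeasurableSpace E] [BorelSpace E]
  {Ω : Type*} [mΩ : MeasurableSpace Ω] {P : Measure Ω} [IsProbabilityMeasure P]
  {ι : Type*} {X : ι → Ω → E} {W : Ω → E}

/-- The term linear in `y` is kept exact, because it vanishes in the mean if `y` is centred and
independent of `x`. -/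
lemma norm_add_cube_le (x y : E) : ‖x + y‖ ^ 3 ≤
    ‖x‖ ^ 3 + 3 * (‖x‖ * inner ℝ x y) + 11 * (‖x‖ * ‖y‖ ^ 2 + ‖y‖ ^ 3) := by
  have hsq := norm_add_sq_real x y
  have hp := abs_le.1 (abs_real_inner_le_norm x y)
  have htri := norm_add_le x y
  set n := ‖x + y‖
  set a := ‖x‖ with ha
  set b := ‖y‖ with hb
  set p : ℝ := inner ℝ x y
  have hn0 : 0 ≤ n := norm_nonneg _
  have ha0 : 0 ≤ a := norm_nonneg _
  have hb0 : 0 ≤ b := norm_nonneg _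
  rcases le_total a b with h | h
  · have h1 : n ^ 3 ≤ (2 * b) ^ 3 := pow_le_pow_left₀ hn0 (by linarith) 3
    have h2 : -(a * (a * b)) ≤ a * p := by nlinarith [hp.1]
    have h3 : a * (a * b) ≤ b ^ 3 := by
      calc a * (a * b) ≤ b * (b * b) := by gcongr
        _ = b ^ 3 := by ring
    have h4 : 0 ≤ a ^ 3 := by positivity
    have h5 : 0 ≤ a * b ^ 2 := by positivity
    nlinarith
  · rcases ha0.eq_or_lt with h0 | h0
    · have hb' : b = 0 := le_antisymm (h0 ▸ h) hb0
      have hn' : n = 0 := le_antisymm (by linarith) hn0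
      rw [hn', hb', ← h0]; simp
    -- multiply by `a` and bound `a * n` by the mean of the squares
    have h1 : a * n ^ 3 ≤ (a ^ 2 + p + b ^ 2 / 2) * (a ^ 2 + 2 * p + b ^ 2) := by
      have h2 : a * n ≤ a ^ 2 + p + b ^ 2 / 2 := by nlinarith [sq_nonneg (a - n)]
      calc a * n ^ 3 = (a * n) * n ^ 2 := by ring
        _ ≤ (a ^ 2 + p + b ^ 2 / 2) * n ^ 2 := by gcongr
        _ = _ := by rw [hsq]
    have h2 : p ^ 2 ≤ (a * b) ^ 2 := sq_le_sq' hp.1 hp.2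
    have h3 : p * b ^ 2 ≤ a * b * b ^ 2 := mul_le_mul_of_nonneg_right hp.2 (sq_nonneg b)
    have h4 : b * b ^ 3 ≤ a * b ^ 3 := by gcongr
    have h5 : 0 ≤ a * (a * b ^ 2) := by positivity
    have h6 : 0 ≤ a * b ^ 3 := by positivity
    refine le_of_mul_le_mul_left ?_ h0
    nlinarith

/-- Adding an independent centred vector changes the third absolute moment only by second and third
moments of that vector. -/
lemma integral_norm_add_cube_le {Y V : Ω → E} (hYV : IndepFun Y V P) (hY : MemLp Y 3 P)
    (hV : MemLp V 3 P) (hmean : ∫ ω, Y ω ∂P = 0) :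
    ∫ ω, ‖V ω + Y ω‖ ^ 3 ∂P ≤ ∫ ω, ‖V ω‖ ^ 3 ∂P +
      11 * ((∫ ω, ‖V ω‖ ∂P) * (∫ ω, ‖Y ω‖ ^ 2 ∂P) + ∫ ω, ‖Y ω‖ ^ 3 ∂P) := by
  have hY2 : MemLp Y 2 P := hY.mono_exponent (by norm_num)
  have hV2 : MemLp V 2 P := hV.mono_exponent (by norm_num)
  have hY3 : MemLp Y (3 : ℕ) P := by exact_mod_cast hY
  have hV3 : MemLp V (3 : ℕ) P := by exact_mod_cast hV
  have hS3 : MemLp (fun ω => V ω + Y ω) (3 : ℕ) P := by exact_mod_cast hV.add hY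
  have iY3 : Integrable (fun ω => ‖Y ω‖ ^ 3) P := hY3.integrable_norm_pow (by norm_num)
  have iV3 : Integrable (fun ω => ‖V ω‖ ^ 3) P := hV3.integrable_norm_pow (by norm_num)
  have iS3 : Integrable (fun ω => ‖V ω + Y ω‖ ^ 3) P := hS3.integrable_norm_pow (by norm_num)
  have iY2 : Integrable (fun ω => ‖Y ω‖ ^ 2) P := hY2.integrable_norm_pow (by norm_num)
  have iV2 : Integrable (fun ω => ‖V ω‖ ^ 2) P := hV2.integrable_norm_pow (by norm_num)
  have iV1 : Integrable (fun ω => ‖V ω‖) P := (hV2.integrable (by norm_num)).norm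
  have iY1 : Integrable Y P := hY2.integrable (by norm_num)
  let b := stdOrthonormalBasis ℝ E
  have hcross : ∀ j, Integrable (fun ω => ‖V ω‖ * inner ℝ (b j) (V ω) * inner ℝ (b j) (Y ω)) P ∧
      ∫ ω, ‖V ω‖ * inner ℝ (b j) (V ω) * inner ℝ (b j) (Y ω) ∂P = 0 := by
    intro j
    have hi : IndepFun (fun ω => ‖V ω‖ * inner ℝ (b j) (V ω)) (fun ω => (inner ℝ (b j) (Y ω) : ℝ)) P :=
      hYV.symm.comp (φ := fun x : E => ‖x‖ * (inner ℝ (b j) x : ℝ))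
        (ψ := fun x : E => (inner ℝ (b j) x : ℝ)) (by fun_prop) (by fun_prop)
    have i1 : Integrable (fun ω => ‖V ω‖ * inner ℝ (b j) (V ω)) P := by
      refine iV2.mono' (hV.1.norm.mul (hV.1.const_inner (𝕜 := ℝ))) (ae_of_all _ fun ω => ?_)
      have := norm_inner_le_norm (𝕜 := ℝ) (b j) (V ω)
      rw [b.norm_eq_one, one_mul] at this
      rw [norm_mul, norm_norm, sq]
      gcongr
    have i2 : Integrable (fun ω => (inner ℝ (b j) (Y ω) : ℝ)) P := iY1.const_inner _
    refine ⟨hi.integrable_mul i1 i2, ?_⟩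
    have h := hi.integral_mul_eq_mul_integral i1.1 i2.1
    simp only [Pi.mul_apply] at h
    rw [h, integral_inner iY1, hmean, inner_zero_right, mul_zero]
  have e : ∀ ω, ‖V ω‖ * inner ℝ (V ω) (Y ω) =
      ∑ j, ‖V ω‖ * inner ℝ (b j) (V ω) * inner ℝ (b j) (Y ω) := fun ω => by
    rw [← b.sum_inner_mul_inner (V ω) (Y ω), Finset.mul_sum]
    refine Finset.sum_congr rfl fun j _ => ?_
    rw [real_inner_comm (b j) (V ω)]
    ring
  have iC : Integrable (fun ω => ‖V ω‖ * inner ℝ (V ω) (Y ω)) P := by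
    simp_rw [e]
    exact integrable_finsetSum _ fun j _ => (hcross j).1
  have hC : ∫ ω, ‖V ω‖ * inner ℝ (V ω) (Y ω) ∂P = 0 := by
    simp_rw [e]
    rw [integral_finsetSum _ fun j _ => (hcross j).1]
    exact Finset.sum_eq_zero fun j _ => (hcross j).2
  have hi : IndepFun (fun ω => ‖V ω‖) (fun ω => ‖Y ω‖ ^ 2) P :=
    hYV.symm.comp (φ := fun x : E => ‖x‖) (ψ := fun x : E => ‖x‖ ^ 2) (by fun_prop) (by fun_prop)
  have iM : Integrable (fun ω => ‖V ω‖ * ‖Y ω‖ ^ 2) P := hi.integrable_mul iV1 iY2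
  have hM : ∫ ω, ‖V ω‖ * ‖Y ω‖ ^ 2 ∂P = (∫ ω, ‖V ω‖ ∂P) * ∫ ω, ‖Y ω‖ ^ 2 ∂P := by
    have h := hi.integral_mul_eq_mul_integral iV1.1 iY2.1
    simpa only [Pi.mul_apply] using h
  have i1 : Integrable (fun ω => ‖V ω‖ ^ 3 + 3 * (‖V ω‖ * inner ℝ (V ω) (Y ω))) P :=
    iV3.add (iC.const_mul 3)
  have i2 : Integrable (fun ω => ‖V ω‖ * ‖Y ω‖ ^ 2 + ‖Y ω‖ ^ 3) P := iM.add iY3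
  have i3 : Integrable (fun ω => ‖V ω‖ ^ 3 + 3 * (‖V ω‖ * inner ℝ (V ω) (Y ω)) +
      11 * (‖V ω‖ * ‖Y ω‖ ^ 2 + ‖Y ω‖ ^ 3)) P := i1.add (i2.const_mul 11)
  refine (integral_mono iS3 i3 fun ω => norm_add_cube_le (V ω) (Y ω)).trans_eq ?_
  rw [integral_add i1 (i2.const_mul 11), integral_add iV3 (iC.const_mul 3), integral_const_mul,
    integral_const_mul, integral_add iM iY3, hC, hM, mul_zero, add_zero]

lemma IndepCentered.integral_norm_sum_cube_le (h : IndepCentered P X)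
    (h3 : ∀ i, MemLp (X i) 3 P) {σ : ℝ} (hσ0 : 0 ≤ σ)
    (hσ : ∀ t : Finset ι, ∑ i ∈ t, ∫ ω, ‖X i ω‖ ^ 2 ∂P ≤ σ ^ 2) (t : Finset ι) :
    ∫ ω, ‖∑ i ∈ t, X i ω‖ ^ 3 ∂P ≤
      ∑ i ∈ t, 11 * (σ * (∫ ω, ‖X i ω‖ ^ 2 ∂P) + ∫ ω, ‖X i ω‖ ^ 3 ∂P) := by
  classical
  induction t using Finset.induction_on with
  | empty => simp
  | insert i t hi ih =>
    simp_rw [Finset.sum_insert hi]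
    simp_rw [add_comm (X i _)]
    refine (integral_norm_add_cube_le (h.indepFun_sum hi) (h3 i)
      (memLp_finsetSum _ fun j _ => h3 j) (h.mean i)).trans ?_
    have h1 : ∫ ω, ‖∑ j ∈ t, X j ω‖ ∂P ≤ σ := by
      refine abs_le_of_sq_le_sq' ?_ hσ0 |>.2
      refine (sq_integral_norm_le (h.memLp_sum t)).trans ?_
      rw [h.integral_norm_sum_sq]
      exact hσ t
    have h2 : 0 ≤ ∫ ω, ‖X i ω‖ ^ 2 ∂P :=
      integral_nonneg (f := fun ω => ‖X i ω‖ ^ 2) fun ω => by positivity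
    nlinarith [mul_le_mul_of_nonneg_right h1 h2]

/-- The third absolute moment of the remainder is bounded by the tail of a convergent series. -/
lemma IndepCentered.exists_lintegral_cube_le (h : IndepCentered P X)
    (hcube : ∑' i, ∫⁻ ω, ‖X i ω‖ₑ ^ 3 ∂P ≠ ∞) :
    ∃ a : ι → ℝ≥0∞, ∑' i, a i ≠ ∞ ∧ ∀ (W : Ω → E) (s : ℕ → Finset ι), Exhausts s → ASLimit P X s W →
      ∀ t, ∫⁻ ω, ‖W ω - ∑ i ∈ t, X i ω‖ₑ ^ 3 ∂P ≤ tail a t := by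
  classical
  have h3 : ∀ i, MemLp (X i) (3 : ℕ) P := fun i =>
    (memLp_natCast_iff (h.meas i).aestronglyMeasurable (by norm_num)).2
      ((ENNReal.le_tsum i).trans_lt hcube.lt_top)
  have h3' : ∀ i, MemLp (X i) 3 P := fun i => by exact_mod_cast h3 i
  have h2 : ∀ i, MemLp (X i) (2 : ℕ) P := fun i => by exact_mod_cast h.memLp i
  set V := (∑' i, ∫⁻ ω, ‖X i ω‖ₑ ^ 2 ∂P).toReal with hV
  have hn2 : ∀ i, 0 ≤ ∫ ω, ‖X i ω‖ ^ 2 ∂P := fun i =>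
    integral_nonneg (f := fun ω => ‖X i ω‖ ^ 2) fun ω => by positivity
  have hn3 : ∀ i, 0 ≤ ∫ ω, ‖X i ω‖ ^ 3 ∂P := fun i =>
    integral_nonneg (f := fun ω => ‖X i ω‖ ^ 3) fun ω => by positivity
  have hσ : ∀ t : Finset ι, ∑ i ∈ t, ∫ ω, ‖X i ω‖ ^ 2 ∂P ≤ √V ^ 2 := fun t => by
    rw [Real.sq_sqrt ENNReal.toReal_nonneg, ← ENNReal.ofReal_le_iff_le_toReal h.sq,
      ENNReal.ofReal_sum_of_nonneg fun i _ => hn2 i]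
    simp_rw [← lintegral_enorm_pow_eq (h2 _)]
    exact ENNReal.sum_le_tsum t
  have key : ∀ u : Finset ι, ∫⁻ ω, ‖∑ i ∈ u, X i ω‖ₑ ^ 3 ∂P ≤ ∑ i ∈ u, ENNReal.ofReal 11 *
      (ENNReal.ofReal (√V) * ∫⁻ ω, ‖X i ω‖ₑ ^ 2 ∂P + ∫⁻ ω, ‖X i ω‖ₑ ^ 3 ∂P) := fun u => by
    have hm : MemLp (fun ω => ∑ i ∈ u, X i ω) (3 : ℕ) P := memLp_finsetSum _ fun i _ => h3 i
    rw [lintegral_enorm_pow_eq hm]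
    refine (ENNReal.ofReal_le_ofReal
      (h.integral_norm_sum_cube_le h3' (Real.sqrt_nonneg V) hσ u)).trans_eq ?_
    rw [ENNReal.ofReal_sum_of_nonneg fun i _ => by have := hn2 i; have := hn3 i; positivity]
    refine Finset.sum_congr rfl fun i _ => ?_
    rw [ENNReal.ofReal_mul (by norm_num), ENNReal.ofReal_add
      (mul_nonneg (Real.sqrt_nonneg V) (hn2 i)) (hn3 i), ENNReal.ofReal_mul (Real.sqrt_nonneg V),
      lintegral_enorm_pow_eq (h2 i), lintegral_enorm_pow_eq (h3 i)]
  refine ⟨fun i => ENNReal.ofReal 11 * (ENNReal.ofReal (√V) * ∫⁻ ω, ‖X i ω‖ₑ ^ 2 ∂P +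
    ∫⁻ ω, ‖X i ω‖ₑ ^ 3 ∂P), ?_, fun W s hs hW t => ?_⟩
  · rw [ENNReal.tsum_mul_left, ENNReal.tsum_add, ENNReal.tsum_mul_left]
    exact ENNReal.mul_ne_top ENNReal.ofReal_ne_top
      (ENNReal.add_ne_top.2 ⟨ENNReal.mul_ne_top ENNReal.ofReal_ne_top h.sq, hcube⟩)
  · refine lintegral_enorm_pow_le_of_tendsto (fun n => h.measurable_sum (s n \ t))
      (hW.sub_sum hs t) (Eventually.of_forall fun n => ?_)
    exact (key _).trans (sum_le_tail _ fun i hi => (Finset.mem_sdiff.1 hi).2)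

lemma memLp_three_iff {Y : Ω → E} (hY : AEStronglyMeasurable Y P) :
    MemLp Y 3 P ↔ ∫⁻ ω, ‖Y ω‖ₑ ^ 3 ∂P < ∞ := by
  have := memLp_natCast_iff hY (k := 3) (by norm_num)
  exact_mod_cast this

/-- An error bound by third moments for all the finite families `truncFamily X W (s n)` gives one
for the series. -/
lemma IndepCentered.ofReal_le_tsum_cube (h : IndepCentered P X) {s : ℕ → Finset ι}
    (hs : Exhausts s) (hW : ASLimit P X s W) (hcube : ∑' i, ∫⁻ ω, ‖X i ω‖ₑ ^ 3 ∂P ≠ ∞) {D L : ℝ}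
    (hL : 0 ≤ L) (hD : ∀ t : Finset ι, (∀ k, MemLp (truncFamily X W t k) 3 P) →
      D ≤ L * ∑ k, ∫ ω, ‖truncFamily X W t k ω‖ ^ 3 ∂P) :
    ENNReal.ofReal D ≤ ENNReal.ofReal L * ∑' i, ∫⁻ ω, ‖X i ω‖ₑ ^ 3 ∂P := by
  obtain ⟨a, ha, hle⟩ := h.exists_lintegral_cube_le hcube
  have h3 : ∀ i, MemLp (X i) 3 P := fun i =>
    (memLp_three_iff (h.meas i).aestronglyMeasurable).2
      ((ENNReal.le_tsum i).trans_lt hcube.lt_top)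
  have hT : ∀ t : Finset ι, MemLp (fun ω => W ω - ∑ i ∈ t, X i ω) 3 P := fun t =>
    (memLp_three_iff ((h.aemeasurable_of_asLimit hW).sub
      (h.measurable_sum t).aemeasurable).aestronglyMeasurable).2
      ((hle W s hs hW t).trans_lt ((tail_le _ _).trans_lt ha.lt_top))
  have e : ∀ Y : Ω → E, MemLp Y 3 P →
      ENNReal.ofReal (∫ ω, ‖Y ω‖ ^ 3 ∂P) = ∫⁻ ω, ‖Y ω‖ₑ ^ 3 ∂P := fun Y hY =>
    (lintegral_enorm_pow_eq (by exact_mod_cast hY)).symm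
  have hnn : ∀ Y : Ω → E, 0 ≤ ∫ ω, ‖Y ω‖ ^ 3 ∂P := fun Y =>
    integral_nonneg (f := fun ω => ‖Y ω‖ ^ 3) fun ω => by positivity
  have key : ∀ n, ENNReal.ofReal D ≤ ENNReal.ofReal L *
      (tail a (s n) + ∑' i, ∫⁻ ω, ‖X i ω‖ₑ ^ 3 ∂P) := by
    intro n
    have h1 := hD (s n) fun k => by
      cases k with
      | none => exact hT (s n)
      | some i => exact h3 i
    rw [sum_truncFamily (fun Y => ∫ ω, ‖Y ω‖ ^ 3 ∂P)] at h1
    refine (ENNReal.ofReal_le_ofReal h1).trans ?_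
    rw [ENNReal.ofReal_mul hL, ENNReal.ofReal_add (hnn _)
      (Finset.sum_nonneg fun i _ => hnn _), ENNReal.ofReal_sum_of_nonneg fun i _ => hnn _,
      e _ (hT (s n))]
    gcongr
    · exact hle W s hs hW (s n)
    · rw [Finset.sum_congr rfl fun i _ => e _ (h3 i)]
      exact ENNReal.sum_le_tsum _
  have ht : Tendsto (fun n => ENNReal.ofReal L *
      (tail a (s n) + ∑' i, ∫⁻ ω, ‖X i ω‖ₑ ^ 3 ∂P)) atTop
      (𝓝 (ENNReal.ofReal L * (0 + ∑' i, ∫⁻ ω, ‖X i ω‖ₑ ^ 3 ∂P))) :=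
    ENNReal.Tendsto.const_mul ((tendsto_tail ha hs).add_const _) (Or.inr ENNReal.ofReal_ne_top)
  rw [zero_add] at ht
  exact ge_of_tendsto' ht key

lemma IndepCentered.memLp_limit_three (h : IndepCentered P X) {s : ℕ → Finset ι}
    (hs : Exhausts s) (hW : ASLimit P X s W) (hcube : ∑' i, ∫⁻ ω, ‖X i ω‖ₑ ^ 3 ∂P ≠ ∞) :
    MemLp W 3 P := by
  obtain ⟨a, ha, hle⟩ := h.exists_lintegral_cube_le hcube
  refine (memLp_three_iff (h.aemeasurable_of_asLimit hW).aestronglyMeasurable).2 ?_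
  have := (hle W s hs hW ∅).trans_lt ((tail_le _ _).trans_lt ha.lt_top)
  simpa using this

end ThirdMoments

/-! ### Error bounds for countable sums -/

section CountableSums

variable {E : Type*} [NormedAddCommGroup E] [InnerProductSpace ℝ E] [FiniteDimensional ℝ E]
  [MeasurableSpace E] [BorelSpace E]
  {Ω : Type*} [mΩ : MeasurableSpace Ω] {P : Measure Ω} [IsProbabilityMeasure P]
  {ι : Type*} {X : ι → Ω → E} {W : Ω → E} {f : E → ℝ} {s : ℕ → Finset ι}

lemma integrable_one_add_norm_pow {V : Ω → E} {m : ℕ} (hm : m ≠ 0) (hV : MemLp V m P) :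
    Integrable (fun ω => (1 + ‖V ω‖) ^ m) P := by
  have h : MemLp (fun ω => 1 + ‖V ω‖) m P := (memLp_const (1 : ℝ)).add hV.norm
  refine (h.integrable_norm_pow hm).congr (ae_of_all _ fun ω => ?_)
  simp only [Real.norm_eq_abs]
  rw [abs_of_nonneg (by positivity)]

lemma C2Growth.integrable_comp {k : ℕ} (hf : C2Growth f k) {V : Ω → E}
    (hV : MemLp V (k + 2 : ℕ) P) : Integrable (fun ω => f (V ω)) P := by
  obtain ⟨C, hC, hle⟩ := hf.self_bdd
  have hi : Integrable (fun ω => (1 + ‖V ω‖) ^ (k + 2)) P :=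
    integrable_one_add_norm_pow (by omega) hV
  exact (hi.const_mul C).mono' (hf.contDiff.continuous.comp_aestronglyMeasurable hV.1)
    (ae_of_all _ fun ω => hle _)

lemma c2Growth_one_of_lipschitz_hess (hf : ContDiff ℝ 2 f) {L : ℝ} (hL : 0 ≤ L)
    (h : ∀ a b x y, |fderiv ℝ (fderiv ℝ f) a x y - fderiv ℝ (fderiv ℝ f) b x y| ≤
      L * ‖a - b‖ * (‖x‖ * ‖y‖)) : C2Growth f 1 := by
  have hb0 := bilinBound_nonneg (fderiv ℝ (fderiv ℝ f) 0)
  refine ⟨hf, bilinBound (fderiv ℝ (fderiv ℝ f) 0) + L, by positivity, fun a => ?_⟩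
  refine ContinuousLinearMap.opNorm_le_bound₂ _ (by positivity) fun x y => ?_
  have h1 := h a 0 x y
  have h2 := abs_le_bilinBound (fderiv ℝ (fderiv ℝ f) 0) x y
  have h3 := abs_sub_abs_le_abs_sub (fderiv ℝ (fderiv ℝ f) a x y) (fderiv ℝ (fderiv ℝ f) 0 x y)
  rw [sub_zero] at h1
  have h4 : 0 ≤ bilinBound (fderiv ℝ (fderiv ℝ f) 0) * ‖a‖ * (‖x‖ * ‖y‖) := by positivity
  have h5 : 0 ≤ L * (‖x‖ * ‖y‖) := by positivity
  rw [Real.norm_eq_abs, pow_one]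
  linarith

lemma c2Growth_zero_of_hess_const (hf : ContDiff ℝ 2 f)
    (h : ∀ a b x y, fderiv ℝ (fderiv ℝ f) a x y = fderiv ℝ (fderiv ℝ f) b x y) :
    C2Growth f 0 := by
  have hb0 := bilinBound_nonneg (fderiv ℝ (fderiv ℝ f) 0)
  refine ⟨hf, bilinBound (fderiv ℝ (fderiv ℝ f) 0), hb0, fun a => ?_⟩
  refine ContinuousLinearMap.opNorm_le_bound₂ _ (by positivity) fun x y => ?_
  rw [h a 0 x y, pow_zero, mul_one]
  exact abs_le_bilinBound _ x y

/-- A single centred vector with identity covariance is a trivial sum. -/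
lemma isStdSum_single (hWm : Measurable W) (hW : MemLp W 2 P) (hmean : ∫ ω, W ω ∂P = 0)
    (hcov : ∀ u v : E, ∫ ω, inner ℝ u (W ω) * inner ℝ v (W ω) ∂P = inner ℝ u v) :
    IsStdSum P (fun _ : Unit => W) W where
  meas _ := hWm
  sum ω := by simp
  indep _ := by
    simp only [sub_self]
    exact indepFun_const_right _ _
  mean _ := hmean
  memLp _ := hW
  cov := hcov

theorem IndepCentered.error_le_of_lipschitz (h : IndepCentered P X) (hs : Exhausts s)
    (hW : ASLimit P X s W) (hWm : Measurable W)
    (hcov : ∀ u v : E, ∫ ω, inner ℝ u (W ω) * inner ℝ v (W ω) ∂P = inner ℝ u v)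
    (hd : 1 ≤ Module.finrank ℝ E) {K : ℝ} (hK : 0 ≤ K) (hf : ∀ a b, |f a - f b| ≤ K * ‖a - b‖) :
    ENNReal.ofReal |∫ ω, f (W ω) ∂P - ∫ z, f z ∂(stdGaussian E)| ≤ ENNReal.ofReal K *
      ∑' i, ∫⁻ ω, ENNReal.ofReal (‖X i ω‖ ^ 2 *
        min 4.5 ((11.1 + 0.83 * Real.log (Module.finrank ℝ E)) * ‖X i ω‖)) ∂P := by
  have hlog : 0 ≤ Real.log (Module.finrank ℝ E) := Real.log_natCast_nonneg _
  exact h.ofReal_le_tsum_min hs hW hK (by norm_num) (by positivity) fun t =>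
    (h.isStdSum hs hW hWm hcov t).wassersteinLE hd f K hK hf

theorem IndepCentered.error_le_of_lipschitz_fderiv (h : IndepCentered P X) (hs : Exhausts s)
    (hW : ASLimit P X s W) (hWm : Measurable W)
    (hcov : ∀ u v : E, ∫ ω, inner ℝ u (W ω) * inner ℝ v (W ω) ∂P = inner ℝ u v)
    (hfd : Differentiable ℝ f) {L : ℝ} (hL : 0 ≤ L)
    (hf : ∀ a b x, |fderiv ℝ f a x - fderiv ℝ f b x| ≤ L * ‖a - b‖ * ‖x‖) :
    ENNReal.ofReal |∫ ω, f (W ω) ∂P - ∫ z, f z ∂(stdGaussian E)| ≤ ENNReal.ofReal L *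
      ∑' i, ∫⁻ ω, ENNReal.ofReal (‖X i ω‖ ^ 2 * min 2.5 (0.94 * ‖X i ω‖)) ∂P :=
  h.ofReal_le_tsum_min hs hW hL (by norm_num) (by norm_num) fun t =>
    (h.isStdSum hs hW hWm hcov t).abs_sub_le_of_lipschitz_fderiv hfd hL hf

/-- The case of finite third moments or of a quadratic test function. -/
theorem IndepCentered.error_le_of_lipschitz_hess (h : IndepCentered P X) (hs : Exhausts s)
    (hW : ASLimit P X s W) (hWm : Measurable W)
    (hcov : ∀ u v : E, ∫ ω, inner ℝ u (W ω) * inner ℝ v (W ω) ∂P = inner ℝ u v)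
    (hf2 : ContDiff ℝ 2 f) {L : ℝ} (hL : 0 ≤ L)
    (hf : ∀ a b x y, |fderiv ℝ (fderiv ℝ f) a x y - fderiv ℝ (fderiv ℝ f) b x y| ≤
      L * ‖a - b‖ * (‖x‖ * ‖y‖))
    (hfin : ENNReal.ofReal L / 2 * ∑' i, ∫⁻ ω, ‖X i ω‖ₑ ^ 3 ∂P < ∞) :
    Integrable (fun ω => f (W ω)) P ∧
    ENNReal.ofReal |∫ ω, f (W ω) ∂P - ∫ z, f z ∂(stdGaussian E)| ≤
      ENNReal.ofReal L / 2 * ∑' i, ∫⁻ ω, ‖X i ω‖ₑ ^ 3 ∂P := by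
  have hW2 := h.memLp_limit hs hW
  rcases hL.eq_or_lt with rfl | hL0
  · -- the third moments need not be summable here, so `W` itself is taken as the only summand
    have hc : ∀ a b x y, fderiv ℝ (fderiv ℝ f) a x y = fderiv ℝ (fderiv ℝ f) b x y := by
      intro a b x y
      have := hf a b x y
      rw [zero_mul, zero_mul] at this
      exact sub_eq_zero.1 (abs_nonpos_iff.1 this)
    have hf0 := c2Growth_zero_of_hess_const hf2 hc
    refine ⟨hf0.integrable_comp (by exact_mod_cast hW2), ?_⟩
    rw [(isStdSum_single hWm hW2 (h.integral_limit hs hW) hcov).integral_eq_of_hess_const hf0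
      fun a b x => hc a b x x]
    simp
  · have hf1 := c2Growth_one_of_lipschitz_hess hf2 hL hf
    have hcube : ∑' i, ∫⁻ ω, ‖X i ω‖ₑ ^ 3 ∂P ≠ ∞ := by
      intro hinf
      rw [hinf, ENNReal.mul_top] at hfin
      · exact lt_irrefl _ hfin
      · simpa using hL0
    refine ⟨hf1.integrable_comp (by exact_mod_cast h.memLp_limit_three hs hW hcube), ?_⟩
    have := h.ofReal_le_tsum_cube hs hW hcube (L := L / 2) (by positivity)
      (D := |∫ ω, f (W ω) ∂P - ∫ z, f z ∂(stdGaussian E)|) fun t ht =>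
      (h.isStdSum hs hW hWm hcov t).abs_sub_le_of_lipschitz_hess hf1 ht hL
        fun a b x => (hf a b x x).trans_eq (by ring)
    rwa [ENNReal.ofReal_div_of_pos (by norm_num), ENNReal.ofReal_ofNat] at this

end CountableSums

/-! ### The smoothness constants `M` -/

section Smoothness

variable {d : ℕ} {f : EuclideanSpace ℝ (Fin d) → ℝ}

/-- Finiteness of `M (k + 1) f` means that `f` is `k` times continuously differentiable and that
its `k`-th derivative is Lipschitz with constant `M (k + 1) f`. -/
lemma contDiff_and_lipschitz_of_M_lt_top {k : ℕ} (h : M (k + 1) f < ∞) :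
    ContDiff ℝ k f ∧ ∀ x y m, |iteratedFDeriv ℝ k f x m - iteratedFDeriv ℝ k f y m| ≤
      (M (k + 1) f).toReal * ‖x - y‖ * ∏ i, ‖m i‖ := by
  set L := (M (k + 1) f).toReal with hLdef
  have hL0 : 0 ≤ L := ENNReal.toReal_nonneg
  have hT : TimesDifferentiable k f := by
    by_contra hT
    simp [M, hT] at h
  have hM : M (k + 1) f = ⨆ (x : EuclideanSpace ℝ (Fin d)) (y : EuclideanSpace ℝ (Fin d))
      (_ : x ≠ y), ‖iteratedFDeriv ℝ k f x - iteratedFDeriv ℝ k f y‖ₑ / ‖x - y‖ₑ := by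
    simp [M, hT]
  have hlip : ∀ x y, ‖iteratedFDeriv ℝ k f x - iteratedFDeriv ℝ k f y‖ ≤ L * ‖x - y‖ := by
    intro x y
    rcases eq_or_ne x y with rfl | hxy
    · simp
    have h1 : ‖iteratedFDeriv ℝ k f x - iteratedFDeriv ℝ k f y‖ₑ / ‖x - y‖ₑ ≤ M (k + 1) f := by
      rw [hM]
      exact le_iSup_of_le x (le_iSup_of_le y (le_iSup_of_le hxy le_rfl))
    have h2 : ‖x - y‖ₑ ≠ 0 := by simpa [sub_eq_zero] using hxy
    rw [ENNReal.div_le_iff h2 enorm_ne_top, ← ENNReal.ofReal_toReal h.ne, ← ofReal_norm,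
      ← ofReal_norm, ← ENNReal.ofReal_mul hL0] at h1
    exact (ENNReal.ofReal_le_ofReal_iff (by positivity)).1 h1
  refine ⟨contDiff_nat_iff_continuous_differentiable.2 ⟨fun m hm => ?_, fun m hm => hT m hm⟩,
    fun x y m => ?_⟩
  · rcases hm.lt_or_eq with hm | rfl
    · exact (hT m hm).continuous
    · exact (LipschitzWith.of_dist_le' (K := L) fun x y => by
        rw [dist_eq_norm, dist_eq_norm]; exact hlip x y).continuous
  · have h1 := (iteratedFDeriv ℝ k f x - iteratedFDeriv ℝ k f y).le_opNorm m
    rw [_root_.sub_apply, Real.norm_eq_abs] at h1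
    exact h1.trans (mul_le_mul_of_nonneg_right (hlip x y)
      (Finset.prod_nonneg fun i _ => norm_nonneg _))

lemma lipschitz_of_M_one_lt_top (h : M 1 f < ∞) (x y : EuclideanSpace ℝ (Fin d)) :
    |f x - f y| ≤ (M 1 f).toReal * ‖x - y‖ := by
  have := (contDiff_and_lipschitz_of_M_lt_top (k := 0) h).2 x y ![]
  simpa using this

lemma lipschitz_fderiv_of_M_two_lt_top (h : M 2 f < ∞) : Differentiable ℝ f ∧
    ∀ x y v, |fderiv ℝ f x v - fderiv ℝ f y v| ≤ (M 2 f).toReal * ‖x - y‖ * ‖v‖ := by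
  obtain ⟨h1, h2⟩ := contDiff_and_lipschitz_of_M_lt_top (k := 1) h
  refine ⟨h1.differentiable (by norm_num), fun x y v => ?_⟩
  have := h2 x y ![v]
  rw [iteratedFDeriv_one_apply, iteratedFDeriv_one_apply] at this
  simpa using this

lemma lipschitz_hess_of_M_three_lt_top (h : M 3 f < ∞) : ContDiff ℝ 2 f ∧
    ∀ x y v w, |fderiv ℝ (fderiv ℝ f) x v w - fderiv ℝ (fderiv ℝ f) y v w| ≤
      (M 3 f).toReal * ‖x - y‖ * (‖v‖ * ‖w‖) := by
  obtain ⟨h1, h2⟩ := contDiff_and_lipschitz_of_M_lt_top (k := 2) h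
  refine ⟨h1, fun x y v w => ?_⟩
  have := h2 x y ![v, w]
  rw [iteratedFDeriv_two_apply, iteratedFDeriv_two_apply] at this
  simpa using this

/-- The identity covariance matrix, in terms of the inner product. -/
lemma integral_inner_mul_inner_of_covariance {Ω : Type*} [MeasurableSpace Ω] {P : Measure Ω}
    [IsProbabilityMeasure P] {W : Ω → EuclideanSpace ℝ (Fin d)} (hW : MemLp W 2 P)
    (hmean : ∫ ω, W ω ∂P = 0)
    (hcov : ∀ j k : Fin d,
      covariance (fun ω => W ω j) (fun ω => W ω k) P = if j = k then 1 else 0)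
    (u v : EuclideanSpace ℝ (Fin d)) :
    ∫ ω, inner ℝ u (W ω) * inner ℝ v (W ω) ∂P = inner ℝ u v := by
  have hWj : ∀ j, MemLp (fun ω => W ω j) 2 P := fun j =>
    hW.continuousLinearMap_comp (EuclideanSpace.proj j : EuclideanSpace ℝ (Fin d) →L[ℝ] ℝ)
  have hmj : ∀ j, ∫ ω, W ω j ∂P = 0 := fun j => by
    have := (EuclideanSpace.proj j : EuclideanSpace ℝ (Fin d) →L[ℝ] ℝ).integral_comp_comm
      (hW.integrable (by norm_num))
    rw [hmean, map_zero] at this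
    exact this
  have hprod : ∀ j k, ∫ ω, W ω j * W ω k ∂P = if j = k then 1 else 0 := fun j k => by
    have := covariance_eq_sub (hWj j) (hWj k)
    rw [hcov, hmj, zero_mul, sub_zero] at this
    exact this.symm
  have hint : ∀ j k, Integrable (fun ω => W ω j * W ω k) P := fun j k =>
    (hWj j).integrable_mul (hWj k)
  have e : ∀ ω, inner ℝ u (W ω) * inner ℝ v (W ω) =
      ∑ j, ∑ k, u j * v k * (W ω j * W ω k) := fun ω => by
    rw [PiLp.inner_apply, PiLp.inner_apply, Finset.sum_mul_sum]
    refine Finset.sum_congr rfl fun j _ => Finset.sum_congr rfl fun k _ => ?_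
    simp only [RCLike.inner_apply, conj_trivial]
    ring
  simp_rw [e]
  rw [integral_finsetSum _ fun j _ => integrable_finsetSum _ fun k _ => (hint j k).const_mul _]
  have e2 : ∀ j, ∫ ω, ∑ k, u j * v k * (W ω j * W ω k) ∂P = u j * v j := fun j => by
    rw [integral_finsetSum _ fun k _ => (hint j k).const_mul _]
    simp_rw [integral_const_mul, hprod]
    simp
  simp_rw [e2]
  rw [PiLp.inner_apply]
  refine Finset.sum_congr rfl fun j _ => ?_
  simp only [RCLike.inner_apply, conj_trivial]
  ring

end Smoothness

end LipCLT

theorem mainTheorem3 {Ω ι : Type*} [MeasurableSpace Ω] (P : Measure Ω) [IsProbabilityMeasure P]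
    [Countable ι] (d : ℕ) (hd : 1 ≤ d)
    (X : ι → Ω → EuclideanSpace ℝ (Fin d))
    (hmeas : ∀ i, Measurable (X i))
    (hindep : iIndepFun X P)
    (hmean : ∀ i, ∫ ω, X i ω ∂P = 0)
    (hsq : ∑' i, ∫⁻ ω, ‖X i ω‖ₑ ^ 2 ∂P < ∞) :
    -- the sum of the `X i` exists almost surely
    (∃ W : Ω → EuclideanSpace ℝ (Fin d), Measurable W ∧
      ∀ s : ℕ → Finset ι, LipCLT.Exhausts s → LipCLT.ASSumAlong P X s W) ∧
    -- and if its covariance matrix is the identity, the error bounds hold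
    ∀ (W : Ω → EuclideanSpace ℝ (Fin d)) (s : ℕ → Finset ι),
      LipCLT.Exhausts s → LipCLT.ASSumAlong P X s W →
      (∀ j k : Fin d,
        covariance (fun ω => W ω j) (fun ω => W ω k) P = if j = k then 1 else 0) →
      ∀ f : EuclideanSpace ℝ (Fin d) → ℝ,
        (LipCLT.M 3 f < ∞ →
          Integrable f (stdGaussian (EuclideanSpace ℝ (Fin d))) ∧
          (LipCLT.M 3 f / 2 * ∑' i, ∫⁻ ω, ‖X i ω‖ₑ ^ 3 ∂P < ∞ →
            Integrable (fun ω => f (W ω)) P) ∧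
          ENNReal.ofReal
              |∫ ω, f (W ω) ∂P - ∫ z, f z ∂(stdGaussian (EuclideanSpace ℝ (Fin d)))| ≤
            LipCLT.M 3 f / 2 * ∑' i, ∫⁻ ω, ‖X i ω‖ₑ ^ 3 ∂P) ∧
        (LipCLT.M 2 f < ∞ →
          Integrable f (stdGaussian (EuclideanSpace ℝ (Fin d))) ∧
          Integrable (fun ω => f (W ω)) P ∧
          ENNReal.ofReal
              |∫ ω, f (W ω) ∂P - ∫ z, f z ∂(stdGaussian (EuclideanSpace ℝ (Fin d)))| ≤
            LipCLT.M 2 f * ∑' i, ∫⁻ ω, ENNReal.ofReal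
              (‖X i ω‖ ^ 2 * min 2.5 (0.94 * ‖X i ω‖)) ∂P) ∧
        (LipCLT.M 1 f < ∞ →
          Integrable f (stdGaussian (EuclideanSpace ℝ (Fin d))) ∧
          Integrable (fun ω => f (W ω)) P ∧
          ENNReal.ofReal
              |∫ ω, f (W ω) ∂P - ∫ z, f z ∂(stdGaussian (EuclideanSpace ℝ (Fin d)))| ≤
            LipCLT.M 1 f * ∑' i, ∫⁻ ω, ENNReal.ofReal
              (‖X i ω‖ ^ 2 * min 4.5 ((11.1 + 0.83 * Real.log d) * ‖X i ω‖)) ∂P) := by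
  have h : LipCLT.IndepCentered P X := ⟨hmeas, hindep, hmean, hsq.ne⟩
  refine ⟨h.exists_asLimit_forall, fun W₀ s hs hW₀ hcov₀ f => ?_⟩
  have hcov := LipCLT.integral_inner_mul_inner_of_covariance (h.memLp_limit hs hW₀)
    (h.integral_limit hs hW₀) hcov₀
  -- `W₀` need not be measurable, so it is replaced by a measurable version
  have ha := h.aemeasurable_of_asLimit hW₀
  set W := ha.mk W₀
  have hWm : Measurable W := ha.measurable_mk
  have hae : W₀ =ᵐ[P] W := ha.ae_eq_mk
  have hW : LipCLT.ASLimit P X s W := LipCLT.ASLimit.congr hW₀ hae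
  have hW2 := h.memLp_limit hs hW
  have hZ2 := LipCLT.memLp_id_stdGaussian (E := EuclideanSpace ℝ (Fin d)) 2 (by simp)
  have hcov' : ∀ u v : EuclideanSpace ℝ (Fin d),
      ∫ ω, inner ℝ u (W ω) * inner ℝ v (W ω) ∂P = inner ℝ u v := fun u v => by
    rw [← hcov u v]
    refine integral_congr_ae ?_
    filter_upwards [hae] with ω hω
    rw [hω]
  have hfae : (fun ω => f (W₀ ω)) =ᵐ[P] fun ω => f (W ω) := by
    filter_upwards [hae] with ω hω
    rw [hω]
  rw [integral_congr_ae hfae, integrable_congr hfae]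
  refine ⟨fun hM => ?_, fun hM => ?_, fun hM => ?_⟩
  · obtain ⟨hf2, hf⟩ := LipCLT.lipschitz_hess_of_M_three_lt_top hM
    have key := fun hfin => h.error_le_of_lipschitz_hess hs hW hWm hcov' hf2
      ENNReal.toReal_nonneg hf hfin
    rw [ENNReal.ofReal_toReal hM.ne] at key
    refine ⟨(LipCLT.c2Growth_one_of_lipschitz_hess hf2 ENNReal.toReal_nonneg hf).polyBdd.integrable,
      fun hfin => (key hfin).1, ?_⟩
    rcases eq_or_ne (LipCLT.M 3 f / 2 * ∑' i, ∫⁻ ω, ‖X i ω‖ₑ ^ 3 ∂P) ∞ with hinf | hfin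
    · rw [hinf]; exact le_top
    · exact (key hfin.lt_top).2
  · obtain ⟨hfd, hf⟩ := LipCLT.lipschitz_fderiv_of_M_two_lt_top hM
    refine ⟨LipCLT.integrable_comp_of_lipschitz_fderiv hfd ENNReal.toReal_nonneg hf hZ2,
      LipCLT.integrable_comp_of_lipschitz_fderiv hfd ENNReal.toReal_nonneg hf hW2, ?_⟩
    have key := h.error_le_of_lipschitz_fderiv hs hW hWm hcov' hfd ENNReal.toReal_nonneg hf
    rwa [ENNReal.ofReal_toReal hM.ne] at key
  · have hf := LipCLT.lipschitz_of_M_one_lt_top hM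
    refine ⟨LipCLT.integrable_comp_of_lipschitz hf (hZ2.mono_exponent (by norm_num)),
      LipCLT.integrable_comp_of_lipschitz hf (hW2.mono_exponent (by norm_num)), ?_⟩
    have key := h.error_le_of_lipschitz hs hW hWm hcov' (by simpa using hd)
      ENNReal.toReal_nonneg hf
    rwa [ENNReal.ofReal_toReal hM.ne, finrank_euclideanSpace_fin] at key
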